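/- Let $d\in\{2,3\}$, let $a,b,\kappa,\lambda\in\mathbb R$, $c>0$, $\mu>0$, $\Gamma>0$, and consider on $\mathbb R^d$ the active liquid crystal system for a symmetric traceless matrix field $Q(t,x)\in\mathbb R^{d\times d}$, a velocity $u(t,x)\in\mathbb R^d$ and a pressure $P$: $$\begin{cases}\partial_tQ+(u\cdot\nabla)Q+Q\Omega-\Omega Q-\lambda|Q|D=\Gamma H,\\ \partial_tu+(u\cdot\nabla)u+\nabla P-\mu\Delta u=-\nabla\cdot(\nabla Q\odot\nabla Q)-\lambda\nabla\cdot(|Q|H)+\nabla\cdot(Q\Delta Q-\Delta Q\,Q)+\kappa\nabla\cdot Q,\\ \nabla\cdot u=0,\end{cases}$$ where $(\nabla u)_{\alpha\beta}=\partial_\beta u_\alpha$, $D=\frac12(\nabla u+\nabla u^\top)$, $\Omega=\frac12(\nabla u-\nabla u^\top)$, $|Q|=\sqrt{\operatorname{tr}(Q^2)}$, $(\nabla Q\odot\nabla Q)_{\alpha\beta}=\sum_{\gamma,\delta}\partial_\alpha Q_{\gamma\delta}\,\partial_\beta Q_{\gamma\delta}$, $(\nabla\cdot A)_\alpha=\sum_\beta\partial_\beta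 A_{\alpha\beta}$ and $$H=\Delta Q-aQ+b\Big(Q^2-\frac{\operatorname{tr}(Q^2)}{d}\mathrm I_d\Big)-cQ\operatorname{tr}(Q^2).$$ Let $\bar Q,\bar u$ be smooth with $(\bar Q,\bar u)\in H^1\times L^2$. Then there are constants $C_1,C_2,C_3,C_4>0$, depending only on $d,a,b,c,\kappa,\mu,\lambda,\Gamma$ and on $(\bar Q,\bar u)$, such that the following holds. Let $0<T\le\infty$ and let $(Q,u)$ be a smooth solution of the system on $[0,T)\times\mathbb R^d$ (smooth up to $t=0$) with $Q(0,\cdot)=\bar Q$, $u(0,\cdot)=\bar u$, such that, for every $0<S<T$, $$Q\in L^\infty(0,S;H^1)\cap L^2(0,S;H^2),\qquad u\in L^\infty(0,S;L^2)\cap L^2(0,S;H^1).$$ (As $|Q|$ need not be differentiable where $Q=0$, the momentum equation is understood for almost every $x$, at every $t\in(0,T)$, with $P(t,\cdot)$ locally Lipschitz.) Then, for every $0<t<T$, $$\|Q(t,\cdot)\|_{H^1}\le C_1e^{C_2t}\big(\|\bar Q\|_{H^1}^2+\|\bar u\|_{L^2}^2\big)$$ and $$\frac12\|u(t,\cdot)\|_{L^2}^2+\frac\mu4\int_0^t\|\nabla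 u(s,\cdot)\|_{L^2}^2\,ds\le C_3\big(\|\bar Q\|_{H^1}^2+\|\bar u\|_{L^2}^2\big)e^{C_2t}+C_4 .$$ -/

import Mathlib

open MeasureTheory Set
open scoped ENNReal ContDiff

noncomputable section

namespace ActiveLC

/-- The space `ℝᵈ` with its Euclidean norm and Lebesgue measure. -/
abbrev E (d : ℕ) : Type := EuclideanSpace ℝ (Fin d)

/-- Real `d × d` matrices. -/
abbrev Mat (d : ℕ) : Type := Matrix (Fin d) (Fin d) ℝ

variable {d : ℕ}

/-- The partial derivative `∂ₖ f` of a scalar function on `ℝᵈ`. -/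
def pd (k : Fin d) (f : E d → ℝ) (x : E d) : ℝ :=
  fderiv ℝ f x (EuclideanSpace.single k 1)

/-- The Laplacian `∂ₖ ∂ₖ f` of a scalar function. -/
def lap (f : E d → ℝ) (x : E d) : ℝ := ∑ k, pd k (pd k f) x

/-- The componentwise Laplacian `ΔQ` of a matrix field. -/
def matLap (Q : E d → Mat d) (x : E d) : Mat d :=
  Matrix.of fun i j => lap (fun y => Q y i j) x

/-- The row divergence `(∇ · A)_α = ∂_β A_{αβ}` of a matrix field. -/
def matDiv (A : E d → Mat d) (x : E d) (α : Fin d) : ℝ :=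
  ∑ β, pd β (fun y => A y α β) x

/-- The velocity gradient `(∇u)_{αβ} = ∂_β u_α`. -/
def gradU (u : E d → E d) (x : E d) : Mat d :=
  Matrix.of fun α β => pd β (fun y => u y α) x

/-- The divergence `∇ · u`. -/
def divU (u : E d → E d) (x : E d) : ℝ := ∑ α, pd α (fun y => u y α) x

/-- The symmetric part `D` of the velocity gradient. -/
def symPart (u : E d → E d) (x : E d) : Mat d :=
  (1 / 2 : ℝ) • (gradU u x + (gradU u x).transpose)

/-- The antisymmetric part `Ω` of the velocity gradient. -/
def skewPart (u : E d → E d) (x : E d) : Mat d :=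
  (1 / 2 : ℝ) • (gradU u x - (gradU u x).transpose)

/-- The square of the Frobenius norm, `|A|² = A_{αβ} A_{αβ}`. -/
def frobSq (A : Mat d) : ℝ := ∑ i, ∑ j, A i j ^ 2

/-- The Frobenius norm `|A|`. -/
def frob (A : Mat d) : ℝ := Real.sqrt (frobSq A)

/-- The molecular field `H = ΔQ - a Q + b (Q² - (tr Q² / d) I) - c Q tr(Q²)`. -/
def molField (a b c : ℝ) (Q : E d → Mat d) (x : E d) : Mat d :=
  matLap Q x - a • Q x
    + b • (Q x * Q x - ((Q x * Q x).trace / (d : ℝ)) • (1 : Mat d))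
    - c • ((Q x * Q x).trace • Q x)

/-- The tensor `(∇Q ⊙ ∇Q)_{αβ} = ∂_α Q_{γδ} ∂_β Q_{γδ}`. -/
def gradOdot (Q : E d → Mat d) (x : E d) : Mat d :=
  Matrix.of fun α β => ∑ γ, ∑ δ, pd α (fun y => Q y γ δ) x * pd β (fun y => Q y γ δ) x

/-- The transport term `(u · ∇) Q`. -/
def advectQ (u : E d → E d) (Q : E d → Mat d) (x : E d) : Mat d :=
  Matrix.of fun i j => ∑ k, u x k * pd k (fun y => Q y i j) x

/-- `|∇Q|² = ∂_δ Q_{αβ} ∂_δ Q_{αβ}`. -/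
def gradQSq (Q : E d → Mat d) (x : E d) : ℝ :=
  ∑ i, ∑ j, ∑ k, pd k (fun y => Q y i j) x ^ 2

/-- The sum of the squares of all second partial derivatives of all entries of `Q`. -/
def hessQSq (Q : E d → Mat d) (x : E d) : ℝ :=
  ∑ i, ∑ j, ∑ k, ∑ l, pd k (pd l (fun y => Q y i j)) x ^ 2

/-! The norms below are applied to smooth fields only, for which distributional and classical
derivatives agree. They take values in `[0, ∞]`; finiteness means membership in the space. -/

/-- `‖Q‖_{H¹}²`. -/
def h1Sq (Q : E d → Mat d) : ℝ≥0∞ :=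
  ∫⁻ x, ENNReal.ofReal (frobSq (Q x) + gradQSq Q x)

/-- `‖Q‖_{H¹}`. -/
def h1Norm (Q : E d → Mat d) : ℝ≥0∞ := h1Sq Q ^ (1 / 2 : ℝ)

/-- `‖Q‖_{H²}²`, up to equivalence of norms: each mixed second derivative is counted twice. -/
def h2Sq (Q : E d → Mat d) : ℝ≥0∞ :=
  ∫⁻ x, ENNReal.ofReal (frobSq (Q x) + gradQSq Q x + hessQSq Q x)

/-- `‖u‖_{L²}²`. -/
def l2Sq (u : E d → E d) : ℝ≥0∞ := ∫⁻ x, ENNReal.ofReal (‖u x‖ ^ 2)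

/-- `‖∇u‖_{L²}²`. -/
def gradL2Sq (u : E d → E d) : ℝ≥0∞ := ∫⁻ x, ENNReal.ofReal (frobSq (gradU u x))

/-- The class
`Q ∈ L^∞(0,S;H¹) ∩ L²(0,S;H²)`, `u ∈ L^∞(0,S;L²) ∩ L²(0,S;H¹)`. -/
structure InEnergyClass (S : ℝ) (Q : ℝ → E d → Mat d) (u : ℝ → E d → E d) : Prop where
  Q_LinftyH1 : ∃ K : ℝ, ∀ᵐ t ∂(volume.restrict (Ioo 0 S)), h1Sq (Q t) ≤ ENNReal.ofReal K
  Q_L2H2 : ∫⁻ t in Ioo 0 S, h2Sq (Q t) < ⊤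
  u_LinftyL2 : ∃ K : ℝ, ∀ᵐ t ∂(volume.restrict (Ioo 0 S)), l2Sq (u t) ≤ ENNReal.ofReal K
  u_L2H1 : ∫⁻ t in Ioo 0 S, (l2Sq (u t) + gradL2Sq (u t)) < ⊤

/-- The time interval `[0, T)`, where `T = ∞` is allowed. -/
def timeInterval (T : EReal) : Set ℝ := {t | 0 ≤ t ∧ (t : EReal) < T}

/-- The first equation of the system, at the point `(t, x)`:
`∂ₜQ + (u · ∇)Q + QΩ - ΩQ - λ|Q|D = Γ H`. -/
def QEquation (a b c lam Γ : ℝ) (Q : ℝ → E d → Mat d) (u : ℝ → E d → E d)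
    (t : ℝ) (x : E d) : Prop :=
  (Matrix.of fun i j => deriv (fun s => Q s x i j) t) + advectQ (u t) (Q t) x
      + Q t x * skewPart (u t) x - skewPart (u t) x * Q t x
      - (lam * frob (Q t x)) • symPart (u t) x
    = Γ • molField a b c (Q t) x

/-- The second equation of the system, at the point `(t, x)`:
`∂ₜu + (u · ∇)u + ∇P - μΔu
  = -∇·(∇Q ⊙ ∇Q) - λ∇·(|Q|H) + ∇·(QΔQ - ΔQ Q) + κ∇·Q`. -/
def uEquation (a b c κ μ lam : ℝ) (Q : ℝ → E d → Mat d) (u : ℝ → E d → E d)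
    (P : ℝ → E d → ℝ) (t : ℝ) (x : E d) : Prop :=
  ∀ α : Fin d,
    deriv (fun s => u s x α) t + ∑ β, u t x β * pd β (fun y => u t y α) x
        + pd α (P t) x - μ * lap (fun y => u t y α) x
      = - matDiv (gradOdot (Q t)) x α
        - lam * matDiv (fun y => frob (Q t y) • molField a b c (Q t) y) x α
        + matDiv (fun y => Q t y * matLap (Q t) y - matLap (Q t) y * Q t y) x α
        + κ * matDiv (Q t) x α

/-- `(Q, u)` is a smooth solution on `[0, T) × ℝᵈ` with initial data `(Q₀, u₀)`: it is smooth up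
to `t = 0`, `Q` is symmetric and traceless, the equations hold for `0 < t < T`, and `(Q, u)`
has finite energy on compact subintervals of `[0, T)`.
Since `Q ↦ |Q|` is Lipschitz but not differentiable at `0`, the field `|Q|H` of a smooth `Q` is in
general only locally Lipschitz, so differentiable almost everywhere; accordingly, the
momentum equation is required for almost every `x`, with a pressure that is locally Lipschitz
in `x`. Near points with `Q ≠ 0` this forces `P` to be smooth in `x` and the equation to hold
everywhere. -/
structure IsSmoothSolution (a b c κ μ lam Γ : ℝ) (T : EReal)
    (Q₀ : E d → Mat d) (u₀ : E d → E d)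
    (Q : ℝ → E d → Mat d) (u : ℝ → E d → E d) : Prop where
  smooth_Q : ∀ i j, ContDiffOn ℝ ∞ (fun p : ℝ × E d => Q p.1 p.2 i j)
    (timeInterval T ×ˢ univ)
  smooth_u : ContDiffOn ℝ ∞ (fun p : ℝ × E d => u p.1 p.2) (timeInterval T ×ˢ univ)
  symm_Q : ∀ t ∈ timeInterval T, ∀ x, (Q t x).IsSymm
  trace_Q : ∀ t ∈ timeInterval T, ∀ x, (Q t x).trace = 0
  init_Q : ∀ x, Q 0 x = Q₀ x
  init_u : ∀ x, u 0 x = u₀ x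
  eq_Q : ∀ t ∈ timeInterval T, 0 < t → ∀ x, QEquation a b c lam Γ Q u t x
  eq_u : ∃ P : ℝ → E d → ℝ, ∀ t ∈ timeInterval T, 0 < t →
    LocallyLipschitz (P t) ∧ ∀ᵐ x, uEquation a b c κ μ lam Q u P t x
  div_u : ∀ t ∈ timeInterval T, 0 < t → ∀ x, divU (u t) x = 0
  energyClass : ∀ S ∈ timeInterval T, InEnergyClass S Q u

end ActiveLC

end

/-!
The estimates come from the energy `e = ½|u|² + ½|∇Q|² + f(Q) + K/2 |Q|²`, where `f` is the bulk
energy `a/2 tr Q² - b/3 tr Q³ + c/4 (tr Q²)²` and `K` (`coerc`) is so large that `f(Q) + K/2 |Q|²`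
dominates `½|Q|² + c/8 |Q|⁴` (`le_bulk_add`). Write the velocity equation as `∂ₜu_α + ∂_β F_{αβ} =
-∂_α P` with the momentum flux `F` (`stress`). Pairing it with `u`, and the equation of `Q` with
the variational derivative of the energy, the couplings cancel (`energy_algebra`): `λ|Q|D` against
`λ∇·(|Q|H)`, and `QΩ - ΩQ` against `∇·(QΔQ - ΔQ Q)` because the bulk part of `H` commutes with `Q`.
The active term `κ∇·Q` is absorbed by the viscosity. What is left of `∂ₜe` besides a divergence is
bounded by `-μ/2 |∇u|² + rate · e` (`local_energy_balance`, `production_le_rate`). Integration over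
space, Grönwall's lemma and the bound of the initial energy by the data give both claims; for the
first one, the square root of the data is absorbed into the constant, which may depend on the data.

The solution is only known to lie in the energy class, and nothing is assumed on the pressure at
infinity. Hence the balance is localized with a cutoff `φ` of radius `R`, which leaves two errors.

* The flux terms are bounded by `|∇φ| (|u| + |∇Q|)` times a function (`dominant`) that the
  embeddings `H¹ ⊂ L⁴` and `H² ⊂ L^∞` bound in `L¹(0,S;L²)`
  (`exists_flux_le`, `exists_lintegral_dominant_sq_le`).
* The pressure tested with `φ u` is bounded by `‖F‖₂ ‖div (φ u)‖₂ = ‖F‖₂ ‖u · ∇φ‖₂`. To get this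
  without any growth condition on `P`, one starts from the equation tested with divergence-free
  fields (`weak_momentum`) and shows that it determines the pressure: if
  `U + div Φ`, with `U` weakly divergence-free and `U`, `Φ` in `L²`, annihilates divergence-free
  test fields, then it is the gradient of an `L²` function bounded by `Φ`, by a projection in `L²`
  and Liouville's theorem for weakly harmonic distributions (`pressure_estimate`,
  `eq_zero_of_weakly_harmonic`). Only `∂ₜu` is not known to be in `L²`, so the
  estimate is applied to difference quotients of `u` in time, and the limit is taken at Lebesgue
  points (`momentum_estimate`).

Both errors are `O(1/R)`, and `R → ∞` with Fatou's lemma (`IsSmoothSolution.energy_le`).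
-/

noncomputable section

namespace ActiveLC

variable {d : ℕ}

/-! ### Partial derivatives and integration by parts -/

lemma contDiff_pd {f : E d → ℝ} (hf : ContDiff ℝ ∞ f) (k : Fin d) : ContDiff ℝ ∞ (pd k f) :=
  (hf.fderiv_right (m := ∞) (by simp)).clm_apply contDiff_const

lemma contDiff_lap {f : E d → ℝ} (hf : ContDiff ℝ ∞ f) : ContDiff ℝ ∞ (lap f) :=
  ContDiff.sum fun k _ => contDiff_pd (contDiff_pd hf k) k

lemma hasCompactSupport_pd {f : E d → ℝ} (hf : HasCompactSupport f) (k : Fin d) :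
    HasCompactSupport (pd k f) :=
  hf.fderiv_apply ℝ _

lemma pd_add {f g : E d → ℝ} {x : E d} (hf : DifferentiableAt ℝ f x)
    (hg : DifferentiableAt ℝ g x) (k : Fin d) :
    pd k (fun y => f y + g y) x = pd k f x + pd k g x := by
  simp [pd, fderiv_fun_add hf hg]

lemma pd_sub {f g : E d → ℝ} {x : E d} (hf : DifferentiableAt ℝ f x)
    (hg : DifferentiableAt ℝ g x) (k : Fin d) :
    pd k (fun y => f y - g y) x = pd k f x - pd k g x := by
  simp [pd, fderiv_fun_sub hf hg]

lemma pd_neg (f : E d → ℝ) (k : Fin d) (x : E d) :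
    pd k (fun y => -f y) x = -pd k f x := by
  simp [pd, fderiv_fun_neg]

lemma pd_mul {f g : E d → ℝ} {x : E d} (hf : DifferentiableAt ℝ f x)
    (hg : DifferentiableAt ℝ g x) (k : Fin d) :
    pd k (fun y => f y * g y) x = f x * pd k g x + pd k f x * g x := by
  simp [pd, fderiv_fun_mul hf hg, mul_comm]

lemma pd_const_mul {f : E d → ℝ} {x : E d} (hf : DifferentiableAt ℝ f x) (c : ℝ) (k : Fin d) :
    pd k (fun y => c * f y) x = c * pd k f x := by
  simp [pd, fderiv_const_mul hf]

lemma pd_sum {ι : Type*} (s : Finset ι) {f : ι → E d → ℝ} {x : E d}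
    (hf : ∀ i ∈ s, DifferentiableAt ℝ (f i) x) (k : Fin d) :
    pd k (fun y => ∑ i ∈ s, f i y) x = ∑ i ∈ s, pd k (f i) x := by
  simp [pd, fderiv_fun_sum hf]

lemma pd_pow {f : E d → ℝ} {x : E d} (hf : DifferentiableAt ℝ f x) (n : ℕ) (k : Fin d) :
    pd k (fun y => f y ^ n) x = n * f x ^ (n - 1) * pd k f x := by
  simp [pd, fderiv_fun_pow n hf]

lemma pd_const (c : ℝ) (k : Fin d) (x : E d) : pd k (fun _ => c) x = 0 := by
  simp [pd]

lemma pd_comm {f : E d → ℝ} (hf : ContDiff ℝ ∞ f) (k l : Fin d) (x : E d) :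
    pd k (pd l f) x = pd l (pd k f) x := by
  have h1 : ∀ i j : Fin d, pd i (pd j f) x
      = fderiv ℝ (fderiv ℝ f) x (EuclideanSpace.single i 1) (EuclideanSpace.single j 1) := by
    intro i j
    have : DifferentiableAt ℝ (fderiv ℝ f) x :=
      ((hf.fderiv_right (m := ∞) (by simp)).differentiable (by simp)) x
    simp only [pd]
    have h2 : pd j f = fun y => fderiv ℝ f y (EuclideanSpace.single j 1) := rfl
    rw [h2, fderiv_clm_apply this (by fun_prop)]
    simp
  rw [h1, h1]
  have := (hf.contDiffAt (x := x)).isSymmSndFDerivAt (by simpa using (WithTop.coe_le_coe.2 (le_top : (2 : ℕ∞) ≤ ⊤)))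
  exact this _ _

/-- The functions of compact support and class `C^∞`, the test functions of the proof. -/
structure IsTest (f : E d → ℝ) : Prop where
  smooth : ContDiff ℝ ∞ f
  compact : HasCompactSupport f

namespace IsTest

lemma pderiv {f : E d → ℝ} (hf : IsTest f) (k : Fin d) : IsTest (pd k f) :=
  ⟨contDiff_pd hf.1 k, hasCompactSupport_pd hf.2 k⟩

lemma mul_left {f g : E d → ℝ} (hf : IsTest f) (hg : ContDiff ℝ ∞ g) :
    IsTest (fun x => f x * g x) :=
  ⟨hf.1.mul hg, hf.2.mul_right⟩

lemma add {f g : E d → ℝ} (hf : IsTest f) (hg : IsTest g) : IsTest (fun x => f x + g x) :=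
  ⟨hf.1.add hg.1, hf.2.add hg.2⟩

lemma const_mul {f : E d → ℝ} (hf : IsTest f) (c : ℝ) : IsTest (fun x => c * f x) :=
  ⟨contDiff_const.mul hf.1, hf.2.mul_left⟩

lemma neg {f : E d → ℝ} (hf : IsTest f) : IsTest (fun x => - f x) := by
  simpa using hf.const_mul (-1)

lemma sub {f g : E d → ℝ} (hf : IsTest f) (hg : IsTest g) : IsTest (fun x => f x - g x) := by
  simpa [sub_eq_add_neg] using hf.add hg.neg

lemma zero : IsTest (fun _ : E d => (0 : ℝ)) :=
  ⟨contDiff_const, HasCompactSupport.zero⟩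

lemma sum {ι : Type*} (s : Finset ι) {f : ι → E d → ℝ} (hf : ∀ i ∈ s, IsTest (f i)) :
    IsTest (fun x => ∑ i ∈ s, f i x) := by
  classical
  induction s using Finset.induction_on with
  | empty => simpa using zero
  | insert a s ha ih =>
    simp only [Finset.sum_insert ha]
    exact (hf a (by simp)).add (ih fun i hi => hf i (by simp [hi]))

lemma laplacian {f : E d → ℝ} (hf : IsTest f) : IsTest (lap f) :=
  sum _ fun k _ => (hf.pderiv k).pderiv k

lemma differentiable {f : E d → ℝ} (hf : IsTest f) : Differentiable ℝ f :=
  hf.1.differentiable (by simp)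

lemma continuous {f : E d → ℝ} (hf : IsTest f) : Continuous f := hf.1.continuous

lemma integrable_mul {f g : E d → ℝ} (hf : IsTest f) (hg : Continuous g) :
    Integrable (fun x => f x * g x) :=
  (hf.continuous.mul hg).integrable_of_hasCompactSupport hf.2.mul_right

lemma integrable {f : E d → ℝ} (hf : IsTest f) : Integrable f :=
  hf.continuous.integrable_of_hasCompactSupport hf.2

lemma memLp {f : E d → ℝ} (hf : IsTest f) (p : ℝ≥0∞) : MemLp f p :=
  hf.continuous.memLp_of_hasCompactSupport hf.2

end IsTest

lemma IsTest.integral_pd {f : E d → ℝ} (hf : IsTest f) (k : Fin d) : ∫ x, pd k f x = 0 := by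
  obtain ⟨r, hr⟩ := hf.2.isCompact.isBounded.subset_closedBall 0
  have h := integral_mul_fderiv_eq_neg_fderiv_mul_of_integrable (𝕜 := ℝ) (μ := volume)
    (f := fun _ : E d => (1 : ℝ)) (g := f) (v := EuclideanSpace.single k 1)
    (by simp) (by simpa using! (hf.pderiv k).integrable) (by simpa using hf.integrable)
    (fun x _ => by fun_prop) (fun x _ => hf.differentiable x)
  simpa [pd] using h

/-- A locally Lipschitz function agrees near the ball of a given radius with a globally Lipschitz
one. -/
lemma exists_lipschitz_eqOn {f : E d → ℝ} (hf : LocallyLipschitz f) (r : ℝ) :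
    ∃ (K : NNReal) (g : E d → ℝ), LipschitzWith K g ∧ EqOn f g (Metric.closedBall 0 r) := by
  obtain ⟨K, hK⟩ := LocallyLipschitzOn.exists_lipschitzOnWith_of_compact
    (isCompact_closedBall (0 : E d) r) (hf.locallyLipschitzOn (s := _))
  obtain ⟨g, hg, hfg⟩ := hK.extend_real
  exact ⟨K, g, hg, hfg⟩

lemma ae_differentiableAt_of_locallyLipschitz {f : E d → ℝ} (hf : LocallyLipschitz f) :
    ∀ᵐ x, DifferentiableAt ℝ f x := by
  have h : ∀ n : ℕ, ∀ᵐ x : E d, x ∈ Metric.ball (0 : E d) n → DifferentiableAt ℝ f x := by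
    intro n
    obtain ⟨K, g, hg, hfg⟩ := exists_lipschitz_eqOn hf n
    filter_upwards [hg.ae_differentiableAt] with x hx hxn
    refine hx.congr_of_eventuallyEq ?_
    filter_upwards [Metric.isOpen_ball.mem_nhds hxn] with y hy
    exact hfg (Metric.ball_subset_closedBall hy)
  filter_upwards [ae_all_iff.2 h] with x hx
  obtain ⟨n, hn⟩ := exists_nat_gt ‖x‖
  exact hx n (by simpa using hn)

/-- Integration by parts of a locally Lipschitz function against a test function. -/
lemma IsTest.integral_pd_mul {f g : E d → ℝ} (hg : IsTest g) (hf : LocallyLipschitz f)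
    (k : Fin d) :
    Integrable (fun x => pd k f x * g x) ∧ ∫ x, pd k f x * g x = - ∫ x, f x * pd k g x := by
  obtain ⟨r, hr⟩ := hg.2.isCompact.isBounded.subset_ball 0
  obtain ⟨K, f', hf', hff'⟩ := exists_lipschitz_eqOn hf r
  obtain ⟨D, hD⟩ := hg.1.lipschitzWith_of_hasCompactSupport hg.2 (by simp)
  have hz : ∀ x, x ∉ Metric.ball (0 : E d) r → x ∉ tsupport g := fun x hx h => hx (hr h)
  have hg0 : ∀ x, x ∉ Metric.ball (0 : E d) r → g x = 0 :=
    fun x hx => image_eq_zero_of_notMem_tsupport (hz x hx)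
  have hpg0 : ∀ x, x ∉ Metric.ball (0 : E d) r → pd k g x = 0 := by
    intro x hx
    refine image_eq_zero_of_notMem_tsupport (fun h => hz x hx ?_)
    exact tsupport_fderiv_apply_subset ℝ _ h
  have e1 : (fun x => pd k f x * g x) =ᵐ[volume]
      fun x => lineDeriv ℝ f' x (EuclideanSpace.single k 1) * g x := by
    filter_upwards [hf'.ae_differentiableAt] with x hx
    by_cases hxr : x ∈ Metric.ball (0 : E d) r
    · have : f =ᶠ[nhds x] f' := by
        filter_upwards [Metric.isOpen_ball.mem_nhds hxr] with y hy
        exact hff' (Metric.ball_subset_closedBall hy)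
      rw [pd, this.fderiv_eq, hx.lineDeriv_eq_fderiv]
    · simp [hg0 x hxr]
  constructor
  · refine Integrable.congr ?_ e1.symm
    have hb : ∀ x, ‖lineDeriv ℝ f' x (EuclideanSpace.single k 1)‖ ≤ K * ‖EuclideanSpace.single k (1:ℝ)‖ := by
      intro x
      exact norm_lineDeriv_le_of_lipschitz ℝ hf'
    exact hg.integrable.bdd_mul
      (measurable_lineDeriv hf'.continuous).aestronglyMeasurable (Filter.Eventually.of_forall hb)
  · rw [integral_congr_ae e1, hf'.integral_lineDeriv_mul_eq hD hg.2, ← integral_neg]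
    congr 1
    ext x
    rw [(hg.differentiable x).lineDeriv_eq_fderiv, map_neg]
    by_cases hxr : x ∈ Metric.ball (0 : E d) r
    · rw [hff' (Metric.ball_subset_closedBall hxr), pd]; ring
    · have := hpg0 x hxr
      rw [pd] at this ⊢
      rw [this]; ring

lemma IsTest.integral_pd_mul' {f g : E d → ℝ} (hg : IsTest g) (hf : ContDiff ℝ ∞ f)
    (k : Fin d) : ∫ x, pd k f x * g x = - ∫ x, f x * pd k g x :=
  (hg.integral_pd_mul (hf.of_le (by simp)).locallyLipschitz k).2

/-! ### Cutoff functions -/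

/-- A smooth cutoff equal to `1` on the unit ball and supported in the ball of radius `2`. -/
def unitBump (d : ℕ) : ContDiffBump (0 : E d) := ⟨1, 2, by norm_num, by norm_num⟩

/-- The cutoff `x ↦ χ (x / R)`. -/
def cutoff (R : ℝ) (x : E d) : ℝ := unitBump d (R⁻¹ • x)

lemma cutoff_isTest {R : ℝ} (hR : 0 < R) : IsTest (cutoff (d := d) R) := by
  constructor
  · exact (unitBump d).contDiff.comp (contDiff_const_smul R⁻¹)
  · exact (unitBump d).hasCompactSupport.comp_homeomorph (Homeomorph.smulOfNeZero R⁻¹ (inv_ne_zero hR.ne'))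

lemma cutoff_nonneg (R : ℝ) (x : E d) : 0 ≤ cutoff R x := (unitBump d).nonneg

lemma cutoff_le_one (R : ℝ) (x : E d) : cutoff R x ≤ 1 := (unitBump d).le_one

lemma cutoff_eq_one {R : ℝ} (hR : 0 < R) {x : E d} (hx : ‖x‖ ≤ R) : cutoff R x = 1 := by
  apply (unitBump d).one_of_mem_closedBall
  simp only [unitBump, Metric.mem_closedBall, dist_zero_right, norm_smul, norm_inv, Real.norm_eq_abs,
    abs_of_pos hR]
  rw [inv_mul_le_iff₀ hR]; simpa using hx

lemma pd_cutoff (R : ℝ) (k : Fin d) (x : E d) :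
    pd k (cutoff R) x = R⁻¹ * pd k (unitBump d) (R⁻¹ • x) := by
  have : cutoff (d := d) R = fun x => unitBump d (R⁻¹ • x) := rfl
  rw [pd, this, fderiv_comp_smul]
  simp [pd]

lemma unitBump_isTest : IsTest (unitBump d : E d → ℝ) :=
  ⟨(unitBump d).contDiff, (unitBump d).hasCompactSupport⟩

lemma exists_pd_cutoff_le (d : ℕ) : ∃ C : ℝ, 0 < C ∧ ∀ R : ℝ, 0 < R → ∀ (k : Fin d) (x : E d),
    |pd k (cutoff R) x| ≤ C / R := by
  have h : ∀ k : Fin d, ∃ C, ∀ x, ‖pd k (unitBump d) x‖ ≤ C := fun k =>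
    ((unitBump_isTest.pderiv k).continuous.bounded_above_of_compact_support (unitBump_isTest.pderiv k).2)
  choose C hC using h
  refine ⟨∑ k, |C k| + 1, by positivity, fun R hR k x => ?_⟩
  rw [pd_cutoff, abs_mul, abs_of_pos (inv_pos.2 hR), inv_mul_eq_div]
  gcongr
  have h1 := hC k (R⁻¹ • x)
  have h2 : |C k| ≤ ∑ k, |C k| := Finset.single_le_sum (f := fun k => |C k|) (fun _ _ => abs_nonneg _) (Finset.mem_univ k)
  have h3 := le_abs_self (C k)
  rw [Real.norm_eq_abs] at h1
  linarith

lemma tendsto_cutoff (x : E d) :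
    Filter.Tendsto (fun n : ℕ => cutoff ((n : ℝ) + 1) x) Filter.atTop (nhds 1) := by
  refine tendsto_const_nhds.congr' ?_
  obtain ⟨N, hN⟩ := exists_nat_ge ‖x‖
  filter_upwards [Filter.eventually_ge_atTop N] with n hn
  refine (cutoff_eq_one (by positivity) ?_).symm
  have : (N : ℝ) ≤ n := by exact_mod_cast hn
  linarith

/-! ### Square-integrable harmonic distributions vanish -/

lemma lintegral_mul_sq_le {α : Type*} [MeasurableSpace α] {ν : Measure α} {f g : α → ℝ≥0∞}
    (hf : AEMeasurable f ν) (hg : AEMeasurable g ν) :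
    (∫⁻ x, f x * g x ∂ν) ^ 2 ≤ (∫⁻ x, f x ^ 2 ∂ν) * ∫⁻ x, g x ^ 2 ∂ν := by
  have h := ENNReal.lintegral_mul_le_Lp_mul_Lq ν Real.HolderConjugate.two_two hf hg
  simp only [Pi.mul_apply, ENNReal.rpow_two] at h
  calc _ ≤ ((∫⁻ x, f x ^ 2 ∂ν) ^ (1 / 2 : ℝ) * (∫⁻ x, g x ^ 2 ∂ν) ^ (1 / 2 : ℝ)) ^ 2 := by gcongr
    _ = _ := by
      rw [mul_pow, ← ENNReal.rpow_two, ← ENNReal.rpow_two, ← ENNReal.rpow_mul, ← ENNReal.rpow_mul]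
      norm_num

lemma memLp_two_of_lintegral {α : Type*} [MeasurableSpace α] {ν : Measure α} {f : α → ℝ}
    (hf : AEStronglyMeasurable f ν) (h : ∫⁻ x, ‖f x‖ₑ ^ 2 ∂ν < ⊤) : MemLp f 2 ν := by
  refine ⟨hf, ?_⟩
  rw [eLpNorm_lt_top_iff_lintegral_rpow_enorm_lt_top (by simp) (by simp)]
  simpa using h

lemma lintegral_sq_lt_top_of_memLp {α : Type*} [MeasurableSpace α] {ν : Measure α} {f : α → ℝ}
    (h : MemLp f 2 ν) : ∫⁻ x, ‖f x‖ₑ ^ 2 ∂ν < ⊤ := by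
  have := (eLpNorm_lt_top_iff_lintegral_rpow_enorm_lt_top (by simp) (by simp)).1 h.2
  simpa using this

lemma fderiv_apply_eq_sum (f : E d → ℝ) (x v : E d) :
    fderiv ℝ f x v = ∑ k, v k * pd k f x := by
  have hv : v = ∑ k, v k • EuclideanSpace.single k (1 : ℝ) := by
    conv_lhs => rw [← (EuclideanSpace.basisFun (Fin d) ℝ).sum_repr v]
    simp
  conv_lhs => rw [hv]
  simp [pd]

/-- The convolution `U * ρ`. -/
def conv (U ρ : E d → ℝ) (x : E d) : ℝ := ∫ y, U y * ρ (x - y)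

lemma conv_eq (U ρ : E d → ℝ) :
    conv U ρ = convolution U ρ (ContinuousLinearMap.lsmul ℝ ℝ) volume := by
  ext x; simp [conv, convolution]

lemma contDiff_conv {U ρ : E d → ℝ} (hU : MemLp U 2) (hρ : IsTest ρ) : ContDiff ℝ ∞ (conv U ρ) := by
  rw [conv_eq]
  exact hρ.2.contDiff_convolution_right _ (hU.locallyIntegrable (by norm_num)) hρ.1

lemma pd_conv {U ρ : E d → ℝ} (hU : MemLp U 2) (hρ : IsTest ρ) (k : Fin d) :
    pd k (conv U ρ) = conv U (pd k ρ) := by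
  ext x
  have hl := hU.locallyIntegrable (by norm_num)
  rw [pd, conv_eq, conv_eq]
  rw [(hρ.2.hasFDerivAt_convolution_right (ContinuousLinearMap.lsmul ℝ ℝ) hl
    (hρ.1.of_le (by simp)) x).fderiv]
  rw [convolution_precompR_apply _ hl (hρ.2.fderiv ℝ) (hρ.1.continuous_fderiv (by simp))]
  rfl

lemma memLp_conv {U ρ : E d → ℝ} (hU : MemLp U 2) (hρ : IsTest ρ) : MemLp (conv U ρ) 2 := by
  refine memLp_two_of_lintegral (contDiff_conv hU hρ).continuous.aestronglyMeasurable ?_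
  set I := ∫⁻ y, ‖ρ y‖ₑ with hI
  have hI1 : I < ⊤ := hρ.integrable.2
  have hUm : AEMeasurable (fun y => ‖U y‖ₑ) := hU.1.enorm
  have hρm : Measurable (fun y => ‖ρ y‖ₑ) := hρ.continuous.measurable.enorm
  have hIx : ∀ x, ∫⁻ y, ‖ρ (x - y)‖ₑ = I := fun x => by
    rw [hI]; exact lintegral_sub_left_eq_self (fun y => ‖ρ y‖ₑ) x
  have key : ∀ x, ‖conv U ρ x‖ₑ ^ 2 ≤ (∫⁻ y, ‖U y‖ₑ ^ 2 * ‖ρ (x - y)‖ₑ) * I := by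
    intro x
    have hm : Measurable (fun y => ‖ρ (x - y)‖ₑ) := hρm.comp (by fun_prop)
    have h1 : ‖conv U ρ x‖ₑ ≤ ∫⁻ y, (‖U y‖ₑ * ‖ρ (x - y)‖ₑ ^ (1 / 2 : ℝ)) * ‖ρ (x - y)‖ₑ ^ (1 / 2 : ℝ) := by
      refine (enorm_integral_le_lintegral_enorm _).trans (lintegral_mono fun y => ?_)
      rw [enorm_mul, mul_assoc, ← ENNReal.rpow_add_of_nonneg _ _ (by norm_num) (by norm_num)]
      norm_num
    calc _ ≤ _ := pow_le_pow_left' h1 2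
      _ ≤ _ := lintegral_mul_sq_le (hUm.mul (hm.pow_const _).aemeasurable) (hm.pow_const _).aemeasurable
      _ = _ := by
        simp_rw [mul_pow, ← ENNReal.rpow_two, ← ENNReal.rpow_mul]
        norm_num [hIx]
  calc _ ≤ ∫⁻ x, (∫⁻ y, ‖U y‖ₑ ^ 2 * ‖ρ (x - y)‖ₑ) * I := lintegral_mono key
    _ = (∫⁻ x, (∫⁻ y, ‖U y‖ₑ ^ 2 * ‖ρ (x - y)‖ₑ)) * I := lintegral_mul_const' _ _ hI1.ne
    _ = (∫⁻ y, (∫⁻ x, ‖U y‖ₑ ^ 2 * ‖ρ (x - y)‖ₑ)) * I := by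
      rw [lintegral_lintegral_swap]
      have h1 : AEMeasurable (fun p : E d × E d => ‖U p.2‖ₑ) (volume.prod volume) :=
        hUm.comp_quasiMeasurePreserving Measure.quasiMeasurePreserving_snd
      exact (h1.pow_const 2).mul (hρm.comp (by fun_prop)).aemeasurable
    _ = (∫⁻ y, ‖U y‖ₑ ^ 2 * I) * I := by
      congr 2; ext y
      rw [lintegral_const_mul' _ _ (by simp), hI]
      congr 1
      exact lintegral_sub_right_eq_self (fun y => ‖ρ y‖ₑ) y
    _ = (∫⁻ y, ‖U y‖ₑ ^ 2) * I * I := by rw [lintegral_mul_const' _ _ hI1.ne]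
    _ < ⊤ := ENNReal.mul_lt_top (ENNReal.mul_lt_top (lintegral_sq_lt_top_of_memLp hU) hI1) hI1

/-- By the Caccioppoli inequality, the gradient of a harmonic function has on a ball of radius `R`
an `L²` norm of order `1/R` times that of the function. -/
lemma pd_eq_zero_of_harmonic {m : E d → ℝ} (hm : ContDiff ℝ ∞ m) (hm2 : MemLp m 2)
    (hh : ∀ x, lap m x = 0) (k : Fin d) (x : E d) : pd k m x = 0 := by
  obtain ⟨C, hC, hCR⟩ := exists_pd_cutoff_le d
  have hcm := hm.continuous
  have hpc : ∀ k, Continuous (pd k m) := fun k => (contDiff_pd hm k).continuous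
  have hpc2 : ∀ k, Continuous (fun x => pd k m x ^ 2) := fun k => (hpc k).pow 2
  have hpcm : ∀ (R : ℝ), 0 < R → ∀ k,
      Integrable fun x => cutoff R x * (pd k (cutoff R) x * (m x * pd k m x)) := fun R hR k =>
    (cutoff_isTest hR).integrable_mul
      (((cutoff_isTest hR).pderiv k).continuous.mul (hcm.mul (hpc k)))
  have hm2i : Integrable (fun x => m x ^ 2) := by simpa using hm2.integrable_sq
  -- the Caccioppoli inequality
  have cacc : ∀ R : ℝ, 0 < R →
      ∑ k, ∫ x, cutoff R x ^ 2 * pd k m x ^ 2 ≤ 4 * d * C ^ 2 / R ^ 2 * ∫ x, m x ^ 2 := by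
    intro R hR
    have hφ := cutoff_isTest (d := d) hR
    have hφ2 : IsTest (fun x => cutoff (d := d) R x ^ 2) := by
      simpa [pow_two] using hφ.mul_left hφ.1
    have ibp : ∀ k, ∫ x, pd k (pd k m) x * (cutoff R x ^ 2 * m x)
        = - ((∫ x, cutoff R x ^ 2 * pd k m x ^ 2)
          + ∫ x, 2 * (cutoff R x * pd k (cutoff R) x * (m x * pd k m x))) := by
      intro k
      rw [(hφ2.mul_left hm).integral_pd_mul' (contDiff_pd hm k), ← integral_add]
      · congr 1; congr 1; ext x
        rw [pd_mul (hφ2.differentiable x) (hm.differentiable (by simp) x),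
          pd_pow (hφ.differentiable x)]
        push_cast; ring
      · exact hφ2.integrable_mul (hpc2 k)
      · exact (hpcm R hR k).const_mul 2 |>.congr
          (by filter_upwards with x; ring)
    have hsum : ∑ k, ∫ x, pd k (pd k m) x * (cutoff R x ^ 2 * m x) = 0 := by
      rw [← integral_finsetSum]
      · rw [← integral_zero (E d) ℝ]
        congr 1; ext x
        rw [← Finset.sum_mul]
        have := hh x
        rw [lap] at this; rw [this]; simp
      · intro k _
        exact ((hφ2.mul_left hm).integrable_mul (contDiff_pd (contDiff_pd hm k) k).continuous).congr
          (by filter_upwards with x; ring)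
    simp only [ibp, Finset.sum_neg_distrib, Finset.sum_add_distrib] at hsum
    have hb : ∀ k, - ∫ x, 2 * (cutoff R x * pd k (cutoff R) x * (m x * pd k m x))
        ≤ 1 / 2 * (∫ x, cutoff R x ^ 2 * pd k m x ^ 2) + 2 * (C ^ 2 / R ^ 2) * ∫ x, m x ^ 2 := by
      intro k
      rw [← integral_neg, ← integral_const_mul, ← integral_const_mul, ← integral_add]
      · apply integral_mono
        · exact (((hpcm R hR k).const_mul 2).neg).congr
            (by filter_upwards with x; simp; ring)
        · exact ((hφ2.integrable_mul (hpc2 k)).const_mul _).add (hm2i.const_mul _)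
        · intro x
          have h1 := hCR R hR k x
          have h2 : pd k (cutoff R) x ^ 2 ≤ C ^ 2 / R ^ 2 := by
            rw [← div_pow, ← sq_abs]
            gcongr
          have h3 := mul_le_mul_of_nonneg_right h2 (sq_nonneg (m x))
          simp only
          nlinarith [sq_nonneg (cutoff R x * pd k m x + 2 * (pd k (cutoff R) x * m x))]
      · exact (hφ2.integrable_mul (hpc2 k)).const_mul _
      · exact hm2i.const_mul _
    have hb' := Finset.sum_le_sum fun k (_ : k ∈ Finset.univ) => hb k
    rw [Finset.sum_neg_distrib, Finset.sum_add_distrib, ← Finset.mul_sum, Finset.sum_const] at hb'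
    simp only [Finset.card_univ, Fintype.card_fin, nsmul_eq_mul] at hb'
    have : 4 * d * C ^ 2 / R ^ 2 * ∫ x, m x ^ 2
        = 2 * (d * (2 * (C ^ 2 / R ^ 2) * ∫ x, m x ^ 2)) := by ring
    rw [this]
    linarith
  -- hence the integral over a fixed ball vanishes
  set r : ℝ := ‖x‖ + 1 with hr
  have hr0 : 0 < r := by positivity
  have hφ := cutoff_isTest (d := d) hr0
  have hφ2 : IsTest (fun x => cutoff (d := d) r x ^ 2) := by
    simpa [pow_two] using hφ.mul_left hφ.1
  have hi := hφ2.integrable_mul (hpc2 k)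
  have hle : ∀ R : ℝ, 2 * r ≤ R →
      ∫ x, cutoff r x ^ 2 * pd k m x ^ 2 ≤ 4 * d * C ^ 2 / R ^ 2 * ∫ x, m x ^ 2 := by
    intro R hR
    have hR0 : 0 < R := by linarith
    have hψ := cutoff_isTest (d := d) hR0
    have hψ2 : IsTest (fun x => cutoff (d := d) R x ^ 2) := by
      simpa [pow_two] using hψ.mul_left hψ.1
    refine le_trans ?_ (cacc R hR0)
    refine le_trans ?_ (Finset.single_le_sum (f := fun k => ∫ x, cutoff R x ^ 2 * pd k m x ^ 2)
      (fun k _ => integral_nonneg fun x => by positivity) (Finset.mem_univ k))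
    apply integral_mono hi (hψ2.integrable_mul (hpc2 k))
    intro y
    simp only
    refine mul_le_mul_of_nonneg_right (pow_le_pow_left₀ (cutoff_nonneg _ _) ?_ 2) (sq_nonneg _)
    by_cases hy : ‖y‖ ≤ R
    · rw [cutoff_eq_one hR0 hy]; exact cutoff_le_one _ _
    · have : cutoff r y = 0 := by
        apply (unitBump d).zero_of_le_dist
        simp only [unitBump, dist_zero_right, norm_smul, norm_inv, Real.norm_eq_abs, abs_of_pos hr0]
        rw [le_inv_mul_iff₀ hr0]; linarith [not_le.1 hy]
      rw [this]; exact cutoff_nonneg _ _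
  have hlim : Filter.Tendsto (fun R : ℝ => 4 * d * C ^ 2 / R ^ 2 * ∫ x, m x ^ 2) Filter.atTop
      (nhds 0) := by
    have : Filter.Tendsto (fun R : ℝ => 4 * d * C ^ 2 / R ^ 2) Filter.atTop (nhds 0) :=
      Filter.Tendsto.div_atTop tendsto_const_nhds (Filter.tendsto_pow_atTop (by norm_num))
    simpa using this.mul_const (∫ x, m x ^ 2)
  have hz : ∫ x, cutoff r x ^ 2 * pd k m x ^ 2 ≤ 0 :=
    ge_of_tendsto hlim (by filter_upwards [Filter.eventually_ge_atTop (2 * r)] with R hR using hle R hR)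
  have hz0 : ∫ x, cutoff r x ^ 2 * pd k m x ^ 2 = 0 :=
    le_antisymm hz (integral_nonneg fun x => by positivity)
  have hcont : Continuous (fun x => cutoff r x ^ 2 * pd k m x ^ 2) :=
    hφ2.continuous.mul (hpc2 k)
  have := (hcont.ae_eq_iff_eq volume continuous_const).1
    ((integral_eq_zero_iff_of_nonneg (fun x => mul_nonneg (sq_nonneg _) (sq_nonneg _)) hi).1 hz0)
  have h : cutoff r x ^ 2 * pd k m x ^ 2 = 0 := congrFun this x
  rw [cutoff_eq_one hr0 (by rw [hr]; linarith), one_pow, one_mul] at h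
  exact (pow_eq_zero_iff two_ne_zero).1 h

lemma eq_zero_of_harmonic (hd : 0 < d) {m : E d → ℝ} (hm : ContDiff ℝ ∞ m) (hm2 : MemLp m 2)
    (hh : ∀ x, lap m x = 0) (x : E d) : m x = 0 := by
  have hf : ∀ x, fderiv ℝ m x = 0 := by
    intro x
    ext v
    rw [fderiv_apply_eq_sum]
    simp [pd_eq_zero_of_harmonic hm hm2 hh]
  have hconst : m = fun _ => m x := by
    ext y
    exact is_const_of_fderiv_eq_zero (hm.differentiable (by simp)) hf y x
  rw [hconst] at hm2
  have : Nonempty (Fin d) := ⟨⟨0, hd⟩⟩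
  rcases (memLp_const_iff (by simp) (by simp)).1 hm2 with h | h
  · exact h
  · simp at h

/-- A distribution of the form `U + ∑ ∂ₖ Wₖ` with `U, Wₖ ∈ L²` that is harmonic is zero. Its
convolution with a test function is a classical harmonic function in `L²`. -/
lemma eq_zero_of_weakly_harmonic (hd : 0 < d) {U : E d → ℝ} {W : Fin d → E d → ℝ}
    (hU : MemLp U 2) (hW : ∀ k, MemLp (W k) 2)
    (h : ∀ η : E d → ℝ, IsTest η → (∫ x, U x * lap η x) - ∑ k, ∫ x, W k x * pd k (lap η) x = 0)
    {f : E d → ℝ} (hf : IsTest f) : (∫ x, U x * f x) - ∑ k, ∫ x, W k x * pd k f x = 0 := by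
  have hrefl : ∀ {g : E d → ℝ}, IsTest g → ∀ z : E d, IsTest (fun y => g (z - y)) := fun hg z =>
    ⟨hg.1.comp (contDiff_const.sub contDiff_id), hg.2.comp_homeomorph (Homeomorph.subLeft z)⟩
  have hpd : ∀ {g : E d → ℝ}, IsTest g → ∀ (z : E d) (k : Fin d) (y : E d),
      pd k (fun y => g (z - y)) y = - pd k g (z - y) := by
    intro g hg z k y
    simp only [pd]
    rw [show (fun y => g (z - y)) = g ∘ (fun y => z - y) from rfl,
      fderiv_comp y (hg.differentiable _) (by fun_prop)]
    rw [fderiv_const_sub]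
    simp
  have hlap : ∀ {g : E d → ℝ}, IsTest g → ∀ (z : E d) (y : E d),
      lap (fun y => g (z - y)) y = lap g (z - y) := by
    intro g hg z y
    refine Finset.sum_congr rfl fun k _ => ?_
    rw [show pd k (fun y => g (z - y)) = fun y => - pd k g (z - y) from funext (hpd hg z k),
      pd_neg, hpd (hg.pderiv k), neg_neg]
  -- the convolutions with the reflection `ρ` take at `0` the values of the distribution at `f`
  set ρ : E d → ℝ := fun y => f (0 - y) with hρdef
  have hρ : IsTest ρ := hrefl hf 0
  set m : E d → ℝ := fun x => conv U ρ x + ∑ k, conv (W k) (pd k ρ) x with hmdef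
  have hmc : ∀ k, ContDiff ℝ ∞ (conv (W k) (pd k ρ)) := fun k => contDiff_conv (hW k) (hρ.pderiv k)
  have hm : ContDiff ℝ ∞ m := (contDiff_conv hU hρ).add (ContDiff.sum fun k _ => hmc k)
  have hm2 : MemLp m 2 :=
    (memLp_conv hU hρ).add (memLp_finsetSum _ fun k _ => memLp_conv (hW k) (hρ.pderiv k))
  have lapconv : ∀ {V g : E d → ℝ}, MemLp V 2 → IsTest g → ∀ x, lap (conv V g) x = conv V (lap g) x := by
    intro V g hV hg x
    have : ∀ k, pd k (pd k (conv V g)) x = conv V (pd k (pd k g)) x := by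
      intro k
      rw [pd_conv hV hg, pd_conv hV (hg.pderiv k)]
    rw [show lap (conv V g) x = ∑ k, conv V (pd k (pd k g)) x from
      Finset.sum_congr rfl fun k _ => this k]
    simp only [conv, lap]
    rw [← integral_finsetSum]
    · simp [Finset.mul_sum]
    · intro k _
      exact hV.integrable_mul ((hrefl ((hg.pderiv k).pderiv k) x).memLp 2)
  have hmlap : ∀ x, lap m x = 0 := by
    intro x
    have hA : ContDiff ℝ ∞ (conv U ρ) := contDiff_conv hU hρ
    have e1 : ∀ j, pd j m = fun x => pd j (conv U ρ) x + ∑ k, pd j (conv (W k) (pd k ρ)) x := by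
      intro j; ext x
      rw [hmdef, pd_add (hA.differentiable (by simp) x)
        ((ContDiff.sum fun k _ => hmc k).differentiable (by simp) x),
        pd_sum _ (fun k _ => (hmc k).differentiable (by simp) x)]
    have e2 : lap m x = lap (conv U ρ) x + ∑ k, lap (conv (W k) (pd k ρ)) x := by
      simp only [lap, e1]
      rw [Finset.sum_comm, ← Finset.sum_add_distrib]
      refine Finset.sum_congr rfl fun j _ => ?_
      rw [pd_add ((contDiff_pd hA j).differentiable (by simp) x)
        ((ContDiff.sum fun k _ => contDiff_pd (hmc k) j).differentiable (by simp) x),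
        pd_sum _ (fun k _ => (contDiff_pd (hmc k) j).differentiable (by simp) x)]
    have e3 : ∀ k y, lap (pd k ρ) y = pd k (lap ρ) y := by
      intro k y
      have : lap ρ = fun y => ∑ j, pd j (pd j ρ) y := rfl
      rw [this, lap, pd_sum _ (fun j _ => ((hρ.pderiv j).pderiv j).differentiable y)]
      refine Finset.sum_congr rfl fun j _ => ?_
      rw [show pd j (pd k ρ) = pd k (pd j ρ) from funext fun z => pd_comm hρ.1 j k z,
        pd_comm (hρ.pderiv j).1]
    rw [e2, lapconv hU hρ]
    have e4 := h _ (hrefl hρ x)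
    have e5 : lap (fun y => ρ (x - y)) = fun y => lap ρ (x - y) := funext fun y => hlap hρ x y
    rw [e5] at e4
    simp only [hpd hρ.laplacian x, mul_neg, integral_neg, Finset.sum_neg_distrib, sub_neg_eq_add] at e4
    rw [← e4]
    congr 1
    refine Finset.sum_congr rfl fun k _ => ?_
    rw [lapconv (hW k) (hρ.pderiv k), conv]
    simp only [e3]
  have h0 := eq_zero_of_harmonic hd hm hm2 hmlap 0
  have hρ0 : ∀ y, ρ (0 - y) = f y := fun y => by simp [hρdef]
  have hρ1 : ∀ k y, pd k ρ (0 - y) = - pd k f y := fun k y => by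
    rw [hρdef, hpd hf]; simp
  simp only [hmdef, conv, hρ0, hρ1, mul_neg, integral_neg, Finset.sum_neg_distrib] at h0
  linarith

/-! ### The pressure estimate -/

lemma L2_inner_toLp {α : Type*} [MeasurableSpace α] {ν : Measure α} {f g : α → ℝ}
    (hf : MemLp f 2 ν) (hg : MemLp g 2 ν) :
    inner ℝ (hf.toLp f) (hg.toLp g) = ∫ x, f x * g x ∂ν := by
  rw [L2.inner_def]
  refine integral_congr_ae ?_
  filter_upwards [hf.coeFn_toLp, hg.coeFn_toLp] with x h1 h2
  rw [h1, h2]; simp [mul_comm]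

lemma norm_toLp_sq {α : Type*} [MeasurableSpace α] {ν : Measure α} {f : α → ℝ}
    (hf : MemLp f 2 ν) : ‖hf.toLp f‖ ^ 2 = ∫ x, f x ^ 2 ∂ν := by
  rw [← real_inner_self_eq_norm_sq, L2_inner_toLp hf hf]; simp [pow_two]

lemma abs_integral_mul_le {α : Type*} [MeasurableSpace α] {ν : Measure α} {f g : α → ℝ}
    (hf : MemLp f 2 ν) (hg : MemLp g 2 ν) :
    |∫ x, f x * g x ∂ν| ≤ √(∫ x, f x ^ 2 ∂ν) * √(∫ x, g x ^ 2 ∂ν) := by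
  rw [← L2_inner_toLp hf hg, ← norm_toLp_sq hf, ← norm_toLp_sq hg,
    Real.sqrt_sq (norm_nonneg _), Real.sqrt_sq (norm_nonneg _)]
  exact abs_real_inner_le_norm _ _

/-- The Hilbert space of square-integrable vector fields, as a product of scalar spaces. -/
abbrev VecL2 (d : ℕ) : Type := PiLp 2 (fun _ : Fin d => Lp ℝ 2 (volume : Measure (E d)))

/-- The element of `VecL2` with the given components. -/
def toVecL2 (f : Fin d → E d → ℝ) (hf : ∀ α, MemLp (f α) 2) : VecL2 d :=
  WithLp.toLp 2 fun α => (hf α).toLp (f α)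

lemma inner_toVecL2 (V : VecL2 d) {f : Fin d → E d → ℝ} (hf : ∀ α, MemLp (f α) 2) :
    inner ℝ V (toVecL2 f hf) = ∑ α, ∫ x, V α x * f α x := by
  rw [PiLp.inner_apply]
  refine Finset.sum_congr rfl fun α _ => ?_
  have := L2_inner_toLp (Lp.memLp (V α)) (hf α)
  rw [← this, Lp.toLp_coeFn]
  rfl

/-- The divergence-free vector fields with components that are test functions. -/
structure IsSolenoidalTest (w : Fin d → E d → ℝ) : Prop where
  test : ∀ α, IsTest (w α)
  div : ∀ x, ∑ α, pd α (w α) x = 0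

/-- The closure in `L²` of the divergence-free test fields. -/
def solenoidal (d : ℕ) : Submodule ℝ (VecL2 d) :=
  (Submodule.span ℝ {V | ∃ (w : Fin d → E d → ℝ) (hw : IsSolenoidalTest w),
    V = toVecL2 w fun α => (hw.test α).memLp 2}).topologicalClosure

lemma inner_eq_zero_of_solenoidal {V Z : VecL2 d} (hV : V ∈ solenoidal d)
    (h : ∀ (w : Fin d → E d → ℝ) (hw : IsSolenoidalTest w),
      inner ℝ (toVecL2 w fun α => (hw.test α).memLp 2) Z = 0) : inner ℝ V Z = 0 := by
  have hsub : solenoidal d ≤ LinearMap.ker (innerₛₗ ℝ Z) := by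
    refine Submodule.topologicalClosure_minimal _ (Submodule.span_le.2 ?_) ?_
    · rintro _ ⟨w, hw, rfl⟩
      simpa [real_inner_comm] using h w hw
    · have : IsClosed {y : VecL2 d | inner ℝ Z y = 0} :=
        isClosed_eq (by fun_prop) continuous_const
      simpa using! this
  have := hsub hV
  rw [real_inner_comm]
  simpa using this

/-- If `f` is a test function, `(∂ₖ f) eᵢ - (∂ᵢ f) eₖ` is a divergence-free test field; more
generally so is `∂ₖ f - (div f) eₖ` for a test vector field `f`. -/
lemma isSolenoidalTest_sub {f : Fin d → E d → ℝ} (hf : ∀ α, IsTest (f α)) (k : Fin d) :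
    IsSolenoidalTest (fun α x => pd k (f α) x - if α = k then ∑ j, pd j (f j) x else 0) := by
  have hdiv : IsTest (fun x => ∑ j, pd j (f j) x) := IsTest.sum _ fun j _ => (hf j).pderiv j
  constructor
  · intro α
    by_cases h : α = k
    · simpa only [h, if_true] using ((hf k).pderiv k).sub hdiv
    · simpa only [h, if_false, sub_zero] using (hf α).pderiv k
  · intro x
    have : ∀ α, pd α (fun x => pd k (f α) x - if α = k then ∑ j, pd j (f j) x else 0) x
        = pd k (pd α (f α)) x - if α = k then ∑ j, pd k (pd j (f j)) x else 0 := by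
      intro α
      by_cases h : α = k
      · subst h
        simp only [if_true]
        rw [pd_sub (((hf α).pderiv α).differentiable x) (hdiv.differentiable x),
          pd_sum _ fun j _ => ((hf j).pderiv j).differentiable x]
      · simp only [h, if_false, sub_zero]
        exact pd_comm (hf α).1 _ _ _
    simp [this]

/-- The `L²` theory of the pressure. If the distribution `U + div Φ`, with `U` divergence-free and
square-integrable and `Φ` square-integrable, annihilates all divergence-free test fields, then it is
the gradient of a function `p` whose `L²` norm is controlled by that of `Φ`. The function `p` is the
trace of the component of `Φ` orthogonal to the solenoidal fields. -/
lemma pressure_estimate (hd : 0 < d) {U : Fin d → E d → ℝ} {Φ : Fin d → Fin d → E d → ℝ}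
    (hU : ∀ α, MemLp (U α) 2) (hΦ : ∀ α β, MemLp (Φ α β) 2)
    (hUdiv : ∀ η : E d → ℝ, IsTest η → ∑ α, ∫ x, U α x * pd α η x = 0)
    (h : ∀ w : Fin d → E d → ℝ, IsSolenoidalTest w →
      ∑ α, ∫ x, U α x * w α x = ∑ α, ∑ β, ∫ x, Φ α β x * pd β (w α) x)
    {N : ℝ} (hN : 0 ≤ N) (hΦN : ∀ α β, ∫ x, Φ α β x ^ 2 ≤ N ^ 2)
    {f : Fin d → E d → ℝ} (hf : ∀ α, IsTest (f α)) :
    |(∑ α, ∫ x, U α x * f α x) - ∑ α, ∑ β, ∫ x, Φ α β x * pd β (f α) x|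
      ≤ d ^ 2 * N * √(∫ x, (∑ α, pd α (f α) x) ^ 2) := by
  set F : Fin d → VecL2 d := fun β => toVecL2 (fun α => Φ α β) (fun α => hΦ α β) with hF
  have hcomplete : CompleteSpace (solenoidal d) :=
    (Submodule.isClosed_topologicalClosure _).completeSpace_coe
  have hdec : ∀ β, ∃ W ∈ solenoidal d, ∃ g ∈ (solenoidal d)ᗮ, F β = W + g := fun β =>
    Submodule.exists_add_mem_mem_orthogonal _
  choose W hW g hg hFWg using hdec
  have hFα : ∀ α β, (fun x => Φ α β x) =ᵐ[volume] fun x => W β α x + g β α x := by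
    intro α β
    have h1 : (F β) α = W β α + g β α := by rw [hFWg β]; rfl
    have h2 : ((F β) α : E d → ℝ) =ᵐ[volume] Φ α β := (hΦ α β).coeFn_toLp
    filter_upwards [h2, Lp.coeFn_add (W β α) (g β α)] with x hx hy
    rw [← hx, h1, hy]; rfl
  have hsplit : ∀ (α β) {η : E d → ℝ}, IsTest η →
      ∫ x, Φ α β x * η x = (∫ x, W β α x * η x) + ∫ x, g β α x * η x := by
    intro α β η hη
    refine Eq.trans ?_ (integral_add ((Lp.memLp (W β α)).integrable_mul (hη.memLp 2))
      ((Lp.memLp (g β α)).integrable_mul (hη.memLp 2)))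
    refine integral_congr_ae ?_
    filter_upwards [hFα α β] with x hx
    simp only [hx, add_mul]
  -- `g β` is orthogonal to divergence-free test fields
  have hgw : ∀ β, ∀ w : Fin d → E d → ℝ, IsSolenoidalTest w → ∑ α, ∫ x, g β α x * w α x = 0 := by
    intro β w hw
    rw [← inner_toVecL2 (g β) fun α => (hw.test α).memLp 2]
    rw [real_inner_comm]
    exact (hg β) _ (Submodule.le_topologicalClosure _ (Submodule.subset_span ⟨w, hw, rfl⟩))
  -- `W β` is weakly divergence-free
  have hWη : ∀ β, ∀ η : E d → ℝ, IsTest η → ∑ α, ∫ x, W β α x * pd α η x = 0 := by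
    intro β η hη
    rw [← inner_toVecL2 (W β) fun α => (hη.pderiv α).memLp 2]
    refine inner_eq_zero_of_solenoidal (hW β) fun w hw => ?_
    rw [inner_toVecL2]
    have : ∀ α, ∫ x, (toVecL2 w fun α => (hw.test α).memLp 2) α x * pd α η x
        = - ∫ x, η x * pd α (w α) x := by
      intro α
      rw [← (hw.test α).integral_pd_mul' hη.1]
      refine integral_congr_ae ?_
      filter_upwards [((hw.test α).memLp 2).coeFn_toLp] with x hx
      rw [mul_comm]; congr 1
    simp only [this, Finset.sum_neg_distrib]
    rw [← integral_finsetSum _ fun α _ => hη.integrable_mul ((hw.test α).pderiv α).continuous]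
    simp [← Finset.mul_sum, hw.div]
  -- the gradient part only sees the divergence of the test field
  have hgf : ∀ β, ∑ α, ∫ x, g β α x * pd β (f α) x = ∫ x, g β β x * ∑ α, pd α (f α) x := by
    intro β
    have hdiv : IsTest (fun x => ∑ j, pd j (f j) x) := IsTest.sum _ fun j _ => (hf j).pderiv j
    have h1 := hgw β _ (isSolenoidalTest_sub hf β)
    have h2 : ∀ α, ∫ x, g β α x * (pd β (f α) x - if α = β then ∑ j, pd j (f j) x else 0)
        = (∫ x, g β α x * pd β (f α) x)
          - if α = β then ∫ x, g β β x * ∑ α, pd α (f α) x else 0 := by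
      intro α
      by_cases hαβ : α = β
      · subst hαβ
        simp only [if_true, mul_sub]
        exact integral_sub ((Lp.memLp _).integrable_mul (((hf α).pderiv α).memLp 2))
          ((Lp.memLp _).integrable_mul (hdiv.memLp 2))
      · simp [hαβ]
    simp only [h2, Finset.sum_sub_distrib, Finset.sum_ite_eq', Finset.mem_univ, if_true] at h1
    linarith
  -- the solenoidal part cancels `U`
  have hcomp : ∀ i, ∀ η : E d → ℝ, IsTest η →
      (∫ x, U i x * η x) - ∑ β, ∫ x, W β i x * pd β η x = 0 := by
    intro i η hη
    refine eq_zero_of_weakly_harmonic hd (hU i) (fun β => Lp.memLp (W β i)) ?_ hη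
    intro η hη
    -- the test field `(Δ η) eᵢ - ∇ ∂ᵢ η`
    set w : Fin d → E d → ℝ := fun α x => (if α = i then lap η x else 0) - pd α (pd i η) x with hw
    have hwt : IsSolenoidalTest w := by
      constructor
      · intro α
        by_cases hα : α = i
        · simpa only [hw, hα, if_true] using hη.laplacian.sub ((hη.pderiv i).pderiv i)
        · simpa only [hw, hα, if_false, zero_sub] using ((hη.pderiv i).pderiv α).neg
      · intro x
        have h1 : ∀ α, pd α (w α) x = (if α = i then pd i (lap η) x else 0)
            - pd α (pd α (pd i η)) x := by
          intro α
          by_cases hα : α = i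
          · subst hα
            simp only [hw, if_true]
            exact pd_sub (hη.laplacian.differentiable x)
              (((hη.pderiv α).pderiv α).differentiable x) α
          · simp only [hw, hα, if_false, zero_sub]
            exact pd_neg _ _ _
        simp only [h1, Finset.sum_sub_distrib, Finset.sum_ite_eq', Finset.mem_univ, if_true]
        have h2 : lap η = fun y => ∑ α, pd α (pd α η) y := rfl
        rw [h2, pd_sum _ fun α _ => ((hη.pderiv α).pderiv α).differentiable x, sub_eq_zero]
        refine Finset.sum_congr rfl fun α _ => ?_
        rw [show pd α (pd i η) = pd i (pd α η) from funext fun z => pd_comm hη.1 α i z,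
          pd_comm (hη.pderiv α).1]
    have h3 := h w hwt
    have h4 : ∑ α, ∑ β, ∫ x, Φ α β x * pd β (w α) x
        = ∑ α, ∑ β, ∫ x, W β α x * pd β (w α) x := by
      simp only [fun α β => hsplit α β ((hwt.test α).pderiv β), Finset.sum_add_distrib]
      rw [add_eq_left, Finset.sum_comm]
      refine Finset.sum_eq_zero fun β _ => hgw β (fun α => pd β (w α)) ⟨fun α => (hwt.test α).pderiv β, ?_⟩
      intro x
      have h5 : (fun y => ∑ α, pd α (w α) y) = fun _ => 0 := funext hwt.div
      calc _ = ∑ α, pd β (pd α (w α)) x :=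
            Finset.sum_congr rfl fun α _ => pd_comm (hwt.test α).1 _ _ _
        _ = pd β (fun y => ∑ α, pd α (w α) y) x :=
            (pd_sum _ (fun α _ => ((hwt.test α).pderiv α).differentiable x) β).symm
        _ = 0 := by rw [h5, pd_const]
    rw [h4] at h3
    have h6 : ∀ α, ∫ x, U α x * w α x = (if α = i then ∫ x, U i x * lap η x else 0)
        - ∫ x, U α x * pd α (pd i η) x := by
      intro α
      by_cases hα : α = i
      · subst hα
        simp only [hw, if_true, mul_sub]
        exact integral_sub ((hU α).integrable_mul (hη.laplacian.memLp 2))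
          ((hU α).integrable_mul (((hη.pderiv α).pderiv α).memLp 2))
      · simp [hw, hα, integral_neg]
    have h7 : ∀ α β, ∫ x, W β α x * pd β (w α) x
        = (if α = i then ∫ x, W β i x * pd β (lap η) x else 0)
        - ∫ x, W β α x * pd α (pd β (pd i η)) x := by
      intro α β
      have h8 : ∀ x, pd β (w α) x = (if α = i then pd β (lap η) x else 0)
          - pd α (pd β (pd i η)) x := by
        intro x
        rw [pd_comm (hη.pderiv i).1 α β]
        by_cases hα : α = i
        · simp only [hw, hα, if_true]
          exact pd_sub (hη.laplacian.differentiable x)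
            (((hη.pderiv i).pderiv i).differentiable x) β
        · simp only [hw, hα, if_false, zero_sub]
          exact pd_neg _ _ _
      simp only [h8]
      by_cases hα : α = i
      · subst hα
        simp only [if_true, mul_sub]
        exact integral_sub ((Lp.memLp _).integrable_mul ((hη.laplacian.pderiv β).memLp 2))
          ((Lp.memLp _).integrable_mul ((((hη.pderiv α).pderiv β).pderiv α).memLp 2))
      · simp [hα, integral_neg]
    simp only [h6, h7, Finset.sum_sub_distrib, Finset.sum_ite_eq', Finset.mem_univ, if_true] at h3
    rw [hUdiv _ (hη.pderiv i)] at h3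
    have h9 : ∑ α, ∑ β, ∫ x, W β α x * pd α (pd β (pd i η)) x = 0 := by
      rw [Finset.sum_comm]
      exact Finset.sum_eq_zero fun β _ => hWη β _ ((hη.pderiv i).pderiv β)
    have h10 : ∑ α, ∑ β, (if α = i then ∫ x, W β i x * pd β (lap η) x else 0)
        = ∑ β, ∫ x, W β i x * pd β (lap η) x := by
      rw [Finset.sum_comm]; simp
    rw [h9, h10] at h3
    linarith
  have hdivT : IsTest (fun x => ∑ j, pd j (f j) x) := IsTest.sum _ fun j _ => (hf j).pderiv j
  have e1 : (∑ α, ∫ x, U α x * f α x) - ∑ α, ∑ β, ∫ x, Φ α β x * pd β (f α) x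
      = - ∑ β, ∫ x, g β β x * ∑ α, pd α (f α) x := by
    simp only [fun α β => hsplit α β ((hf α).pderiv β), Finset.sum_add_distrib]
    rw [Finset.sum_comm (f := fun α β => ∫ x, g β α x * pd β (f α) x)]
    simp only [hgf]
    have := Finset.sum_congr (rfl : (Finset.univ : Finset (Fin d)) = Finset.univ)
      fun i _ => hcomp i (f i) (hf i)
    rw [Finset.sum_sub_distrib] at this
    simp only [Finset.sum_const_zero] at this
    linarith
  have hd1 : (1 : ℝ) ≤ d := by exact_mod_cast hd
  have hgN : ∀ β, ‖g β‖ ≤ d * N := by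
    intro β
    have h1 : ‖g β‖ * ‖g β‖ ≤ ‖F β‖ * ‖F β‖ := by
      have horth : inner ℝ (W β) (g β) = 0 := (hg β) _ (hW β)
      rw [hFWg β, norm_add_sq_eq_norm_sq_add_norm_sq_of_inner_eq_zero _ _ horth]
      nlinarith [mul_self_nonneg ‖W β‖]
    have h2 : ‖F β‖ ^ 2 ≤ (d * N) ^ 2 := by
      rw [PiLp.norm_sq_eq_of_L2]
      calc ∑ α, ‖(F β) α‖ ^ 2 ≤ ∑ _α : Fin d, N ^ 2 :=
            Finset.sum_le_sum fun α _ => by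
              have := norm_toLp_sq (hΦ α β)
              exact this.le.trans (hΦN α β)
        _ = d * N ^ 2 := by simp
        _ ≤ (d * N) ^ 2 := by rw [mul_pow]; gcongr; nlinarith
    exact abs_le_of_sq_le_sq' (by nlinarith) (by positivity) |>.2
  rw [e1, abs_neg]
  calc |∑ β, ∫ x, g β β x * ∑ α, pd α (f α) x|
      ≤ ∑ β, |∫ x, g β β x * ∑ α, pd α (f α) x| := Finset.abs_sum_le_sum_abs _ _
    _ ≤ ∑ _β : Fin d, d * N * √(∫ x, (∑ α, pd α (f α) x) ^ 2) := by
      refine Finset.sum_le_sum fun β _ => ?_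
      refine (abs_integral_mul_le (Lp.memLp (g β β)) (hdivT.memLp 2)).trans ?_
      gcongr
      rw [← norm_toLp_sq (Lp.memLp (g β β)), Real.sqrt_sq (norm_nonneg _), Lp.toLp_coeFn]
      exact (PiLp.norm_apply_le (g β) β).trans (hgN β)
    _ = d ^ 2 * N * √(∫ x, (∑ α, pd α (f α) x) ^ 2) := by
      simp; ring

/-! ### Sobolev inequalities in dimensions two and three -/

/-- `|f|² + |∇f|²` for a scalar function. -/
def jetOne (f : E d → ℝ) (x : E d) : ℝ := f x ^ 2 + ∑ k, pd k f x ^ 2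

/-- `|f|² + |∇f|² + |∇²f|²` for a scalar function. -/
def jetTwo (f : E d → ℝ) (x : E d) : ℝ :=
  f x ^ 2 + ∑ k, pd k f x ^ 2 + ∑ k, ∑ l, pd k (pd l f) x ^ 2

lemma norm_fderiv_sq_le (f : E d → ℝ) (x : E d) : ‖fderiv ℝ f x‖ ^ 2 ≤ ∑ k, pd k f x ^ 2 := by
  have h : ‖fderiv ℝ f x‖ ≤ √(∑ k, pd k f x ^ 2) := by
    refine ContinuousLinearMap.opNorm_le_bound _ (Real.sqrt_nonneg _) fun v => ?_
    rw [fderiv_apply_eq_sum, Real.norm_eq_abs, EuclideanSpace.norm_eq, ← Real.sqrt_mul (by positivity)]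
    refine Real.abs_le_sqrt ?_
    have := Finset.sum_mul_sq_le_sq_mul_sq Finset.univ (fun k => v k) (fun k => pd k f x)
    simpa [mul_comm] using this
  calc _ ≤ (√(∑ k, pd k f x ^ 2)) ^ 2 := by gcongr
    _ = _ := Real.sq_sqrt (by positivity)

lemma ofReal_pow_four (a : ℝ) : ENNReal.ofReal (a ^ 4) = ‖a‖ₑ ^ 4 := by
  rw [← ofReal_norm, ← ENNReal.ofReal_pow (norm_nonneg _)]
  congr 1
  rw [Real.norm_eq_abs, show (4 : ℕ) = 2 * 2 from rfl, pow_mul, pow_mul, sq_abs]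

lemma ofReal_pow_two (a : ℝ) : ENNReal.ofReal (a ^ 2) = ‖a‖ₑ ^ 2 := by
  rw [← ofReal_norm, ← ENNReal.ofReal_pow (norm_nonneg _), Real.norm_eq_abs, sq_abs]

lemma enorm_fderiv_sq_le (f : E d → ℝ) (x : E d) :
    ‖fderiv ℝ f x‖ₑ ^ 2 ≤ ENNReal.ofReal (jetOne f x) := by
  rw [← ofReal_norm, ← ENNReal.ofReal_pow (norm_nonneg _)]
  refine ENNReal.ofReal_le_ofReal ((norm_fderiv_sq_le f x).trans ?_)
  rw [jetOne]; nlinarith [sq_nonneg (f x)]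

lemma exists_lintegral_pow_four_le_of_isTest (hd : d = 2 ∨ d = 3) :
    ∃ C : NNReal, ∀ f : E d → ℝ, IsTest f →
      ∫⁻ x, ENNReal.ofReal (f x ^ 4) ≤ C * (∫⁻ x, ENNReal.ofReal (jetOne f x)) ^ 2 := by
  rcases hd with hd | hd
  · -- the inequality `‖g‖₂ ≤ C ‖∇g‖₁` for `g = f²`
    have hp : Real.HolderConjugate (Module.finrank ℝ (E d)) 2 := by
      simp only [finrank_euclideanSpace, Fintype.card_fin, hd]
      exact_mod_cast Real.HolderConjugate.two_two
    refine ⟨lintegralPowLePowLIntegralFDerivConst (volume : Measure (E d)) 2, fun f hf => ?_⟩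
    have hf2 : IsTest (fun x => f x ^ 2) := by simpa [pow_two] using hf.mul_left hf.1
    have h := lintegral_pow_le_pow_lintegral_fderiv (μ := volume) (u := fun x => f x ^ 2)
      (hf2.1.of_le (by simp)) hf2.2 hp
    calc ∫⁻ x, ENNReal.ofReal (f x ^ 4) = ∫⁻ x, ‖f x ^ 2‖ₑ ^ (2 : ℝ) := by
          congr 1; ext x
          rw [ofReal_pow_four, enorm_pow, ENNReal.rpow_two, ← pow_mul]
      _ ≤ _ := h
      _ ≤ _ := by
        rw [ENNReal.rpow_two]
        gcongr with x
        have h1 : fderiv ℝ (fun x => f x ^ 2) x = (2 * f x) • fderiv ℝ f x := by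
          rw [fderiv_fun_pow 2 (hf.differentiable x)]; simp
        rw [h1, ← ofReal_norm]
        refine ENNReal.ofReal_le_ofReal ?_
        rw [norm_smul, norm_mul, jetOne]
        have h2 := norm_fderiv_sq_le f x
        have h3 : ‖f x‖ ^ 2 = f x ^ 2 := by rw [Real.norm_eq_abs, sq_abs]
        norm_num
        rw [Real.norm_eq_abs] at h3
        nlinarith [sq_nonneg (|f x| - ‖fderiv ℝ f x‖)]
  · -- the inequality `‖f‖₆ ≤ C ‖∇f‖₂` and interpolation
    have hfin : Module.finrank ℝ (E d) = 3 := by simp [hd]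
    refine ⟨(SNormLESNormFDerivOfEqConst ℝ (volume : Measure (E d)) 2) ^ 3, fun f hf => ?_⟩
    have h := eLpNorm_le_eLpNorm_fderiv_of_eq (F := ℝ) (μ := volume) (p := 2) (p' := 6)
      (hf.1.of_le (by simp)) hf.2 (by norm_num) (by rw [hfin]; norm_num)
      (by rw [hfin]; norm_num)
    set S := SNormLESNormFDerivOfEqConst ℝ (volume : Measure (E d)) 2 with hS
    set A := ∫⁻ x, ENNReal.ofReal (jetOne f x) with hA
    have h6 : ∫⁻ x, ‖f x‖ₑ ^ 6 ≤ S ^ 6 * A ^ 3 := by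
      have e1 := eLpNorm_nnreal_pow_eq_lintegral (f := f) (μ := volume) (p := 6) (by norm_num)
      have e2 := eLpNorm_nnreal_pow_eq_lintegral (f := fderiv ℝ f) (μ := volume) (p := 2) (by norm_num)
      norm_num at e1 e2
      have h2 : ∫⁻ x, ‖fderiv ℝ f x‖ₑ ^ 2 ≤ A := lintegral_mono fun x => enorm_fderiv_sq_le f x
      norm_num at h
      calc ∫⁻ x, ‖f x‖ₑ ^ 6 = eLpNorm f 6 volume ^ 6 := e1.symm
        _ ≤ (S * eLpNorm (fderiv ℝ f) 2 volume) ^ 6 := by gcongr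
        _ = S ^ 6 * (eLpNorm (fderiv ℝ f) 2 volume ^ 2) ^ 3 := by ring
        _ ≤ _ := by rw [e2]; gcongr
    have h2 : ∫⁻ x, ‖f x‖ₑ ^ 2 ≤ A := by
      refine lintegral_mono fun x => ?_
      rw [← ofReal_pow_two]
      refine ENNReal.ofReal_le_ofReal ?_
      rw [jetOne]; exact le_add_of_nonneg_right (by positivity)
    have hm : Measurable fun x => ‖f x‖ₑ := hf.continuous.measurable.enorm
    have h4 : (∫⁻ x, ‖f x‖ₑ ^ 4) ^ 2 ≤ (S ^ 3 * A ^ 2) ^ 2 := by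
      calc (∫⁻ x, ‖f x‖ₑ ^ 4) ^ 2 = (∫⁻ x, ‖f x‖ₑ * ‖f x‖ₑ ^ 3) ^ 2 := by
            congr 2; ext x; ring
        _ ≤ (∫⁻ x, ‖f x‖ₑ ^ 2) * ∫⁻ x, (‖f x‖ₑ ^ 3) ^ 2 :=
            lintegral_mul_sq_le hm.aemeasurable (hm.pow_const 3).aemeasurable
        _ = (∫⁻ x, ‖f x‖ₑ ^ 2) * ∫⁻ x, ‖f x‖ₑ ^ 6 := by simp only [← pow_mul]
        _ ≤ A * (S ^ 6 * A ^ 3) := by gcongr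
        _ = _ := by ring
    simp only [ofReal_pow_four]
    push_cast
    exact (ENNReal.pow_le_pow_left_iff two_ne_zero).1 h4

lemma jetOne_cutoff_mul_le (d : ℕ) : ∃ C : ℝ, 0 < C ∧ ∀ f : E d → ℝ, ContDiff ℝ ∞ f → ∀ R : ℝ,
    1 ≤ R → ∀ x, jetOne (fun x => cutoff R x * f x) x ≤ C * jetOne f x := by
  obtain ⟨C, hC, hCR⟩ := exists_pd_cutoff_le d
  refine ⟨3 + 2 * d * C ^ 2, by positivity, fun f hf R hR x => ?_⟩
  have hR0 : 0 < R := by linarith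
  have h0 := cutoff_nonneg R x
  have h1 := cutoff_le_one R x
  have hk : ∀ k, pd k (fun x => cutoff R x * f x) x ^ 2 ≤ 2 * pd k f x ^ 2 + 2 * C ^ 2 * f x ^ 2 := by
    intro k
    rw [pd_mul ((cutoff_isTest hR0).differentiable x) (hf.differentiable (by simp) x)]
    have h2 : pd k (cutoff R) x ^ 2 ≤ C ^ 2 := by
      rw [← sq_abs]
      gcongr
      exact (hCR R hR0 k x).trans (div_le_self hC.le hR)
    have h3 : cutoff R x ^ 2 ≤ 1 := by nlinarith
    have h4 := mul_le_mul_of_nonneg_right h2 (sq_nonneg (f x))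
    have h5 := mul_le_mul_of_nonneg_right h3 (sq_nonneg (pd k f x))
    nlinarith [sq_nonneg (cutoff R x * pd k f x - pd k (cutoff R) x * f x)]
  have hs := Finset.sum_le_sum fun k (_ : k ∈ Finset.univ) => hk k
  rw [Finset.sum_add_distrib, ← Finset.mul_sum] at hs
  simp only [Finset.sum_const, Finset.card_univ, Fintype.card_fin, nsmul_eq_mul] at hs
  have h3 : (cutoff R x * f x) ^ 2 ≤ f x ^ 2 := by
    rw [mul_pow]; exact mul_le_of_le_one_left (sq_nonneg _) (by nlinarith)
  have h4 : 0 ≤ ∑ k, pd k f x ^ 2 := by positivity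
  have h5 : 0 ≤ 2 * d * C ^ 2 := by positivity
  simp only [jetOne]
  nlinarith [sq_nonneg (f x), mul_nonneg h5 h4]

/-- The embedding `H¹ ⊂ L⁴`. -/
lemma exists_lintegral_pow_four_le (hd : d = 2 ∨ d = 3) :
    ∃ C : NNReal, ∀ f : E d → ℝ, ContDiff ℝ ∞ f →
      ∫⁻ x, ENNReal.ofReal (f x ^ 4) ≤ C * (∫⁻ x, ENNReal.ofReal (jetOne f x)) ^ 2 := by
  obtain ⟨C, hC⟩ := exists_lintegral_pow_four_le_of_isTest hd
  obtain ⟨C', hC', hjet⟩ := jetOne_cutoff_mul_le d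
  refine ⟨C * (Real.toNNReal C') ^ 2, fun f hf => ?_⟩
  set A := ∫⁻ x, ENNReal.ofReal (jetOne f x) with hA
  have hn : ∀ n : ℕ, ∫⁻ x, ENNReal.ofReal ((cutoff ((n : ℝ) + 1) x * f x) ^ 4)
      ≤ (C * (Real.toNNReal C') ^ 2 : NNReal) * A ^ 2 := by
    intro n
    have ht := (cutoff_isTest (d := d) (R := (n : ℝ) + 1) (by positivity)).mul_left hf
    refine (hC _ ht).trans ?_
    have : ∫⁻ x, ENNReal.ofReal (jetOne (fun x => cutoff ((n : ℝ) + 1) x * f x) x)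
        ≤ (Real.toNNReal C') * A := by
      rw [hA, ← lintegral_const_mul' _ _ (by simp)]
      refine lintegral_mono fun x => ?_
      rw [show ((Real.toNNReal C' : NNReal) : ℝ≥0∞) = ENNReal.ofReal C' from rfl,
        ← ENNReal.ofReal_mul hC'.le]
      exact ENNReal.ofReal_le_ofReal (hjet f hf _ (by simp) x)
    calc _ ≤ C * ((Real.toNNReal C') * A) ^ 2 := by gcongr
      _ = _ := by push_cast; ring
  have hfat := lintegral_liminf_le (μ := (volume : Measure (E d))) (u := Filter.atTop)
    (f := fun (n : ℕ) x => ENNReal.ofReal ((cutoff ((n : ℝ) + 1) x * f x) ^ 4)) (fun n => by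
      have ht := (cutoff_isTest (d := d) (R := (n : ℝ) + 1) (by positivity)).mul_left hf
      exact (ht.continuous.pow 4).measurable.ennreal_ofReal)
  refine le_trans (le_trans (le_of_eq ?_) hfat) (Filter.liminf_le_of_le (by isBoundedDefault) ?_)
  · refine lintegral_congr fun x => ?_
    refine (Filter.Tendsto.liminf_eq ?_).symm
    refine (ENNReal.continuous_ofReal.tendsto _).comp ?_
    simpa using ((tendsto_cutoff x).mul_const (f x)).pow 4
  · intro b hb
    obtain ⟨n, hn'⟩ := hb.exists
    exact hn'.trans (hn n)

lemma exists_pd_pd_cutoff_mul_le (d : ℕ) : ∃ C : ℝ, 0 ≤ C ∧ ∀ f : E d → ℝ, ContDiff ℝ ∞ f → ∀ x,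
    (∑ k, ∑ l, |pd k (pd l (fun y => cutoff 1 y * f y)) x|) ^ 2 ≤ C * jetTwo f x := by
  have hχ := cutoff_isTest (d := d) one_pos
  have h1 : ∀ k : Fin d, ∃ C, ∀ x, ‖pd k (cutoff 1) x‖ ≤ C := fun k =>
    (hχ.pderiv k).continuous.bounded_above_of_compact_support (hχ.pderiv k).2
  have h2 : ∀ k l : Fin d, ∃ C, ∀ x, ‖pd k (pd l (cutoff 1)) x‖ ≤ C := fun k l =>
    ((hχ.pderiv l).pderiv k).continuous.bounded_above_of_compact_support ((hχ.pderiv l).pderiv k).2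
  choose C₁ hC₁ using h1
  choose C₂ hC₂ using h2
  set M : ℝ := 1 + ∑ k, |C₁ k| + ∑ k, ∑ l, |C₂ k l| with hM
  have hS1 : ∀ k, |C₁ k| ≤ ∑ k, |C₁ k| := fun k =>
    Finset.single_le_sum (f := fun k => |C₁ k|) (fun _ _ => abs_nonneg _) (Finset.mem_univ k)
  have hS2 : ∀ k l, |C₂ k l| ≤ ∑ k, ∑ l, |C₂ k l| := fun k l =>
    (Finset.single_le_sum (f := fun l => |C₂ k l|) (fun _ _ => abs_nonneg _)
      (Finset.mem_univ l)).trans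
    (Finset.single_le_sum (f := fun k => ∑ l, |C₂ k l|)
      (fun _ _ => Finset.sum_nonneg fun _ _ => abs_nonneg _) (Finset.mem_univ k))
  have hS1' : 0 ≤ ∑ k, |C₁ k| := Finset.sum_nonneg fun _ _ => abs_nonneg _
  have hS2' : 0 ≤ ∑ k, ∑ l, |C₂ k l| :=
    Finset.sum_nonneg fun _ _ => Finset.sum_nonneg fun _ _ => abs_nonneg _
  have hM1 : 1 ≤ M := by rw [hM]; linarith
  have b1 : ∀ k x, |pd k (cutoff 1) x| ≤ M := fun k x => by
    have := hC₁ k x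
    rw [Real.norm_eq_abs] at this
    linarith [le_abs_self (C₁ k), hS1 k]
  have b2 : ∀ k l x, |pd k (pd l (cutoff 1)) x| ≤ M := fun k l x => by
    have := hC₂ k l x
    rw [Real.norm_eq_abs] at this
    linarith [le_abs_self (C₂ k l), hS2 k l]
  have b0 : ∀ x : E d, |cutoff 1 x| ≤ M := fun x => by
    rw [abs_of_nonneg (cutoff_nonneg _ _)]; exact (cutoff_le_one _ _).trans hM1
  refine ⟨d ^ 2 * (4 * M ^ 2 * (1 + 2 * d + d ^ 2)), by positivity, fun f hf x => ?_⟩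
  have df : DifferentiableAt ℝ f x := hf.differentiable (by simp) x
  have dpf : ∀ l, DifferentiableAt ℝ (pd l f) x := fun l => (contDiff_pd hf l).differentiable (by simp) x
  have e : ∀ k l, pd k (pd l (fun y => cutoff 1 y * f y)) x
      = (cutoff 1 x * pd k (pd l f) x + pd k (cutoff 1) x * pd l f x)
        + (pd l (cutoff 1) x * pd k f x + pd k (pd l (cutoff 1)) x * f x) := by
    intro k l
    have : pd l (fun y => cutoff 1 y * f y) = fun y => cutoff 1 y * pd l f y + pd l (cutoff 1) y * f y :=
      funext fun y => pd_mul (hχ.differentiable y) (hf.differentiable (by simp) y) l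
    rw [this, pd_add ((hχ.differentiable x).fun_mul (dpf l)) (((hχ.pderiv l).differentiable x).fun_mul df),
      pd_mul (hχ.differentiable x) (dpf l), pd_mul ((hχ.pderiv l).differentiable x) df]
  have b : ∀ k l, pd k (pd l (fun y => cutoff 1 y * f y)) x ^ 2
      ≤ 4 * M ^ 2 * (pd k (pd l f) x ^ 2 + pd l f x ^ 2 + pd k f x ^ 2 + f x ^ 2) := by
    intro k l
    rw [e]
    have sq : ∀ {a c : ℝ}, |a| ≤ M → (a * c) ^ 2 ≤ M ^ 2 * c ^ 2 := fun {a c} h => by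
      rw [mul_pow]
      gcongr ?_ * _
      rw [← sq_abs]; gcongr
    have q1 := sq (c := pd k (pd l f) x) (b0 x)
    have q2 := sq (c := pd l f x) (b1 k x)
    have q3 := sq (c := pd k f x) (b1 l x)
    have q4 := sq (c := f x) (b2 k l x)
    have q5 : ∀ a b c e : ℝ, ((a + b) + (c + e)) ^ 2 ≤ 4 * (a ^ 2 + b ^ 2 + c ^ 2 + e ^ 2) := by
      intro a b c e
      nlinarith [sq_nonneg (a - b), sq_nonneg (a - c), sq_nonneg (a - e), sq_nonneg (b - c),
        sq_nonneg (b - e), sq_nonneg (c - e)]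
    refine (q5 _ _ _ _).trans ?_
    linarith
  have cs : (∑ k, ∑ l, |pd k (pd l (fun y => cutoff 1 y * f y)) x|) ^ 2
      ≤ d ^ 2 * ∑ k, ∑ l, pd k (pd l (fun y => cutoff 1 y * f y)) x ^ 2 := by
    have h1 := sq_sum_le_card_mul_sum_sq (s := (Finset.univ : Finset (Fin d × Fin d)))
      (f := fun p => |pd p.1 (pd p.2 (fun y => cutoff 1 y * f y)) x|)
    rw [← Finset.univ_product_univ, Finset.sum_product, Finset.sum_product] at h1
    simpa [pow_two] using h1
  refine cs.trans ?_
  rw [mul_assoc]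
  refine mul_le_mul_of_nonneg_left ?_ (by positivity)
  refine (Finset.sum_le_sum fun k _ => Finset.sum_le_sum fun l _ => b k l).trans ?_
  simp only [← Finset.mul_sum, Finset.sum_add_distrib, Finset.sum_const, Finset.card_univ,
    Fintype.card_fin, nsmul_eq_mul, mul_assoc]
  refine mul_le_mul_of_nonneg_left ?_ (by norm_num)
  refine mul_le_mul_of_nonneg_left ?_ (by positivity)
  rw [jetTwo]
  have p1 : 0 ≤ ∑ k, pd k f x ^ 2 := by positivity
  have p2 : 0 ≤ ∑ k, ∑ l, pd k (pd l f) x ^ 2 := by positivity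
  have p3 : 0 ≤ f x ^ 2 := by positivity
  have p4 : (0 : ℝ) ≤ d := by positivity
  nlinarith [mul_nonneg p4 p1, mul_nonneg p4 p2, mul_nonneg p4 p3, mul_nonneg (mul_nonneg p4 p4) p1,
    mul_nonneg (mul_nonneg p4 p4) p2]

/-- Taylor's formula along the segment from `y` to `0`, for a function vanishing near `y`. -/
lemma IsTest.abs_zero_le_integral {g : E d → ℝ} (hg : IsTest g) {y : E d} (hy : ‖y‖ ≤ 4)
    (h0 : g y = 0) (h1 : fderiv ℝ g y = 0) :
    |g 0| ≤ ∫ s in (0 : ℝ)..1, s * (16 * ∑ k, ∑ l, |pd k (pd l g) (s • y)|) := by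
  have d1 : ∀ {f : E d → ℝ}, IsTest f → ∀ s : ℝ,
      HasDerivAt (fun s : ℝ => f (s • y)) (∑ k, y k * pd k f (s • y)) s := by
    intro f hf s
    have h := (hf.differentiable (s • y)).hasFDerivAt.comp_hasDerivAt s
      ((hasDerivAt_id s).smul_const y)
    rw [one_smul, fderiv_apply_eq_sum] at h
    exact h
  have d2 : ∀ s : ℝ, HasDerivAt (fun s : ℝ => ∑ l, y l * pd l g (s • y))
      (∑ l, y l * ∑ k, y k * pd k (pd l g) (s • y)) s := by
    intro s
    exact HasDerivAt.fun_sum fun l _ => (d1 (hg.pderiv l) s).const_mul (y l)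
  have c2 : Continuous fun s : ℝ => ∑ l, y l * ∑ k, y k * pd k (pd l g) (s • y) := by
    refine continuous_finsetSum _ fun l _ => continuous_const.mul <|
      continuous_finsetSum _ fun k _ => continuous_const.mul ?_
    exact ((hg.pderiv l).pderiv k).continuous.comp (by fun_prop)
  have c1 : Continuous fun s : ℝ => ∑ l, y l * pd l g (s • y) := by
    refine continuous_finsetSum _ fun l _ => continuous_const.mul ?_
    exact (hg.pderiv l).continuous.comp (by fun_prop)
  have ibp := intervalIntegral.integral_mul_deriv_eq_deriv_mul (a := (0 : ℝ)) (b := 1)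
    (u := fun s => s) (u' := fun _ => 1) (v := fun s => ∑ l, y l * pd l g (s • y))
    (v' := fun s => ∑ l, y l * ∑ k, y k * pd k (pd l g) (s • y))
    (fun s _ => hasDerivAt_id s) (fun s _ => d2 s) (by simp) (c2.intervalIntegrable _ _)
  have ftc := intervalIntegral.integral_eq_sub_of_hasDerivAt (a := (0 : ℝ)) (b := 1)
    (fun s _ => d1 hg s) (c1.intervalIntegrable _ _)
  have hp : ∀ l, pd l g y = 0 := fun l => by rw [pd, h1]; rfl
  simp only [one_mul, zero_mul, one_smul, zero_smul, hp, mul_zero, Finset.sum_const_zero, sub_zero,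
    zero_sub, h0] at ibp ftc
  rw [ftc, neg_neg] at ibp
  rw [← ibp]
  refine (intervalIntegral.abs_integral_le_integral_abs zero_le_one).trans ?_
  have hyk : ∀ k, |y k| ≤ 4 := fun k => (PiLp.norm_apply_le y k).trans hy
  refine intervalIntegral.integral_mono_on zero_le_one ((continuous_id.mul c2).abs.intervalIntegrable _ _) ?_ ?_
  · refine Continuous.intervalIntegrable ?_ _ _
    refine continuous_id.mul (continuous_const.mul (continuous_finsetSum _ fun k _ =>
      continuous_finsetSum _ fun l _ => (((hg.pderiv l).pderiv k).continuous.comp ?_).abs))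
    fun_prop
  · intro s hs
    rw [abs_mul, abs_of_nonneg hs.1]
    refine mul_le_mul_of_nonneg_left ?_ hs.1
    rw [Finset.sum_comm (f := fun k l => |pd k (pd l g) (s • y)|)]
    have b1 : ∀ l, |∑ k, y k * pd k (pd l g) (s • y)| ≤ 4 * ∑ k, |pd k (pd l g) (s • y)| := by
      intro l
      refine (Finset.abs_sum_le_sum_abs _ _).trans ?_
      rw [Finset.mul_sum]
      refine Finset.sum_le_sum fun k _ => ?_
      rw [abs_mul]; gcongr; exact hyk k
    refine (Finset.abs_sum_le_sum_abs _ _).trans ?_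
    rw [Finset.mul_sum]
    refine Finset.sum_le_sum fun l _ => ?_
    rw [abs_mul]
    calc _ ≤ 4 * (4 * ∑ k, |pd k (pd l g) (s • y)|) := by gcongr; exacts [hyk l, b1 l]
      _ = _ := by ring

lemma lintegral_comp_smul {h : E d → ℝ≥0∞} (hh : Measurable h) {s : ℝ} (hs : 0 < s) :
    ∫⁻ y, h (s • y) = ENNReal.ofReal ((s ^ d)⁻¹) * ∫⁻ y, h y := by
  have h1 := Measure.map_addHaar_smul (volume : Measure (E d)) hs.ne'
  rw [← lintegral_map (μ := volume) hh (measurable_const_smul s), h1, lintegral_smul_measure]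
  simp [abs_of_pos hs]

/-- The embedding `H² ⊂ L^∞`. Taylor's formula along the segments from `0` to the points `y` of an
annulus on which a localization of `f` vanishes is averaged over `y`; the hypothesis `d ≤ 3` makes
the resulting kernel square-integrable. -/
lemma exists_sq_le_lintegral_jetTwo (hd0 : 0 < d) (hd : d ≤ 3) :
    ∃ C : NNReal, ∀ f : E d → ℝ, ContDiff ℝ ∞ f → ∀ x,
      ENNReal.ofReal (f x ^ 2) ≤ C * ∫⁻ y, ENNReal.ofReal (jetTwo f y) := by
  obtain ⟨C, hC, hCj⟩ := exists_pd_pd_cutoff_mul_le d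
  set K := ∫⁻ s in Ioc (0 : ℝ) 1, ENNReal.ofReal (s ^ (-(1 / 2) : ℝ)) with hK
  have hKtop : K < ⊤ := by
    have := (intervalIntegral.intervalIntegrable_rpow' (a := 0) (b := 1) (r := (-(1 / 2) : ℝ))
      (by norm_num)).1
    exact this.lintegral_lt_top
  set A : Set (E d) := Metric.ball 0 4 \ Metric.closedBall 0 3 with hA
  have hAm : MeasurableSet A := Metric.isOpen_ball.measurableSet.diff Metric.isClosed_closedBall.measurableSet
  have hAtop : volume A < ⊤ := (measure_mono sdiff_subset).trans_lt measure_ball_lt_top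
  have hApos : volume A ≠ 0 := by
    refine (IsOpen.measure_pos _ (Metric.isOpen_ball.sdiff Metric.isClosed_closedBall) ?_).ne'
    refine ⟨EuclideanSpace.single (⟨0, hd0⟩ : Fin d) (7 / 2 : ℝ), ?_, ?_⟩ <;> simp <;> norm_num
  have hconst : K * 256 * K * ENNReal.ofReal C / volume A < ⊤ := by
    refine ENNReal.div_lt_top ?_ hApos
    exact (ENNReal.mul_lt_top (ENNReal.mul_lt_top (ENNReal.mul_lt_top hKtop (by simp)) hKtop)
      ENNReal.ofReal_lt_top).ne
  -- The constant comes from the Cauchy–Schwarz inequality for the weight `s = s^(-1/4) * s^(5/4)` of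
  -- Taylor's formula, as `s^(-1/2)` and, for `d ≤ 3`, `s^(5/2 - d)` are integrable on `(0,1]`.
  refine ⟨(K * 256 * K * ENNReal.ofReal C / volume A).toNNReal, fun f hf x => ?_⟩
  rw [ENNReal.coe_toNNReal hconst.ne]
  -- translate `x` to the origin and localize
  set h : E d → ℝ := fun y => f (x + y) with hh
  have hhs : ContDiff ℝ ∞ h := hf.comp (contDiff_const.add contDiff_id)
  have hpd : ∀ (q : E d → ℝ) (k : Fin d), pd k (fun y => q (x + y)) = fun y => pd k q (x + y) := by
    intro q k; ext y; simp only [pd]; rw [fderiv_comp_add_left]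
  have hjet : ∀ y, jetTwo h y = jetTwo f (x + y) := by
    intro y; simp only [jetTwo, hh, hpd]
  have hjetint : ∫⁻ y, ENNReal.ofReal (jetTwo h y) = ∫⁻ y, ENNReal.ofReal (jetTwo f y) := by
    simp only [hjet]
    exact lintegral_add_left_eq_self (fun y => ENNReal.ofReal (jetTwo f y)) x
  set g : E d → ℝ := fun y => cutoff 1 y * h y with hg
  have hgt : IsTest g := (cutoff_isTest one_pos).mul_left hhs
  have hg0 : g 0 = f x := by simp [hg, hh, cutoff_eq_one one_pos (x := (0 : E d)) (by simp)]
  set G : E d → ℝ := fun y => ∑ k, ∑ l, |pd k (pd l g) y| with hG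
  have hGc : Continuous G := continuous_finsetSum _ fun k _ => continuous_finsetSum _ fun l _ =>
    ((hgt.pderiv l).pderiv k).continuous.abs
  have hG0 : ∀ y, 0 ≤ G y := fun y => Finset.sum_nonneg fun _ _ => Finset.sum_nonneg fun _ _ => abs_nonneg _
  have hgz : ∀ y ∈ A, g =ᶠ[nhds y] fun _ => 0 := by
    intro y hy
    have : (Metric.closedBall (0 : E d) 3)ᶜ ∈ nhds y :=
      Metric.isClosed_closedBall.isOpen_compl.mem_nhds hy.2
    filter_upwards [this] with z hz
    have : cutoff 1 z = 0 := by
      apply (unitBump d).zero_of_le_dist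
      simp only [mem_compl_iff, Metric.mem_closedBall, dist_zero_right, not_le] at hz
      simp only [unitBump, inv_one, one_smul, dist_zero_right]
      linarith
    simp [hg, this]
  -- the pointwise bound for a single `y`
  have key : ∀ y ∈ A, ENNReal.ofReal (f x ^ 2)
      ≤ K * ∫⁻ s in Ioc (0 : ℝ) 1, ENNReal.ofReal (256 * s ^ (5 / 2 : ℝ)) * ENNReal.ofReal (G (s • y) ^ 2) := by
    intro y hy
    have hy4 : ‖y‖ ≤ 4 := by simpa using (Metric.mem_ball.1 hy.1).le
    have t1 := hgt.abs_zero_le_integral hy4 (hgz y hy).eq_of_nhds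
      (by rw [(hgz y hy).fderiv_eq]; simp)
    have hint : Continuous fun s : ℝ => s * (16 * G (s • y)) :=
      continuous_id.mul (continuous_const.mul (hGc.comp (by fun_prop)))
    have t2 : ENNReal.ofReal |f x| ≤ ∫⁻ s in Ioc (0 : ℝ) 1,
        ENNReal.ofReal (s ^ (-(1 / 4) : ℝ)) * ENNReal.ofReal (16 * s ^ (5 / 4 : ℝ) * G (s • y)) := by
      rw [← hg0]
      refine (ENNReal.ofReal_le_ofReal t1).trans ?_
      rw [intervalIntegral.integral_of_le zero_le_one, ofReal_integral_eq_lintegral_ofReal]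
      · refine setLIntegral_mono' measurableSet_Ioc fun s hs => ?_
        rw [← ENNReal.ofReal_mul (by have := hs.1; positivity)]
        refine ENNReal.ofReal_le_ofReal (le_of_eq ?_)
        have : s ^ (-(1 / 4) : ℝ) * s ^ (5 / 4 : ℝ) = s := by
          rw [← Real.rpow_add hs.1]; norm_num
        calc _ = s * (16 * G (s • y)) := rfl
          _ = (s ^ (-(1 / 4) : ℝ) * s ^ (5 / 4 : ℝ)) * (16 * G (s • y)) := by rw [this]
          _ = _ := by ring
      · exact (hint.integrableOn_Icc).mono_set Ioc_subset_Icc_self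
      · filter_upwards [ae_restrict_mem measurableSet_Ioc] with s hs
        exact mul_nonneg hs.1.le (mul_nonneg (by norm_num) (hG0 _))
    calc ENNReal.ofReal (f x ^ 2) = ENNReal.ofReal |f x| ^ 2 := by
          rw [← ENNReal.ofReal_pow (abs_nonneg _), sq_abs]
      _ ≤ _ := pow_le_pow_left' t2 2
      _ ≤ _ := lintegral_mul_sq_le (by fun_prop) (by fun_prop)
      _ = _ := by
        congr 1
        · refine setLIntegral_congr_fun measurableSet_Ioc fun s hs => ?_
          rw [← ENNReal.ofReal_pow (by have := hs.1; positivity), ← Real.rpow_natCast, ← Real.rpow_mul hs.1.le]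
          norm_num
        · refine setLIntegral_congr_fun measurableSet_Ioc fun s hs => ?_
          have := hs.1
          rw [← ENNReal.ofReal_pow (by have := hG0 (s • y); positivity), ← ENNReal.ofReal_mul (by positivity),
            mul_pow, mul_pow, ← Real.rpow_natCast (s ^ (5 / 4 : ℝ)), ← Real.rpow_mul hs.1.le]
          norm_num
  -- average over the annulus
  have hint : ∫⁻ y, ENNReal.ofReal (G y ^ 2) ≤ ENNReal.ofReal C * ∫⁻ y, ENNReal.ofReal (jetTwo f y) := by
    rw [← hjetint, ← lintegral_const_mul' _ _ ENNReal.ofReal_ne_top]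
    refine lintegral_mono fun y => ?_
    rw [← ENNReal.ofReal_mul hC]
    exact ENNReal.ofReal_le_ofReal (hCj h hhs y)
  have hmeas : Measurable fun p : E d × ℝ =>
      ENNReal.ofReal (256 * p.2 ^ (5 / 2 : ℝ)) * ENNReal.ofReal (G (p.2 • p.1) ^ 2) := by
    have h1 : Measurable fun p : E d × ℝ => ENNReal.ofReal (256 * p.2 ^ (5 / 2 : ℝ)) := by fun_prop
    exact h1.mul ((hGc.comp (continuous_snd.smul continuous_fst)).pow 2).measurable.ennreal_ofReal
  have avg : ENNReal.ofReal (f x ^ 2) * volume A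
      ≤ K * 256 * K * ENNReal.ofReal C * ∫⁻ y, ENNReal.ofReal (jetTwo f y) := by
    calc ENNReal.ofReal (f x ^ 2) * volume A = ∫⁻ _ in A, ENNReal.ofReal (f x ^ 2) := by
          rw [setLIntegral_const]
      _ ≤ ∫⁻ y in A, K * ∫⁻ s in Ioc (0 : ℝ) 1, ENNReal.ofReal (256 * s ^ (5 / 2 : ℝ)) *
            ENNReal.ofReal (G (s • y) ^ 2) := setLIntegral_mono' hAm key
      _ ≤ ∫⁻ y, K * ∫⁻ s in Ioc (0 : ℝ) 1, ENNReal.ofReal (256 * s ^ (5 / 2 : ℝ)) *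
            ENNReal.ofReal (G (s • y) ^ 2) := setLIntegral_le_lintegral _ _
      _ = K * ∫⁻ s in Ioc (0 : ℝ) 1, ∫⁻ y, ENNReal.ofReal (256 * s ^ (5 / 2 : ℝ)) *
            ENNReal.ofReal (G (s • y) ^ 2) := by
          rw [lintegral_const_mul' _ _ hKtop.ne, lintegral_lintegral_swap hmeas.aemeasurable]
      _ ≤ K * ∫⁻ s in Ioc (0 : ℝ) 1, 256 * ENNReal.ofReal (s ^ (-(1 / 2) : ℝ)) *
            ∫⁻ y, ENNReal.ofReal (G y ^ 2) := by
          refine mul_le_mul' le_rfl ?_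
          refine setLIntegral_mono' measurableSet_Ioc fun s hs => ?_
          have hs0 := hs.1
          rw [lintegral_const_mul' _ _ ENNReal.ofReal_ne_top,
            lintegral_comp_smul (h := fun y => ENNReal.ofReal (G y ^ 2)) (by fun_prop) hs.1, ← mul_assoc]
          refine mul_le_mul' ?_ le_rfl
          rw [← ENNReal.ofReal_mul (by positivity), show (256 : ℝ≥0∞) = ENNReal.ofReal 256 by simp,
            ← ENNReal.ofReal_mul (by norm_num), mul_assoc]
          refine ENNReal.ofReal_le_ofReal (mul_le_mul_of_nonneg_left ?_ (by norm_num))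
          rw [← Real.rpow_natCast, ← Real.rpow_neg hs0.le, ← Real.rpow_add hs0]
          refine Real.rpow_le_rpow_of_exponent_ge hs0 hs.2 ?_
          have : (d : ℝ) ≤ 3 := by exact_mod_cast hd
          linarith
      _ = K * (256 * K * ∫⁻ y, ENNReal.ofReal (G y ^ 2)) := by
          rw [lintegral_mul_const _ (by fun_prop), lintegral_const_mul _ (by fun_prop)]
      _ ≤ K * (256 * K * (ENNReal.ofReal C * ∫⁻ y, ENNReal.ofReal (jetTwo f y))) := by gcongr
      _ = _ := by ring
  calc ENNReal.ofReal (f x ^ 2) = ENNReal.ofReal (f x ^ 2) * volume A / volume A := by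
        rw [ENNReal.mul_div_cancel_right hApos hAtop.ne]
    _ ≤ (K * 256 * K * ENNReal.ofReal C * ∫⁻ y, ENNReal.ofReal (jetTwo f y)) / volume A := by gcongr
    _ = _ := by rw [ENNReal.div_eq_inv_mul, ENNReal.div_eq_inv_mul]; ring

/-! ### Space-time fields -/

/-- A scalar field depending smoothly on time in `I` and on space. The set `I` need not be open. -/
def SmoothField (I : Set ℝ) (f : ℝ → E d → ℝ) : Prop :=
  ContDiffOn ℝ ∞ (fun p : ℝ × E d => f p.1 p.2) (I ×ˢ univ)

/-- A scalar field depending continuously on time in `I` and on space. -/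
def ContField (I : Set ℝ) (f : ℝ → E d → ℝ) : Prop :=
  ContinuousOn (fun p : ℝ × E d => f p.1 p.2) (I ×ˢ univ)

/-- The time derivative of a field. -/
def dt (f : ℝ → E d → ℝ) (t : ℝ) (x : E d) : ℝ := deriv (fun s => f s x) t

namespace SmoothField

variable {I : Set ℝ} {f g : ℝ → E d → ℝ}

lemma mono {J : Set ℝ} (hf : SmoothField I f) (h : J ⊆ I) : SmoothField J f :=
  ContDiffOn.mono hf (prod_mono h subset_rfl)

lemma contField (hf : SmoothField I f) : ContField I f := ContDiffOn.continuousOn hf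

lemma slice (hf : SmoothField I f) {t : ℝ} (ht : t ∈ I) : ContDiff ℝ ∞ (f t) := by
  rw [← contDiffOn_univ]
  exact ContDiffOn.comp (t := I ×ˢ univ) hf (contDiff_const.prodMk contDiff_id).contDiffOn
    fun x _ => ⟨ht, mem_univ _⟩

lemma add (hf : SmoothField I f) (hg : SmoothField I g) :
    SmoothField I (fun t x => f t x + g t x) := ContDiffOn.add hf hg

lemma sub (hf : SmoothField I f) (hg : SmoothField I g) :
    SmoothField I (fun t x => f t x - g t x) := ContDiffOn.sub hf hg

lemma mul (hf : SmoothField I f) (hg : SmoothField I g) :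
    SmoothField I (fun t x => f t x * g t x) := ContDiffOn.mul hf hg

lemma pow (hf : SmoothField I f) (n : ℕ) :
    SmoothField I (fun t x => f t x ^ n) := ContDiffOn.pow hf n

lemma const_mul (hf : SmoothField I f) (c : ℝ) :
    SmoothField I (fun t x => c * f t x) := ContDiffOn.mul contDiffOn_const hf

lemma sum {ι : Type*} {s : Finset ι} {f : ι → ℝ → E d → ℝ} (hf : ∀ i ∈ s, SmoothField I (f i)) :
    SmoothField I (fun t x => ∑ i ∈ s, f i t x) := ContDiffOn.sum hf

lemma hasFDerivWithinAt (hf : SmoothField I f) {t : ℝ} (ht : t ∈ I) (x : E d) :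
    HasFDerivWithinAt (fun p : ℝ × E d => f p.1 p.2)
      (fderivWithin ℝ (fun p : ℝ × E d => f p.1 p.2) (I ×ˢ univ) (t, x)) (I ×ˢ univ) (t, x) :=
  (ContDiffOn.differentiableOn hf (by simp) (t, x) ⟨ht, mem_univ _⟩).hasFDerivWithinAt

lemma pd_eq (hf : SmoothField I f) {t : ℝ} (ht : t ∈ I) (k : Fin d) (x : E d) :
    pd k (f t) x = fderivWithin ℝ (fun p : ℝ × E d => f p.1 p.2) (I ×ˢ univ) (t, x)
      (0, EuclideanSpace.single k 1) := by
  have h1 : HasFDerivAt (fun y : E d => ((t, y) : ℝ × E d)) (ContinuousLinearMap.inr ℝ ℝ (E d)) x :=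
    hasFDerivAt_prodMk_right t x
  have h2 : HasFDerivWithinAt (f t) _ univ x :=
    (hf.hasFDerivWithinAt ht x).comp x (s := univ) h1.hasFDerivWithinAt
      (fun y _ => ⟨ht, mem_univ _⟩)
  rw [hasFDerivWithinAt_univ] at h2
  rw [pd, h2.fderiv]
  simp

lemma pderiv (hI : UniqueDiffOn ℝ I) (hf : SmoothField I f) (k : Fin d) :
    SmoothField I (fun t => pd k (f t)) := by
  have h : ContDiffOn ℝ ∞ (fderivWithin ℝ (fun p : ℝ × E d => f p.1 p.2) (I ×ˢ univ)) (I ×ˢ univ) :=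
    ContDiffOn.fderivWithin hf (hI.prod uniqueDiffOn_univ) (by simp)
  refine (h.clm_apply (contDiffOn_const
    (c := ((0, EuclideanSpace.single k 1) : ℝ × E d)))).congr fun p hp => ?_
  exact hf.pd_eq hp.1 k p.2

lemma hasDerivAt (hI : IsOpen I) (hf : SmoothField I f) {t : ℝ} (ht : t ∈ I) (x : E d) :
    HasDerivAt (fun s => f s x) (dt f t x) t := by
  have h1 : ContDiffOn ℝ ∞ (fun s => f s x) I :=
    ContDiffOn.comp (t := I ×ˢ univ) hf (contDiff_id.prodMk contDiff_const).contDiffOn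
      fun x hx => ⟨hx, mem_univ _⟩
  exact ((h1.differentiableOn (by simp) t ht).differentiableAt (hI.mem_nhds ht)).hasDerivAt

lemma dt_eq (hI : IsOpen I) (hf : SmoothField I f) {t : ℝ} (ht : t ∈ I) (x : E d) :
    dt f t x = fderiv ℝ (fun p : ℝ × E d => f p.1 p.2) (t, x) (1, 0) := by
  have hd : DifferentiableAt ℝ (fun p : ℝ × E d => f p.1 p.2) (t, x) :=
    (ContDiffOn.differentiableOn hf (by simp) (t, x) ⟨ht, mem_univ _⟩).differentiableAt
      ((hI.prod isOpen_univ).mem_nhds ⟨ht, mem_univ _⟩)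
  have h1 : HasDerivAt (fun s : ℝ => ((s, x) : ℝ × E d)) (1, 0) t :=
    (hasDerivAt_id t).prodMk (hasDerivAt_const t x)
  exact (hd.hasFDerivAt.comp_hasDerivAt t h1).deriv

lemma timeDeriv (hI : IsOpen I) (hf : SmoothField I f) : SmoothField I (dt f) := by
  have h : ContDiffOn ℝ ∞ (fderiv ℝ (fun p : ℝ × E d => f p.1 p.2)) (I ×ˢ univ) :=
    ContDiffOn.fderiv_of_isOpen hf (hI.prod isOpen_univ) (by simp)
  refine (h.clm_apply (contDiffOn_const (c := ((1, 0) : ℝ × E d)))).congr fun p hp => ?_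
  exact hf.dt_eq hI hp.1 p.2

lemma dt_pd (hI : IsOpen I) (hf : SmoothField I f) {t : ℝ} (ht : t ∈ I) (k : Fin d) (x : E d) :
    dt (fun s => pd k (f s)) t x = pd k (dt f t) x := by
  set F : ℝ × E d → ℝ := fun p => f p.1 p.2 with hF
  have hO : IsOpen (I ×ˢ (univ : Set (E d))) := hI.prod isOpen_univ
  have hmem : ((t, x) : ℝ × E d) ∈ I ×ˢ (univ : Set (E d)) := ⟨ht, mem_univ _⟩
  have hFat : ContDiffAt ℝ ∞ F (t, x) := ContDiffOn.contDiffAt hf (hO.mem_nhds hmem)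
  have hF' : DifferentiableAt ℝ (fderiv ℝ F) (t, x) :=
    (hFat.fderiv_right (m := ∞) (by simp)).differentiableAt (by simp)
  have sym := hFat.isSymmSndFDerivAt (by simpa using (WithTop.coe_le_coe.2 (le_top : (2 : ℕ∞) ≤ ⊤)))
  have hpdt : ∀ s ∈ I, ∀ y, pd k (f s) y = fderiv ℝ F (s, y) (0, EuclideanSpace.single k 1) := by
    intro s hs y
    rw [hf.pd_eq hs, fderivWithin_of_isOpen hO ⟨hs, mem_univ _⟩]
  have h1 : HasDerivAt (fun s : ℝ => ((s, x) : ℝ × E d)) (1, 0) t :=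
    (hasDerivAt_id t).prodMk (hasDerivAt_const t x)
  have h2 : HasFDerivAt (fun y : E d => ((t, y) : ℝ × E d)) (ContinuousLinearMap.inr ℝ ℝ (E d)) x :=
    hasFDerivAt_prodMk_right t x
  have e1 : dt (fun s => pd k (f s)) t x
      = fderiv ℝ (fderiv ℝ F) (t, x) (1, 0) (0, EuclideanSpace.single k 1) := by
    have h0 : HasDerivAt (fun s => fderiv ℝ F (s, x)) (fderiv ℝ (fderiv ℝ F) (t, x) (1, 0)) t :=
      hF'.hasFDerivAt.comp_hasDerivAt t h1
    have h3 := h0.clm_apply (hasDerivAt_const t ((0, EuclideanSpace.single k 1) : ℝ × E d))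
    have h4 : (fun s => pd k (f s) x) =ᶠ[nhds t]
        fun s => fderiv ℝ F (s, x) (0, EuclideanSpace.single k 1) := by
      filter_upwards [hI.mem_nhds ht] with s hs using hpdt s hs x
    rw [dt, h4.deriv_eq]
    rw [h3.deriv]
    simp
  have e2 : pd k (dt f t) x
      = fderiv ℝ (fderiv ℝ F) (t, x) (0, EuclideanSpace.single k 1) (1, 0) := by
    have h3 := (hF'.hasFDerivAt.comp x h2).clm_apply
      (hasFDerivAt_const ((1, 0) : ℝ × E d) x)
    have h4 : dt f t = fun y => fderiv ℝ F (t, y) (1, 0) := funext fun y => hf.dt_eq hI ht y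
    rw [pd, h4]
    rw [show (fun y => fderiv ℝ F (t, y) (1, 0)) = fun y => (fderiv ℝ F ∘ fun y => (t, y)) y (1, 0) from rfl,
      h3.fderiv]
    simp
  rw [e1, e2]
  exact sym _ _

end SmoothField

namespace ContField

variable {I : Set ℝ} {f g : ℝ → E d → ℝ}

lemma mono {J : Set ℝ} (hf : ContField I f) (h : J ⊆ I) : ContField J f :=
  ContinuousOn.mono hf (prod_mono h subset_rfl)

lemma add (hf : ContField I f) (hg : ContField I g) :
    ContField I (fun t x => f t x + g t x) := ContinuousOn.add hf hg

lemma mul (hf : ContField I f) (hg : ContField I g) :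
    ContField I (fun t x => f t x * g t x) := ContinuousOn.mul hf hg

lemma const_mul (hf : ContField I f) (c : ℝ) :
    ContField I (fun t x => c * f t x) := ContinuousOn.mul continuousOn_const hf

lemma sqrt (hf : ContField I f) : ContField I (fun t x => √(f t x)) :=
  Real.continuous_sqrt.comp_continuousOn hf

lemma slice (hf : ContField I f) {t : ℝ} (ht : t ∈ I) : Continuous (f t) := by
  rw [← continuousOn_univ]
  exact ContinuousOn.comp (t := I ×ˢ (univ : Set (E d))) (f := fun y => (t, y)) hf (by fun_prop)
    fun x _ => ⟨ht, mem_univ _⟩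

lemma time (hf : ContField I f) (x : E d) : ContinuousOn (fun t => f t x) I :=
  ContinuousOn.comp (t := I ×ˢ (univ : Set (E d))) (f := fun s => (s, x)) hf (by fun_prop)
    fun t ht => ⟨ht, mem_univ _⟩

lemma continuousOn_integral (hf : ContField I f) {φ : E d → ℝ} (hφ : IsTest φ) :
    ContinuousOn (fun t => ∫ x, f t x * φ x) I := by
  refine continuousOn_integral_of_compact_support (k := tsupport φ) hφ.2 ?_ ?_
  · exact ContinuousOn.mul hf (hφ.continuous.comp continuous_snd).continuousOn
  · intro t x _ hx
    rw [image_eq_zero_of_notMem_tsupport hx, mul_zero]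

lemma exists_bound (hf : ContField I f) {J : Set ℝ} (hJ : IsCompact J) (hJI : J ⊆ I)
    {K : Set (E d)} (hK : IsCompact K) : ∃ M : ℝ, ∀ t ∈ J, ∀ x ∈ K, |f t x| ≤ M := by
  obtain ⟨M, hM⟩ := (hJ.prod hK).exists_bound_of_continuousOn
    (ContinuousOn.mono hf (prod_mono hJI (subset_univ _)))
  exact ⟨M, fun t ht x hx => hM (t, x) ⟨ht, hx⟩⟩

lemma aestronglyMeasurable (hf : ContField I f) (hI : MeasurableSet I) :
    AEStronglyMeasurable (fun p : ℝ × E d => f p.1 p.2) ((volume.restrict I).prod volume) := by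
  rw [← Measure.restrict_univ (μ := (volume : Measure (E d))), Measure.prod_restrict]
  exact ContinuousOn.aestronglyMeasurable hf (hI.prod MeasurableSet.univ)

lemma integral_swap {a b : ℝ} (hab : a ≤ b) (hf : ContField (Icc a b) f) {φ : E d → ℝ}
    (hφ : IsTest φ) :
    ∫ t in a..b, ∫ x, f t x * φ x = ∫ x, (∫ t in a..b, f t x) * φ x := by
  simp only [intervalIntegral.integral_of_le hab]
  rw [integral_integral_swap]
  · simp only [integral_mul_const]
  · obtain ⟨M, hM⟩ := hf.exists_bound isCompact_Icc subset_rfl hφ.2.isCompact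
    have hm := (hf.mono Ioc_subset_Icc_self).aestronglyMeasurable measurableSet_Ioc
    have h1 : Integrable (fun p : ℝ × E d => (1 : ℝ) * φ p.2)
        ((volume.restrict (Ioc a b)).prod volume) :=
      (integrable_const (1 : ℝ)).mul_prod hφ.integrable
    refine Integrable.mono' (h1.norm.const_mul M) (hm.mul
      (hφ.continuous.comp continuous_snd).aestronglyMeasurable) ?_
    have hae : ∀ᵐ p ∂((volume.restrict (Ioc a b)).prod (volume : Measure (E d))),
        p ∈ Ioc a b ×ˢ (univ : Set (E d)) := by
      rw [← Measure.restrict_univ (μ := (volume : Measure (E d))), Measure.prod_restrict]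
      exact ae_restrict_mem (measurableSet_Ioc.prod MeasurableSet.univ)
    filter_upwards [hae] with p hp
    simp only [one_mul, Function.uncurry, norm_mul, Real.norm_eq_abs]
    by_cases hx : p.2 ∈ tsupport φ
    · gcongr
      exact hM _ (Ioc_subset_Icc_self hp.1) _ hx
    · simp [image_eq_zero_of_notMem_tsupport hx]

end ContField

lemma SmoothField.hasDerivAt_integral {I : Set ℝ} (hI : IsOpen I) {f : ℝ → E d → ℝ}
    (hf : SmoothField I f) {φ : E d → ℝ} (hφ : IsTest φ) {t : ℝ} (ht : t ∈ I) :
    HasDerivAt (fun s => ∫ x, f s x * φ x) (∫ x, dt f t x * φ x) t := by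
  obtain ⟨ε, hε, hεI⟩ := Metric.isOpen_iff.1 hI t ht
  have hsub : Metric.closedBall t (ε / 2) ⊆ I :=
    (Metric.closedBall_subset_ball (by linarith)).trans hεI
  obtain ⟨M, hM⟩ := (hf.timeDeriv hI).contField.exists_bound (isCompact_closedBall t (ε / 2)) hsub hφ.2.isCompact
  refine (hasDerivAt_integral_of_dominated_loc_of_deriv_le (bound := fun x => M * ‖φ x‖)
    (F' := fun s x => dt f s x * φ x)
    (Metric.ball_mem_nhds t (half_pos hε)) ?_ ?_ ?_ ?_ ?_ ?_).2
  · filter_upwards [hI.mem_nhds ht] with s hs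
    exact ((hf.slice hs).continuous.mul hφ.continuous).aestronglyMeasurable
  · exact (hφ.integrable_mul (hf.slice ht).continuous).congr (by filter_upwards with x; ring)
  · exact (((hf.timeDeriv hI).slice ht).continuous.mul hφ.continuous).aestronglyMeasurable
  · filter_upwards with x s hs
    rw [norm_mul, Real.norm_eq_abs]
    by_cases hx : x ∈ tsupport φ
    · gcongr
      exact hM s (Metric.ball_subset_closedBall hs) x hx
    · simp [image_eq_zero_of_notMem_tsupport hx]
  · exact hφ.integrable.norm.const_mul M
  · filter_upwards with x s hs
    exact (hf.hasDerivAt hI (hsub (Metric.ball_subset_closedBall hs)) x).mul_const _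

/-! ### The momentum balance tested with fields that are not solenoidal -/

/-- Minkowski's integral inequality, for the time integral of a continuous field. -/
lemma lintegral_integral_sq_le {g : ℝ → E d → ℝ} {t τ : ℝ} (htτ : t ≤ τ)
    (hg : ContField (Icc t τ) g) {a : ℝ → ℝ}
    (hga : ∀ᵐ s ∂(volume.restrict (Ioc t τ)), ∫⁻ x, ‖g s x‖ₑ ^ 2 ≤ ENNReal.ofReal (a s) ^ 2) :
    ∫⁻ x, ‖∫ s in t..τ, g s x‖ₑ ^ 2 ≤ (∫⁻ s in Ioc t τ, ENNReal.ofReal (a s)) ^ 2 := by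
  set A := ∫⁻ s in Ioc t τ, ENNReal.ofReal (a s) with hA
  have hm : AEMeasurable (fun p : ℝ × E d => ‖g p.1 p.2‖ₑ) ((volume.restrict (Ioc t τ)).prod volume) :=
    ((hg.mono Ioc_subset_Icc_self).aestronglyMeasurable measurableSet_Ioc).enorm
  have hms : ∀ s ∈ Ioc t τ, Measurable fun x => ‖g s x‖ₑ := fun s hs =>
    (hg.slice (Ioc_subset_Icc_self hs)).measurable.enorm
  set G : E d → ℝ≥0∞ := fun x => ∫⁻ s in Ioc t τ, ‖g s x‖ₑ with hG
  have hGm : AEMeasurable G volume := hm.lintegral_prod_left'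
  have hle : ∀ x, ‖∫ s in t..τ, g s x‖ₑ ≤ G x := fun x => by
    rw [intervalIntegral.integral_of_le htτ]; exact enorm_integral_le_lintegral_enorm _
  -- the bound on balls, where the left-hand side is finite beforehand
  have hball : ∀ n : ℕ, ∫⁻ x in Metric.ball 0 n, G x ^ 2 ≤ A ^ 2 := by
    intro n
    set ν := (volume : Measure (E d)).restrict (Metric.ball 0 n) with hν
    set J := ∫⁻ x, G x ^ 2 ∂ν with hJ
    have hJtop : J < ⊤ := by
      obtain ⟨M, hM⟩ := hg.exists_bound isCompact_Icc subset_rfl (isCompact_closedBall (0 : E d) n)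
      have hb : ∀ x ∈ Metric.ball (0 : E d) n, G x ^ 2 ≤ (ENNReal.ofReal M * ENNReal.ofReal (τ - t)) ^ 2 := by
        intro x hx
        gcongr
        calc G x ≤ ∫⁻ s in Ioc t τ, ENNReal.ofReal M := by
              refine setLIntegral_mono' measurableSet_Ioc fun s hs => ?_
              rw [← ofReal_norm, Real.norm_eq_abs]
              exact ENNReal.ofReal_le_ofReal
                (hM s (Ioc_subset_Icc_self hs) x (Metric.ball_subset_closedBall hx))
          _ = _ := by rw [setLIntegral_const, Real.volume_Ioc]
      calc J ≤ ∫⁻ x in Metric.ball (0 : E d) n, (ENNReal.ofReal M * ENNReal.ofReal (τ - t)) ^ 2 :=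
            setLIntegral_mono' Metric.isOpen_ball.measurableSet hb
        _ < ⊤ := by
            rw [setLIntegral_const]
            exact ENNReal.mul_lt_top (ENNReal.pow_lt_top
              (ENNReal.mul_lt_top ENNReal.ofReal_lt_top ENNReal.ofReal_lt_top)) measure_ball_lt_top
    have hJle : J ≤ J ^ (1 / 2 : ℝ) * A := by
      calc J = ∫⁻ x, (∫⁻ s in Ioc t τ, ‖g s x‖ₑ * G x) ∂ν := by
            refine lintegral_congr fun x => ?_
            rw [pow_two, lintegral_mul_const'']
            by_cases hx : AEMeasurable (fun s => ‖g s x‖ₑ) (volume.restrict (Ioc t τ))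
            · exact hx
            · exact absurd ((hg.mono Ioc_subset_Icc_self).time x |>.aestronglyMeasurable
                measurableSet_Ioc).enorm hx
        _ = ∫⁻ s in Ioc t τ, ∫⁻ x, ‖g s x‖ₑ * G x ∂ν := by
            rw [lintegral_lintegral_swap]
            have h1 : AEMeasurable (fun p : E d × ℝ => ‖g p.2 p.1‖ₑ)
                (ν.prod (volume.restrict (Ioc t τ))) := by
              have h2 : AEMeasurable (fun p : ℝ × E d => ‖g p.1 p.2‖ₑ)
                  ((volume.restrict (Ioc t τ)).prod ν) :=
                hm.mono_ac (Measure.AbsolutelyContinuous.rfl.prod Measure.restrict_le_self.absolutelyContinuous)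
              exact h2.prod_swap
            exact h1.mul ((hGm.mono_measure Measure.restrict_le_self).comp_quasiMeasurePreserving
              Measure.quasiMeasurePreserving_fst)
        _ ≤ ∫⁻ s in Ioc t τ, J ^ (1 / 2 : ℝ) * ENNReal.ofReal (a s) := by
            refine lintegral_mono_ae ?_
            filter_upwards [hga, ae_restrict_mem measurableSet_Ioc] with s hs hst
            have h1 := lintegral_mul_sq_le (ν := ν) (hms s hst).aemeasurable
              (hGm.mono_measure Measure.restrict_le_self)
            have h2 : ∫⁻ x, ‖g s x‖ₑ ^ 2 ∂ν ≤ ENNReal.ofReal (a s) ^ 2 :=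
              (setLIntegral_le_lintegral _ _).trans hs
            refine (ENNReal.pow_le_pow_left_iff two_ne_zero).1 (h1.trans ?_)
            rw [mul_pow, ← ENNReal.rpow_two (x := J ^ (1 / 2 : ℝ)), ← ENNReal.rpow_mul, mul_comm]
            norm_num
            gcongr
        _ = _ := lintegral_const_mul' _ _ (by
            exact (ENNReal.rpow_lt_top_of_nonneg (by norm_num) hJtop.ne).ne)
    by_cases hJ0 : J = 0
    · rw [hJ0]; exact bot_le
    have hsq : J = J ^ (1 / 2 : ℝ) * J ^ (1 / 2 : ℝ) := by
      rw [← ENNReal.rpow_add_of_nonneg _ _ (by norm_num) (by norm_num)]; norm_num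
    have hJ0' : J ^ (1 / 2 : ℝ) ≠ 0 := by
      simp [ENNReal.rpow_eq_zero_iff, hJ0]
    have hJt' : J ^ (1 / 2 : ℝ) ≠ ⊤ := (ENNReal.rpow_lt_top_of_nonneg (by norm_num) hJtop.ne).ne
    have h2 : J ^ (1 / 2 : ℝ) ≤ A := by
      rw [← ENNReal.mul_le_mul_iff_right hJ0' hJt', ← hsq]
      exact hJle
    calc J = (J ^ (1 / 2 : ℝ)) ^ 2 := by rw [pow_two]; exact hsq
      _ ≤ _ := by gcongr
  have hunion : (⋃ n : ℕ, Metric.ball (0 : E d) n) = univ := Metric.iUnion_ball_nat 0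
  calc ∫⁻ x, ‖∫ s in t..τ, g s x‖ₑ ^ 2 ≤ ∫⁻ x, G x ^ 2 := lintegral_mono fun x => by
        gcongr; exact hle x
    _ = ∫⁻ x in ⋃ n : ℕ, Metric.ball (0 : E d) n, G x ^ 2 := by rw [hunion, setLIntegral_univ]
    _ = ⨆ n : ℕ, ∫⁻ x in Metric.ball (0 : E d) n, G x ^ 2 := by
        refine setLIntegral_iUnion_of_directed _ ?_
        refine Monotone.directed_le fun m n hmn => ?_
        exact Metric.ball_subset_ball (by exact_mod_cast hmn)
    _ ≤ A ^ 2 := iSup_le hball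

/-- The momentum balance, known for solenoidal test fields only, holds for an arbitrary test field
`f` up to an error controlled by `div f`. For a smooth velocity of finite energy whose stress tensor
is in `L¹(0, S; L²)`, the pressure is thereby estimated without any hypothesis on its growth. As
`∂ₜ u (t)` need not be square-integrable, `pressure_estimate` is applied to the increments of `u`
over short time intervals. -/
lemma momentum_estimate (hd : 0 < d) {S : ℝ} {u : Fin d → ℝ → E d → ℝ}
    {F : Fin d → Fin d → ℝ → E d → ℝ} {a : ℝ → ℝ}
    (hu : ∀ α, SmoothField (Ioo 0 S) (u α)) (hF : ∀ α β, ContField (Ioo 0 S) (F α β))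
    (ha0 : ∀ t, 0 ≤ a t) (ha : IntegrableOn a (Ioo 0 S))
    (hFa : ∀ α β, ∀ᵐ s ∂(volume.restrict (Ioo 0 S)), ∫⁻ x, ‖F α β s x‖ₑ ^ 2 ≤ ENNReal.ofReal (a s) ^ 2)
    (huL2 : ∀ α, ∀ t ∈ Ioo 0 S, MemLp (u α t) 2)
    (hdiv : ∀ t ∈ Ioo 0 S, ∀ x, ∑ α, pd α (u α t) x = 0)
    (heq : ∀ t ∈ Ioo 0 S, ∀ w : Fin d → E d → ℝ, IsSolenoidalTest w →
      ∑ α, ∫ x, dt (u α) t x * w α x = ∑ α, ∑ β, ∫ x, F α β t x * pd β (w α) x) :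
    ∀ᵐ t ∂(volume.restrict (Ioo 0 S)), ∀ f : Fin d → E d → ℝ, (∀ α, IsTest (f α)) →
      |(∑ α, ∫ x, dt (u α) t x * f α x) - ∑ α, ∑ β, ∫ x, F α β t x * pd β (f α) x|
        ≤ d ^ 2 * a t * √(∫ x, (∑ α, pd α (f α) x) ^ 2) := by
  by_cases hS : 0 < S
  swap
  · simp [Ioo_eq_empty hS]
  have hai : IntervalIntegrable a volume 0 S :=
    (intervalIntegrable_iff_integrableOn_Ioo_of_le hS.le).2 ha
  rw [ae_restrict_iff' measurableSet_Ioo]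
  filter_upwards [hai.ae_hasDerivAt_integral] with t hat ht f hf
  have htI : t ∈ uIcc 0 S := by rw [uIcc_of_le hS.le]; exact Ioo_subset_Icc_self ht
  have hA := hat htI t htI
  -- the weak form of the balance and its time integral
  have hq : ∀ f : Fin d → E d → ℝ, (∀ α, IsTest (f α)) → ContinuousOn
      (fun s => ∑ α, ∑ β, ∫ x, F α β s x * pd β (f α) x) (Ioo 0 S) := fun f hf =>
    continuousOn_finsetSum _ fun α _ => continuousOn_finsetSum _ fun β _ =>
      (hF α β).continuousOn_integral ((hf α).pderiv β)
  have hψ : ∀ f : Fin d → E d → ℝ, (∀ α, IsTest (f α)) → ∀ s ∈ Ioo 0 S, HasDerivAt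
      (fun s => ∑ α, ∫ x, u α s x * f α x) (∑ α, ∫ x, dt (u α) s x * f α x) s := fun f hf s hs =>
    HasDerivAt.fun_sum fun α _ => (hu α).hasDerivAt_integral isOpen_Ioo (hf α) hs
  have hsub : ∀ {τ}, τ ∈ Ioo t S → Icc t τ ⊆ Ioo 0 S := fun hτ s hs =>
    ⟨ht.1.trans_le hs.1, hs.2.trans_lt hτ.2⟩
  have hswap : ∀ {τ}, τ ∈ Ioo t S → ∀ f : Fin d → E d → ℝ, (∀ α, IsTest (f α)) →
      ∫ s in t..τ, ∑ α, ∑ β, ∫ x, F α β s x * pd β (f α) x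
        = ∑ α, ∑ β, ∫ x, (∫ s in t..τ, F α β s x) * pd β (f α) x := by
    intro τ hτ f hf
    have hc : ∀ α β, IntervalIntegrable (fun s => ∫ x, F α β s x * pd β (f α) x) volume t τ := by
      intro α β
      refine ContinuousOn.intervalIntegrable ?_
      rw [uIcc_of_le hτ.1.le]
      exact ((hF α β).continuousOn_integral ((hf α).pderiv β)).mono (hsub hτ)
    rw [intervalIntegral.integral_finsetSum fun α _ => ?_]
    · refine Finset.sum_congr rfl fun α _ => ?_
      rw [intervalIntegral.integral_finsetSum fun β _ => hc α β]
      exact Finset.sum_congr rfl fun β _ =>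
        ((hF α β).mono (hsub hτ)).integral_swap hτ.1.le ((hf α).pderiv β)
    · have := IntervalIntegrable.sum Finset.univ (f := fun β s => ∫ x, F α β s x * pd β (f α) x)
        fun β _ => hc α β
      simpa only [Finset.sum_fn] using this
  set c := √(∫ x, (∑ α, pd α (f α) x) ^ 2) with hc
  -- the estimate for increments
  have hinc : ∀ τ ∈ Ioo t S,
      |((∑ α, ∫ x, u α τ x * f α x) - ∑ α, ∫ x, u α t x * f α x)
          - ∫ s in t..τ, ∑ α, ∑ β, ∫ x, F α β s x * pd β (f α) x|
        ≤ d ^ 2 * (∫ s in t..τ, a s) * c := by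
    intro τ hτ
    have hτI : τ ∈ Ioo 0 S := ⟨ht.1.trans hτ.1, hτ.2⟩
    have hIoc : Ioc t τ ⊆ Ioo 0 S := Ioc_subset_Icc_self.trans (hsub hτ)
    have haI : IntegrableOn a (Ioc t τ) := ha.mono_set hIoc
    have hN : 0 ≤ ∫ s in t..τ, a s :=
      intervalIntegral.integral_nonneg hτ.1.le fun s _ => ha0 s
    have hNeq : ∫⁻ s in Ioc t τ, ENNReal.ofReal (a s) = ENNReal.ofReal (∫ s in t..τ, a s) := by
      rw [intervalIntegral.integral_of_le hτ.1.le,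
        ofReal_integral_eq_lintegral_ofReal haI (Filter.Eventually.of_forall ha0)]
    have hΦc : ∀ α β, Continuous fun x => ∫ s in t..τ, F α β s x := by
      intro α β
      have h1 : Continuous (fun p : E d × ℝ => F α β (max t (min τ p.2)) p.1) := by
        rw [← continuousOn_univ]
        refine ContinuousOn.comp (t := Ioo 0 S ×ˢ (univ : Set (E d)))
          (f := fun p : E d × ℝ => (max t (min τ p.2), p.1)) (hF α β) (by fun_prop)
          fun p _ => ⟨hsub hτ ⟨le_max_left _ _, max_le hτ.1.le (min_le_left _ _)⟩, mem_univ _⟩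
      have h2 : ∀ x, ∫ s in t..τ, F α β s x = ∫ s in t..τ, F α β (max t (min τ s)) x := fun x => by
        refine intervalIntegral.integral_congr fun s hs => ?_
        rw [uIcc_of_le hτ.1.le] at hs
        simp only [min_eq_right hs.2, max_eq_right hs.1]
      simp only [h2]
      exact intervalIntegral.continuous_parametric_intervalIntegral_of_continuous'
        (f := fun x s => F α β (max t (min τ s)) x) h1 t τ
    have hΦle : ∀ α β, ∫⁻ x, ‖∫ s in t..τ, F α β s x‖ₑ ^ 2 ≤ ENNReal.ofReal (∫ s in t..τ, a s) ^ 2 := by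
      intro α β
      rw [← hNeq]
      exact lintegral_integral_sq_le hτ.1.le ((hF α β).mono (hsub hτ))
        (ae_restrict_of_ae_restrict_of_subset hIoc (hFa α β))
    have hΦ : ∀ α β, MemLp (fun x => ∫ s in t..τ, F α β s x) 2 := fun α β =>
      memLp_two_of_lintegral (hΦc α β).aestronglyMeasurable
        ((hΦle α β).trans_lt (ENNReal.pow_lt_top ENNReal.ofReal_lt_top))
    have hΦN : ∀ α β, ∫ x, (∫ s in t..τ, F α β s x) ^ 2 ≤ (∫ s in t..τ, a s) ^ 2 := by
      intro α β
      rw [integral_eq_lintegral_of_nonneg_ae (Filter.Eventually.of_forall fun x => sq_nonneg _)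
        ((hΦc α β).pow 2).aestronglyMeasurable]
      refine ENNReal.toReal_le_of_le_ofReal (sq_nonneg _) ?_
      exact (lintegral_congr fun x => ofReal_pow_two _).le.trans
        ((hΦle α β).trans_eq (ENNReal.ofReal_pow hN 2).symm)
    have hU : ∀ α, MemLp (fun x => u α τ x - u α t x) 2 := fun α =>
      (huL2 α τ hτI).sub (huL2 α t ht)
    have hincr : ∀ f : Fin d → E d → ℝ, (∀ α, IsTest (f α)) →
        ∑ α, ∫ x, (u α τ x - u α t x) * f α x
          = (∑ α, ∫ x, u α τ x * f α x) - ∑ α, ∫ x, u α t x * f α x := by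
      intro f hf
      rw [← Finset.sum_sub_distrib]
      refine Finset.sum_congr rfl fun α _ => ?_
      simp only [sub_mul]
      exact integral_sub ((huL2 α τ hτI).integrable_mul ((hf α).memLp 2))
        ((huL2 α t ht).integrable_mul ((hf α).memLp 2))
    have h := pressure_estimate hd (U := fun α x => u α τ x - u α t x)
      (Φ := fun α β x => ∫ s in t..τ, F α β s x) hU hΦ ?_ ?_ hN hΦN hf
    · rw [hincr f hf, ← hswap hτ f hf] at h
      exact h
    · intro η hη
      rw [hincr _ fun α => hη.pderiv α]
      have hz : ∀ s ∈ Ioo 0 S, ∑ α, ∫ x, u α s x * pd α η x = 0 := by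
        intro s hs
        have h1 : ∀ α, ∫ x, u α s x * pd α η x = - ∫ x, pd α (u α s) x * η x := by
          intro α
          rw [hη.integral_pd_mul' ((hu α).slice hs), neg_neg]
        simp only [h1, Finset.sum_neg_distrib]
        rw [← integral_finsetSum]
        · simp only [← Finset.sum_mul, hdiv s hs, zero_mul, integral_zero, neg_zero]
        · intro α _
          exact (hη.integrable_mul (contDiff_pd ((hu α).slice hs) α).continuous).congr
            (by filter_upwards with x; ring)
      rw [hz τ hτI, hz t ht, sub_zero]
    · intro w hw
      rw [hincr w hw.test, ← hswap hτ w hw.test]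
      have hint : IntervalIntegrable (fun s => ∑ α, ∑ β, ∫ x, F α β s x * pd β (w α) x) volume t τ := by
        refine ContinuousOn.intervalIntegrable ?_
        rw [uIcc_of_le hτ.1.le]
        exact (hq w hw.test).mono (hsub hτ)
      refine (intervalIntegral.integral_eq_sub_of_hasDerivAt
        (f := fun s => ∑ α, ∫ x, u α s x * w α x) (fun s hs => ?_) hint).symm
      rw [uIcc_of_le hτ.1.le] at hs
      rw [← heq s (hsub hτ hs) w hw]
      exact hψ w hw.test s (hsub hτ hs)
  -- divide by the length of the time interval
  have hqt : HasDerivAt (fun τ => ∫ s in t..τ, ∑ α, ∑ β, ∫ x, F α β s x * pd β (f α) x)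
      (∑ α, ∑ β, ∫ x, F α β t x * pd β (f α) x) t := by
    have hct := (hq f hf).continuousAt (isOpen_Ioo.mem_nhds ht)
    refine intervalIntegral.integral_hasDerivAt_right (by simp) ?_ hct
    exact (hq f hf).stronglyMeasurableAtFilter isOpen_Ioo t ht
  have hD := ((hψ f hf t ht).sub hqt).tendsto_slope_zero_right.norm
  have hB := ((hA.const_mul ((d : ℝ) ^ 2)).mul_const c).tendsto_slope_zero_right
  refine le_of_tendsto_of_tendsto hD hB ?_
  have hev : ∀ᶠ h : ℝ in nhdsWithin 0 (Ioi 0), h ∈ Ioo 0 (S - t) :=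
    Ioo_mem_nhdsGT (by linarith [ht.2])
  filter_upwards [hev] with h hh
  have h1 := hinc (t + h) ⟨by linarith [hh.1], by linarith [hh.2]⟩
  simp only [Pi.sub_apply, intervalIntegral.integral_same, sub_zero, mul_zero, zero_mul, smul_eq_mul,
    norm_mul, norm_inv, Real.norm_eq_abs, abs_of_pos hh.1]
  refine mul_le_mul_of_nonneg_left ?_ (inv_nonneg.2 hh.1.le)
  rw [sub_right_comm]
  exact h1

/-! ### Algebra of the energy balance -/

/-- The Frobenius inner product `A : B`. -/
def dot (A B : Mat d) : ℝ := ∑ i, ∑ j, A i j * B i j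

lemma dot_add_left (A B C : Mat d) : dot (A + B) C = dot A C + dot B C := by
  simp [dot, add_mul, Finset.sum_add_distrib]

lemma dot_add_right (A B C : Mat d) : dot A (B + C) = dot A B + dot A C := by
  simp [dot, mul_add, Finset.sum_add_distrib]

lemma dot_sub_left (A B C : Mat d) : dot (A - B) C = dot A C - dot B C := by
  simp [dot, sub_mul, Finset.sum_sub_distrib]

lemma dot_sub_right (A B C : Mat d) : dot A (B - C) = dot A B - dot A C := by
  simp [dot, mul_sub, Finset.sum_sub_distrib]

lemma dot_neg_right (A B : Mat d) : dot A (-B) = -dot A B := by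
  simp [dot, Finset.sum_neg_distrib]

lemma dot_smul_left (r : ℝ) (A B : Mat d) : dot (r • A) B = r * dot A B := by
  simp [dot, Finset.mul_sum, mul_assoc]

lemma dot_smul_right (r : ℝ) (A B : Mat d) : dot A (r • B) = r * dot A B := by
  simp [dot, Finset.mul_sum, mul_left_comm]

lemma dot_comm (A B : Mat d) : dot A B = dot B A := by
  simp [dot, mul_comm]

lemma dot_sum_right {ι : Type*} (s : Finset ι) (A : Mat d) (B : ι → Mat d) :
    dot A (∑ k ∈ s, B k) = ∑ k ∈ s, dot A (B k) := by
  simp only [dot, Matrix.sum_apply, Finset.mul_sum]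
  rw [Finset.sum_comm]
  exact (Finset.sum_congr rfl fun i _ => Finset.sum_comm).trans
    (Finset.sum_comm.trans (Finset.sum_congr rfl fun k _ => Finset.sum_comm))

lemma dot_one_left (A : Mat d) : dot 1 A = A.trace := by
  simp [dot, Matrix.one_apply, Matrix.trace]

lemma dot_eq_trace (A B : Mat d) : dot A B = (A.transpose * B).trace := by
  simp only [dot, Matrix.trace, Matrix.diag_apply, Matrix.mul_apply, Matrix.transpose_apply]
  exact Finset.sum_comm

lemma frobSq_eq_dot (A : Mat d) : frobSq A = dot A A := by
  simp [frobSq, dot, pow_two]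

lemma frobSq_nonneg (A : Mat d) : 0 ≤ frobSq A :=
  Finset.sum_nonneg fun _ _ => Finset.sum_nonneg fun _ _ => sq_nonneg _

lemma frob_nonneg (A : Mat d) : 0 ≤ frob A := Real.sqrt_nonneg _

lemma frob_sq (A : Mat d) : frob A ^ 2 = frobSq A := Real.sq_sqrt (frobSq_nonneg A)

lemma trace_sq_of_isSymm {A : Mat d} (hA : A.IsSymm) : (A * A).trace = frobSq A := by
  rw [frobSq_eq_dot, dot_eq_trace, hA.eq]

lemma abs_dot_le (A B : Mat d) : |dot A B| ≤ frob A * frob B := by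
  rw [frob, frob, ← Real.sqrt_mul (frobSq_nonneg A)]
  refine Real.abs_le_sqrt ?_
  have := Finset.sum_mul_sq_le_sq_mul_sq (Finset.univ : Finset (Fin d × Fin d))
    (fun p => A p.1 p.2) (fun p => B p.1 p.2)
  simpa only [dot, frobSq, ← Finset.univ_product_univ, Finset.sum_product] using this

/-- Symmetric and antisymmetric matrices are orthogonal. -/
lemma dot_eq_zero_of_symm_skew {A W : Mat d} (hA : A.IsSymm) (hW : W.transpose = -W) :
    dot A W = 0 := by
  have h : dot A W = dot A.transpose W.transpose := by
    simp only [dot, Matrix.transpose_apply]; exact Finset.sum_comm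
  rw [hA.eq, hW, dot_neg_right] at h
  linarith

/-- The bulk energy density `a/2 tr Q² - b/3 tr Q³ + c/4 (tr Q²)²`. -/
def bulk (a b c : ℝ) (A : Mat d) : ℝ :=
  a / 2 * (A * A).trace - b / 3 * (A * A * A).trace + c / 4 * (A * A).trace ^ 2

/-- The derivative of the bulk energy at the symmetric matrix `A` in the direction `B`. -/
def bulkD (a b c : ℝ) (A B : Mat d) : ℝ :=
  a * dot A B - b * dot (A * A) B + c * ((A * A).trace * dot A B)

lemma hasDerivAt_mul_apply {A B : ℝ → Mat d} {A' B' : Mat d} {t : ℝ}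
    (hA : ∀ i j, HasDerivAt (fun s => A s i j) (A' i j) t)
    (hB : ∀ i j, HasDerivAt (fun s => B s i j) (B' i j) t) (i j : Fin d) :
    HasDerivAt (fun s => (A s * B s) i j) ((A' * B t + A t * B') i j) t := by
  simp only [Matrix.mul_apply, Matrix.add_apply, ← Finset.sum_add_distrib]
  exact HasDerivAt.fun_sum fun k _ => (hA i k).mul (hB k j)

lemma hasDerivAt_trace {A : ℝ → Mat d} {A' : Mat d} {t : ℝ}
    (hA : ∀ i j, HasDerivAt (fun s => A s i j) (A' i j) t) :
    HasDerivAt (fun s => (A s).trace) A'.trace t := by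
  simp only [Matrix.trace, Matrix.diag_apply]
  exact HasDerivAt.fun_sum fun k _ => hA k k

lemma hasDerivAt_bulk (a b c : ℝ) {A : ℝ → Mat d} {A' : Mat d} {t : ℝ}
    (hA : ∀ i j, HasDerivAt (fun s => A s i j) (A' i j) t) (hs : (A t).IsSymm) :
    HasDerivAt (fun s => bulk a b c (A s)) (bulkD a b c (A t) A') t := by
  have h2 := hasDerivAt_mul_apply hA hA
  have h3 := hasDerivAt_mul_apply h2 hA
  have t2 := hasDerivAt_trace h2
  have t3 := hasDerivAt_trace h3
  refine (((t2.const_mul (a / 2)).sub (t3.const_mul (b / 3))).add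
    ((t2.pow 2).const_mul (c / 4))).congr_deriv ?_
  have e1 : (A' * A t + A t * A').trace = 2 * dot (A t) A' := by
    rw [Matrix.trace_add, Matrix.trace_mul_comm A', dot_eq_trace, hs.eq]; ring
  have e2 : ((A' * A t + A t * A') * A t + A t * A t * A').trace = 3 * dot (A t * A t) A' := by
    rw [dot_eq_trace, Matrix.transpose_mul, hs.eq, Matrix.trace_add, add_mul, Matrix.trace_add,
      Matrix.trace_mul_cycle A' (A t) (A t), Matrix.trace_mul_comm (A t * A') (A t), ← mul_assoc]
    ring
  rw [e1, e2, bulkD]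
  push_cast
  ring

/-- The pointwise algebra of the energy balance. Here `A, L, V, R, S + W` stand for
`Q, ΔQ, (u·∇)Q, ∂ₜQ, ∇u`, with `S` and `W` the symmetric and antisymmetric parts of `∇u`,
and `n` stands for `|Q|`. The couplings between the two equations cancel. -/
lemma energy_algebra {a b c κ μ lam Γ K n : ℝ} {A L V R S W : Mat d}
    (hA : A.IsSymm) (hL : L.IsSymm) (hV0 : V.trace = 0) (hR0 : R.trace = 0) (hS : S.IsSymm)
    (hW : W.transpose = -W) {H : Mat d}
    (hH : H = L - a • A + b • (A * A - ((A * A).trace / (d : ℝ)) • (1 : Mat d))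
      - c • ((A * A).trace • A))
    (hR : R + V + A * W - W * A - (lam * n) • S = Γ • H) :
    - dot L R + bulkD a b c A R + K * dot A R - dot V L
        + (- μ * dot (S + W) (S + W) + lam * n * dot H (S + W) - dot (A * L - L * A) (S + W)
          - κ * dot A (S + W))
      = - bulkD a b c A V - K * dot A V
        + (- μ * dot (S + W) (S + W) - Γ * dot H H - κ * dot A (S + W)
          + K * lam * n * dot A (S + W) + K * Γ * dot A H) := by
  have hHB : ∀ B : Mat d, B.trace = 0 → dot H B = dot L B - bulkD a b c A B := by
    intro B hB
    rw [hH]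
    simp only [dot_sub_left, dot_add_left, dot_smul_left, dot_one_left, hB, bulkD]
    ring
  have hHs : H.IsSymm := by
    have h1 : (A * A).IsSymm := by rw [Matrix.IsSymm, Matrix.transpose_mul, hA.eq]
    rw [hH]
    exact ((hL.sub (hA.smul _)).add ((h1.sub (Matrix.isSymm_one.smul _)).smul _)).sub
      ((hA.smul _).smul _)
  have hHA : H * A - A * H = L * A - A * L := by
    rw [hH]
    simp only [sub_mul, mul_sub, add_mul, mul_add, smul_mul_assoc, mul_smul_comm, mul_assoc, one_mul,
      mul_one]
    abel
  have hcomm : ∀ X : Mat d, X.IsSymm → dot X (A * W - W * A) = ((X * A - A * X) * W).trace := by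
    intro X hX
    rw [dot_eq_trace, hX.eq, mul_sub, Matrix.trace_sub, sub_mul, Matrix.trace_sub, ← mul_assoc,
      ← mul_assoc, Matrix.trace_mul_cycle X W A]
  have c1 : dot H (A * W - W * A) = dot (A * L - L * A) (S + W) := by
    have h1 : (A * L - L * A).transpose = L * A - A * L := by
      rw [Matrix.transpose_sub, Matrix.transpose_mul, Matrix.transpose_mul, hA.eq, hL.eq]
    have h2 : dot (A * L - L * A) S = 0 := by
      rw [dot_comm]
      refine dot_eq_zero_of_symm_skew hS ?_
      rw [h1]; abel
    rw [hcomm H hHs, hHA, dot_add_right, h2, zero_add, dot_eq_trace, h1]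
  have c2 : dot A (A * W - W * A) = 0 := by
    rw [hcomm A hA]; simp
  have c3 : dot H (S + W) = dot H S := by
    rw [dot_add_right, dot_eq_zero_of_symm_skew hHs hW, add_zero]
  have c4 : dot A (S + W) = dot A S := by
    rw [dot_add_right, dot_eq_zero_of_symm_skew hA hW, add_zero]
  have hR' : R = Γ • H - V - (A * W - W * A) + (lam * n) • S := by
    rw [← hR]; abel
  have e1 := hHB R hR0
  have e2 := hHB V hV0
  have e3 : dot H R = Γ * dot H H - dot H V - dot H (A * W - W * A) + lam * n * dot H S := by
    conv_lhs => rw [hR']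
    simp only [dot_sub_right, dot_add_right, dot_smul_right]
  have e4 : dot A R = Γ * dot A H - dot A V - dot A (A * W - W * A) + lam * n * dot A S := by
    conv_lhs => rw [hR']
    simp only [dot_sub_right, dot_add_right, dot_smul_right]
  rw [c1] at e3
  rw [c2] at e4
  rw [e4, c3, c4, dot_comm V L]
  linarith

/-! ### Differentiation of matrix fields -/

/-- The entrywise partial derivative of a matrix field. -/
def mpd (k : Fin d) (A : E d → Mat d) (x : E d) : Mat d :=
  Matrix.of fun i j => pd k (fun y => A y i j) x

/-- A matrix field with smooth entries. -/
def SmoothMat (A : E d → Mat d) : Prop := ∀ i j, ContDiff ℝ ∞ fun x => A x i j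

lemma SmoothMat.mpd {A : E d → Mat d} (hA : SmoothMat A) (k : Fin d) : SmoothMat (mpd k A) :=
  fun i j => contDiff_pd (hA i j) k

lemma SmoothMat.mul {A B : E d → Mat d} (hA : SmoothMat A) (hB : SmoothMat B) :
    SmoothMat fun x => A x * B x := fun i j => by
  simp only [Matrix.mul_apply]
  exact ContDiff.sum fun k _ => (hA i k).mul (hB k j)

lemma SmoothMat.trace {A : E d → Mat d} (hA : SmoothMat A) : ContDiff ℝ ∞ fun x => (A x).trace := by
  simp only [Matrix.trace, Matrix.diag_apply]
  exact ContDiff.sum fun k _ => hA k k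

lemma SmoothMat.dot {A B : E d → Mat d} (hA : SmoothMat A) (hB : SmoothMat B) :
    ContDiff ℝ ∞ fun x => dot (A x) (B x) :=
  ContDiff.sum fun i _ => ContDiff.sum fun j _ => (hA i j).mul (hB i j)

lemma SmoothMat.bulk (a b c : ℝ) {A : E d → Mat d} (hA : SmoothMat A) :
    ContDiff ℝ ∞ fun x => bulk a b c (A x) :=
  ((contDiff_const.mul (hA.mul hA).trace).sub
    (contDiff_const.mul ((hA.mul hA).mul hA).trace)).add
    (contDiff_const.mul ((hA.mul hA).trace.pow 2))

lemma matLap_eq (Q : E d → Mat d) (x : E d) : matLap Q x = ∑ k, mpd k (mpd k Q) x := by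
  ext i j
  simp only [matLap, lap, Matrix.of_apply, Matrix.sum_apply, mpd]

lemma SmoothMat.matLap {A : E d → Mat d} (hA : SmoothMat A) : SmoothMat (matLap A) :=
  fun i j => contDiff_lap (hA i j)

lemma gradOdot_apply (Q : E d → Mat d) (x : E d) (α β : Fin d) :
    gradOdot Q x α β = dot (mpd α Q x) (mpd β Q x) := rfl

lemma gradQSq_eq (Q : E d → Mat d) (x : E d) : gradQSq Q x = ∑ k, dot (mpd k Q x) (mpd k Q x) := by
  simp only [gradQSq, dot, mpd, Matrix.of_apply, ← pow_two]
  exact (Finset.sum_congr rfl fun _ _ => Finset.sum_comm).trans Finset.sum_comm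

lemma advectQ_eq (u : E d → E d) (Q : E d → Mat d) (x : E d) :
    advectQ u Q x = ∑ k, u x k • mpd k Q x := by
  ext i j
  simp [advectQ, mpd, Matrix.sum_apply]

lemma pd_dot {A B : E d → Mat d} (hA : SmoothMat A) (hB : SmoothMat B) (k : Fin d) (x : E d) :
    pd k (fun y => dot (A y) (B y)) x = dot (mpd k A x) (B x) + dot (A x) (mpd k B x) := by
  have dA : ∀ i j, DifferentiableAt ℝ (fun y => A y i j) x := fun i j => (hA i j).differentiable (by simp) x
  have dB : ∀ i j, DifferentiableAt ℝ (fun y => B y i j) x := fun i j => (hB i j).differentiable (by simp) x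
  simp only [dot, mpd, Matrix.of_apply]
  rw [pd_sum _ fun i _ => DifferentiableAt.fun_sum fun j _ => (dA i j).fun_mul (dB i j)]
  rw [← Finset.sum_add_distrib]
  refine Finset.sum_congr rfl fun i _ => ?_
  rw [pd_sum _ fun j _ => (dA i j).fun_mul (dB i j), ← Finset.sum_add_distrib]
  refine Finset.sum_congr rfl fun j _ => ?_
  rw [pd_mul (dA i j) (dB i j)]; ring

lemma hasDerivAt_line {f : E d → ℝ} (hf : ContDiff ℝ ∞ f) (k : Fin d) (x : E d) :
    HasDerivAt (fun s : ℝ => f (x + s • EuclideanSpace.single k 1)) (pd k f x) 0 := by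
  have h1 : HasDerivAt (fun s : ℝ => x + s • EuclideanSpace.single k (1 : ℝ))
      (EuclideanSpace.single k 1) 0 := by
    simpa using ((hasDerivAt_id (0 : ℝ)).smul_const (EuclideanSpace.single k (1 : ℝ))).const_add x
  have h2 : HasFDerivAt f (fderiv ℝ f x) (x + (0 : ℝ) • EuclideanSpace.single k (1 : ℝ)) := by
    rw [zero_smul, add_zero]; exact (hf.differentiable (by simp) x).hasFDerivAt
  exact h2.comp_hasDerivAt 0 h1

lemma pd_bulk (a b c : ℝ) {Q : E d → Mat d} (hQ : SmoothMat Q) (hs : ∀ x, (Q x).IsSymm)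
    (k : Fin d) (x : E d) :
    pd k (fun y => bulk a b c (Q y)) x = bulkD a b c (Q x) (mpd k Q x) := by
  have h1 := hasDerivAt_line (hQ.bulk a b c) k x
  have h2 := hasDerivAt_bulk a b c (A := fun s : ℝ => Q (x + s • EuclideanSpace.single k 1))
    (A' := mpd k Q x) (t := 0) (fun i j => hasDerivAt_line (hQ i j) k x) (by simpa using hs x)
  simpa using h1.unique h2

lemma bulkD_sum (a b c : ℝ) (A : Mat d) {ι : Type*} (s : Finset ι) (r : ι → ℝ) (B : ι → Mat d) :
    bulkD a b c A (∑ k ∈ s, r k • B k) = ∑ k ∈ s, r k * bulkD a b c A (B k) := by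
  simp only [bulkD, dot_sum_right, dot_smul_right, Finset.mul_sum]
  rw [← Finset.sum_sub_distrib, ← Finset.sum_add_distrib]
  exact Finset.sum_congr rfl fun _ _ => by ring

/-! ### The local energy balance -/

/-- The momentum flux: the velocity equation reads `∂ₜu_α + ∂_β F_{αβ} = -∂_α P`. -/
def stress (a b c κ μ lam : ℝ) (Q : E d → Mat d) (u : E d → E d) (x : E d) : Mat d :=
  Matrix.of (fun α β => u x α * u x β) - μ • gradU u x + gradOdot Q x
    + (lam * frob (Q x)) • molField a b c Q x
    - (Q x * matLap Q x - matLap Q x * Q x) - κ • Q x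

/-- The energy density without `½|∇Q|²`, with that term subtracted instead. -/
def lagrangian (a b c K : ℝ) (Q : E d → Mat d) (u : E d → E d) (x : E d) : ℝ :=
  1 / 2 * ∑ α, u x α ^ 2 - 1 / 2 * gradQSq Q x - bulk a b c (Q x) - K / 2 * frobSq (Q x)

/-- The energy flux whose divergence appears in the local energy balance; `R` stands for `∂ₜQ`. -/
def energyFlux (a b c K : ℝ) (Q R : E d → Mat d) (u : E d → E d) (k : Fin d) (x : E d) : ℝ :=
  dot (mpd k Q x) (R x) + ∑ α, u x α * dot (mpd α Q x) (mpd k Q x)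
    + u x k * lagrangian a b c K Q u x

lemma contDiff_frobSq {Q : E d → Mat d} (hQ : SmoothMat Q) : ContDiff ℝ ∞ fun x => frobSq (Q x) := by
  simpa only [frobSq_eq_dot] using hQ.dot hQ

lemma contDiff_gradQSq {Q : E d → Mat d} (hQ : SmoothMat Q) : ContDiff ℝ ∞ (gradQSq Q) := by
  have : gradQSq Q = fun x => ∑ k, dot (mpd k Q x) (mpd k Q x) := funext (gradQSq_eq Q)
  rw [this]
  exact ContDiff.sum fun k _ => (hQ.mpd k).dot (hQ.mpd k)

lemma contDiff_lagrangian (a b c K : ℝ) {Q : E d → Mat d} (hQ : SmoothMat Q) {u : E d → E d}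
    (hu : ∀ α, ContDiff ℝ ∞ fun x => u x α) : ContDiff ℝ ∞ (lagrangian a b c K Q u) :=
  (((contDiff_const.mul (ContDiff.sum fun α _ => (hu α).pow 2)).sub
    (contDiff_const.mul (contDiff_gradQSq hQ))).sub (hQ.bulk a b c)).sub
    (contDiff_const.mul (contDiff_frobSq hQ))

lemma contDiff_energyFlux (a b c K : ℝ) {Q R : E d → Mat d} (hQ : SmoothMat Q) (hR : SmoothMat R)
    {u : E d → E d} (hu : ∀ α, ContDiff ℝ ∞ fun x => u x α) (k : Fin d) :
    ContDiff ℝ ∞ (energyFlux a b c K Q R u k) :=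
  (((hQ.mpd k).dot hR).add (ContDiff.sum fun α _ => (hu α).mul ((hQ.mpd α).dot (hQ.mpd k)))).add
    ((hu k).mul (contDiff_lagrangian a b c K hQ hu))

lemma mpd_comm {Q : E d → Mat d} (hQ : SmoothMat Q) (k l : Fin d) (x : E d) :
    mpd k (mpd l Q) x = mpd l (mpd k Q) x := by
  ext i j
  exact pd_comm (hQ i j) k l x

lemma pd_lagrangian (a b c K : ℝ) {Q : E d → Mat d} (hQ : SmoothMat Q) (hs : ∀ x, (Q x).IsSymm)
    {u : E d → E d} (hu : ∀ α, ContDiff ℝ ∞ fun x => u x α) (k : Fin d) (x : E d) :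
    pd k (lagrangian a b c K Q u) x = ∑ α, u x α * gradU u x α k
      - ∑ l, dot (mpd k (mpd l Q) x) (mpd l Q x) - bulkD a b c (Q x) (mpd k Q x)
      - K * dot (Q x) (mpd k Q x) := by
  have D : ∀ {f : E d → ℝ}, ContDiff ℝ ∞ f → DifferentiableAt ℝ f x := fun h =>
    h.differentiable (by simp) x
  have h1 : ContDiff ℝ ∞ fun x => ∑ α, u x α ^ 2 := ContDiff.sum fun α _ => (hu α).pow 2
  have h2 := contDiff_gradQSq hQ
  have h3 := contDiff_frobSq hQ
  have h4 := hQ.bulk a b c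
  have e1 : pd k (fun x => ∑ α, u x α ^ 2) x = 2 * ∑ α, u x α * gradU u x α k := by
    rw [pd_sum _ fun α _ => D ((hu α).pow 2), Finset.mul_sum]
    refine Finset.sum_congr rfl fun α _ => ?_
    rw [pd_pow (D (hu α))]
    simp [gradU, mul_assoc]
  have e2 : pd k (gradQSq Q) x = 2 * ∑ l, dot (mpd k (mpd l Q) x) (mpd l Q x) := by
    have : gradQSq Q = fun x => ∑ k, dot (mpd k Q x) (mpd k Q x) := funext (gradQSq_eq Q)
    rw [this, pd_sum _ fun l _ => D ((hQ.mpd l).dot (hQ.mpd l)), Finset.mul_sum]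
    refine Finset.sum_congr rfl fun l _ => ?_
    rw [pd_dot (hQ.mpd l) (hQ.mpd l), dot_comm (mpd l Q x)]
    ring
  have e3 : pd k (fun x => frobSq (Q x)) x = 2 * dot (Q x) (mpd k Q x) := by
    simp only [frobSq_eq_dot]
    rw [pd_dot hQ hQ, dot_comm (mpd k Q x)]; ring
  have e4 := pd_bulk a b c hQ hs k x
  unfold lagrangian
  rw [pd_sub (D (((contDiff_const.mul h1).sub (contDiff_const.mul h2)).sub h4))
      (D (contDiff_const.mul h3)),
    pd_sub (D ((contDiff_const.mul h1).sub (contDiff_const.mul h2))) (D h4),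
    pd_sub (D (contDiff_const.mul h1)) (D (contDiff_const.mul h2)), pd_const_mul (D h1),
    pd_const_mul (D h2), pd_const_mul (D h3), e1, e2, e3, e4]
  ring

lemma sum_pd_energyFlux (a b c K : ℝ) {Q R : E d → Mat d} (hQ : SmoothMat Q) (hR : SmoothMat R)
    (hs : ∀ x, (Q x).IsSymm) {u : E d → E d} (hu : ∀ α, ContDiff ℝ ∞ fun x => u x α) {x : E d}
    (hdiv : divU u x = 0) :
    ∑ k, pd k (energyFlux a b c K Q R u k) x
      = dot (matLap Q x) (R x) + ∑ k, dot (mpd k Q x) (mpd k R x)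
        + dot (gradOdot Q x) (gradU u x) + dot (advectQ u Q x) (matLap Q x)
        + dot (Matrix.of fun α β => u x α * u x β) (gradU u x)
        - bulkD a b c (Q x) (advectQ u Q x) - K * dot (Q x) (advectQ u Q x) := by
  have D : ∀ {f : E d → ℝ}, ContDiff ℝ ∞ f → DifferentiableAt ℝ f x := fun h =>
    h.differentiable (by simp) x
  have hk : ∀ k, pd k (energyFlux a b c K Q R u k) x
      = dot (mpd k (mpd k Q) x) (R x) + dot (mpd k Q x) (mpd k R x)
        + ∑ α, (u x α * (dot (mpd k (mpd α Q) x) (mpd k Q x) + dot (mpd α Q x) (mpd k (mpd k Q) x))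
          + gradU u x α k * dot (mpd α Q x) (mpd k Q x))
        + (u x k * (∑ α, u x α * gradU u x α k
      - ∑ l, dot (mpd k (mpd l Q) x) (mpd l Q x) - bulkD a b c (Q x) (mpd k Q x)
      - K * dot (Q x) (mpd k Q x)) + pd k (fun y => u y k) x * lagrangian a b c K Q u x) := by
    intro k
    have h1 : ∀ α, ContDiff ℝ ∞ fun x => u x α * dot (mpd α Q x) (mpd k Q x) := fun α =>
      (hu α).mul ((hQ.mpd α).dot (hQ.mpd k))
    unfold energyFlux
    rw [pd_add (D (((hQ.mpd k).dot hR).add (ContDiff.sum fun α _ => h1 α)))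
        (D ((hu k).mul (contDiff_lagrangian a b c K hQ hu))),
      pd_add (D ((hQ.mpd k).dot hR)) (D (ContDiff.sum fun α _ => h1 α)),
      pd_mul (D (hu k)) (D (contDiff_lagrangian a b c K hQ hu)), pd_lagrangian a b c K hQ hs hu,
      pd_dot (hQ.mpd k) hR, pd_sum _ fun α _ => D (h1 α)]
    congr 2
    refine Finset.sum_congr rfl fun α _ => ?_
    rw [pd_mul (D (hu α)) (D ((hQ.mpd α).dot (hQ.mpd k))), pd_dot (hQ.mpd α) (hQ.mpd k)]
    rfl
  simp only [hk, mul_sub, mul_add, Finset.sum_add_distrib, Finset.sum_sub_distrib]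
  have hd0 : ∑ k, pd k (fun y => u y k) x * lagrangian a b c K Q u x = 0 := by
    rw [← Finset.sum_mul]
    have : ∑ k, pd k (fun y => u y k) x = 0 := hdiv
    rw [this, zero_mul]
  have h1 : dot (matLap Q x) (R x) = ∑ k, dot (mpd k (mpd k Q) x) (R x) := by
    rw [matLap_eq, dot_comm, dot_sum_right]
    exact Finset.sum_congr rfl fun k _ => dot_comm _ _
  have h2 : dot (gradOdot Q x) (gradU u x)
      = ∑ k, ∑ α, gradU u x α k * dot (mpd α Q x) (mpd k Q x) := by
    rw [Finset.sum_comm]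
    exact Finset.sum_congr rfl fun α _ => Finset.sum_congr rfl fun k _ => mul_comm _ _
  have h3 : dot (advectQ u Q x) (matLap Q x)
      = ∑ k, ∑ α, u x α * dot (mpd α Q x) (mpd k (mpd k Q) x) := by
    rw [matLap_eq, dot_sum_right]
    refine Finset.sum_congr rfl fun k _ => ?_
    rw [advectQ_eq, dot_comm, dot_sum_right]
    exact Finset.sum_congr rfl fun α _ => by rw [dot_smul_right, dot_comm]
  have h4 : dot (Matrix.of fun α β => u x α * u x β) (gradU u x)
      = ∑ k, u x k * ∑ α, u x α * gradU u x α k := by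
    simp only [Finset.mul_sum, dot, Matrix.of_apply]
    rw [Finset.sum_comm]
    exact Finset.sum_congr rfl fun α _ => Finset.sum_congr rfl fun k _ => by ring
  have h5 : bulkD a b c (Q x) (advectQ u Q x) = ∑ k, u x k * bulkD a b c (Q x) (mpd k Q x) := by
    rw [advectQ_eq, bulkD_sum]
  have h6 : K * dot (Q x) (advectQ u Q x) = ∑ k, u x k * (K * dot (Q x) (mpd k Q x)) := by
    rw [advectQ_eq, dot_sum_right, Finset.mul_sum]
    exact Finset.sum_congr rfl fun k _ => by rw [dot_smul_right]; ring
  have h7 : ∑ k, ∑ α, u x α * dot (mpd k (mpd α Q) x) (mpd k Q x)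
      = ∑ k, u x k * ∑ l, dot (mpd k (mpd l Q) x) (mpd l Q x) := by
    rw [Finset.sum_comm]
    refine Finset.sum_congr rfl fun k _ => ?_
    rw [Finset.mul_sum]
    exact Finset.sum_congr rfl fun l _ => by rw [mpd_comm hQ]
  rw [h1, h2, h3, h4, h5, h6, h7, hd0]
  ring

/-- The local energy production: the part of the energy balance that is not a divergence. -/
def production (a b c κ μ lam Γ K : ℝ) (Q : E d → Mat d) (u : E d → E d) (x : E d) : ℝ :=
  - μ * frobSq (gradU u x) - Γ * frobSq (molField a b c Q x) - κ * dot (Q x) (gradU u x)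
    + K * lam * frob (Q x) * dot (Q x) (gradU u x) + K * Γ * dot (Q x) (molField a b c Q x)

lemma symPart_add_skewPart (u : E d → E d) (x : E d) : symPart u x + skewPart u x = gradU u x := by
  rw [symPart, skewPart, ← smul_add]
  ext i j
  simp; ring

lemma isSymm_symPart (u : E d → E d) (x : E d) : (symPart u x).IsSymm := by
  ext i j
  simp [symPart]; ring

lemma transpose_skewPart (u : E d → E d) (x : E d) : (skewPart u x).transpose = - skewPart u x := by
  ext i j
  simp [skewPart]; ring

lemma isSymm_matLap {Q : E d → Mat d} (hs : ∀ x, (Q x).IsSymm) (x : E d) :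
    (matLap Q x).IsSymm := by
  ext i j
  have : (fun y => Q y j i) = fun y => Q y i j := funext fun y => (hs y).apply i j
  simp [matLap, this]

lemma trace_mpd {Q : E d → Mat d} (hQ : SmoothMat Q) (h0 : ∀ x, (Q x).trace = 0) (k : Fin d)
    (x : E d) : (mpd k Q x).trace = 0 := by
  have h1 := pd_sum Finset.univ (f := fun i y => Q y i i)
    (fun i _ => (hQ i i).differentiable (by simp) x) k
  have h2 : (fun y => ∑ i, Q y i i) = fun _ => (0 : ℝ) := funext h0
  rw [h2, pd_const] at h1
  exact h1.symm

/-- The localized energy balance at one time, pointwise in space: testing the equations with `φ`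
gives a divergence, the production weighted by `φ`, and an error that contains only `∇φ`. -/
lemma local_energy_balance {a b c κ μ lam Γ K : ℝ} {Q R : E d → Mat d} (hQ : SmoothMat Q)
    (hR : SmoothMat R) (hs : ∀ x, (Q x).IsSymm) (h0 : ∀ x, (Q x).trace = 0) {u : E d → E d}
    (hu : ∀ α, ContDiff ℝ ∞ fun x => u x α) {x : E d} (hR0 : (R x).trace = 0)
    (hdiv : divU u x = 0)
    (heq : R x + advectQ u Q x + Q x * skewPart u x - skewPart u x * Q x
      - (lam * frob (Q x)) • symPart u x = Γ • molField a b c Q x)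
    {φ : E d → ℝ} (hφ : ContDiff ℝ ∞ φ) :
    φ x * (∑ k, dot (mpd k Q x) (mpd k R x) + bulkD a b c (Q x) (R x) + K * dot (Q x) (R x))
      + ∑ α, ∑ β, stress a b c κ μ lam Q u x α β * pd β (fun y => φ y * u y α) x
    = ∑ k, pd k (fun y => φ y * energyFlux a b c K Q R u k y) x
      + φ x * production a b c κ μ lam Γ K Q u x
      + ∑ k, pd k φ x * (∑ α, stress a b c κ μ lam Q u x α k * u x α
        - energyFlux a b c K Q R u k x) := by
  have D : ∀ {f : E d → ℝ}, ContDiff ℝ ∞ f → DifferentiableAt ℝ f x := fun h =>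
    h.differentiable (by simp) x
  have hV0 : (advectQ u Q x).trace = 0 := by
    rw [advectQ_eq, Matrix.trace_sum]
    exact Finset.sum_eq_zero fun k _ => by rw [Matrix.trace_smul, trace_mpd hQ h0, smul_zero]
  have halg := energy_algebra (κ := κ) (μ := μ) (K := K) (hs x) (isSymm_matLap hs x) hV0 hR0
    (isSymm_symPart u x) (transpose_skewPart u x) (H := molField a b c Q x) rfl heq
  rw [symPart_add_skewPart] at halg
  have hflux := sum_pd_energyFlux a b c K hQ hR hs hu hdiv
  have e1 : ∑ k, pd k (fun y => φ y * energyFlux a b c K Q R u k y) x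
      = φ x * ∑ k, pd k (energyFlux a b c K Q R u k) x
        + ∑ k, pd k φ x * energyFlux a b c K Q R u k x := by
    rw [Finset.mul_sum, ← Finset.sum_add_distrib]
    exact Finset.sum_congr rfl fun k _ =>
      pd_mul (D hφ) (D (contDiff_energyFlux a b c K hQ hR hu k)) k
  have e2 : ∑ α, ∑ β, stress a b c κ μ lam Q u x α β * pd β (fun y => φ y * u y α) x
      = φ x * dot (stress a b c κ μ lam Q u x) (gradU u x)
        + ∑ k, pd k φ x * ∑ α, stress a b c κ μ lam Q u x α k * u x α := by
    have : ∑ k, pd k φ x * ∑ α, stress a b c κ μ lam Q u x α k * u x α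
        = ∑ α, ∑ k, pd k φ x * (stress a b c κ μ lam Q u x α k * u x α) := by
      simp only [Finset.mul_sum]; exact Finset.sum_comm
    rw [this, dot, Finset.mul_sum, ← Finset.sum_add_distrib]
    refine Finset.sum_congr rfl fun α _ => ?_
    rw [Finset.mul_sum, ← Finset.sum_add_distrib]
    refine Finset.sum_congr rfl fun β _ => ?_
    rw [pd_mul (D hφ) (D (hu α))]
    simp only [gradU, Matrix.of_apply]
    ring
  have e3 : dot (stress a b c κ μ lam Q u x) (gradU u x)
      = dot (Matrix.of fun α β => u x α * u x β) (gradU u x) - μ * dot (gradU u x) (gradU u x)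
        + dot (gradOdot Q x) (gradU u x)
        + lam * frob (Q x) * dot (molField a b c Q x) (gradU u x)
        - dot (Q x * matLap Q x - matLap Q x * Q x) (gradU u x) - κ * dot (Q x) (gradU u x) := by
    simp only [stress, dot_sub_left, dot_add_left, dot_smul_left]
  have e4 : ∑ k, pd k φ x * (∑ α, stress a b c κ μ lam Q u x α k * u x α
        - energyFlux a b c K Q R u k x)
      = ∑ k, pd k φ x * ∑ α, stress a b c κ μ lam Q u x α k * u x α
        - ∑ k, pd k φ x * energyFlux a b c K Q R u k x := by
    rw [← Finset.sum_sub_distrib]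
    exact Finset.sum_congr rfl fun k _ => by ring
  rw [e1, e2, e3, e4, hflux, production, frobSq_eq_dot, frobSq_eq_dot]
  linear_combination φ x * halg

/-! ### Pointwise bounds -/

section Frobenius

attribute [local instance] Matrix.frobeniusNormedRing Matrix.frobeniusNormedAlgebra

lemma frob_eq_norm (A : Mat d) : frob A = ‖A‖ := by
  rw [Matrix.frobenius_norm_def, frob, Real.sqrt_eq_rpow]
  simp [frobSq]

lemma frob_add_le (A B : Mat d) : frob (A + B) ≤ frob A + frob B := by
  simpa only [frob_eq_norm] using norm_add_le A B

lemma frob_sub_le (A B : Mat d) : frob (A - B) ≤ frob A + frob B := by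
  simpa only [frob_eq_norm] using norm_sub_le A B

lemma frob_mul_le (A B : Mat d) : frob (A * B) ≤ frob A * frob B := by
  simpa only [frob_eq_norm] using norm_mul_le A B

lemma frob_smul (r : ℝ) (A : Mat d) : frob (r • A) = |r| * frob A := by
  simpa only [frob_eq_norm] using (norm_smul r A).trans (by rw [Real.norm_eq_abs])

lemma frob_sum_le {ι : Type*} (s : Finset ι) (A : ι → Mat d) :
    frob (∑ k ∈ s, A k) ≤ ∑ k ∈ s, frob (A k) := by
  simpa only [frob_eq_norm] using norm_sum_le s A

lemma frob_transpose (A : Mat d) : frob A.transpose = frob A := by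
  rw [frob, frob, frobSq, frobSq, Finset.sum_comm]; rfl

end Frobenius

lemma abs_apply_le_frob (A : Mat d) (i j : Fin d) : |A i j| ≤ frob A := by
  refine Real.abs_le_sqrt ?_
  calc A i j ^ 2 ≤ ∑ j, A i j ^ 2 :=
        Finset.single_le_sum (f := fun j => A i j ^ 2) (fun _ _ => sq_nonneg _) (Finset.mem_univ j)
    _ ≤ frobSq A := Finset.single_le_sum (f := fun i => ∑ j, A i j ^ 2)
        (fun _ _ => Finset.sum_nonneg fun _ _ => sq_nonneg _) (Finset.mem_univ i)

lemma abs_trace_cube_le {A : Mat d} (hA : A.IsSymm) : |(A * A * A).trace| ≤ frob A ^ 3 := by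
  have h1 : (A * A * A).trace = dot (A * A) A := by
    rw [dot_eq_trace, Matrix.transpose_mul, hA.eq]
  rw [h1]
  calc _ ≤ frob (A * A) * frob A := abs_dot_le _ _
    _ ≤ (frob A * frob A) * frob A := by gcongr; exacts [frob_nonneg _, frob_mul_le _ _]
    _ = _ := by ring

lemma bulk_eq (a b c : ℝ) {A : Mat d} (hA : A.IsSymm) :
    bulk a b c A = a / 2 * frob A ^ 2 - b / 3 * (A * A * A).trace + c / 4 * frob A ^ 4 := by
  rw [bulk, trace_sq_of_isSymm hA, ← frob_sq]; ring

/-- The multiple of `½|Q|²` that is added to the bulk energy to make it coercive. -/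
def coerc (a b c : ℝ) : ℝ := 1 + |a| + b ^ 2 / c

lemma le_bulk_add (a b : ℝ) {c : ℝ} (hc : 0 < c) {A : Mat d} (hA : A.IsSymm) :
    1 / 2 * frob A ^ 2 + c / 8 * frob A ^ 4 ≤ bulk a b c A + coerc a b c / 2 * frob A ^ 2 := by
  rw [bulk_eq a b c hA, coerc]
  set q := frob A
  have hq : 0 ≤ q := frob_nonneg A
  have h1 : |b / 3 * (A * A * A).trace| ≤ |b| / 3 * q ^ 3 := by
    rw [abs_mul, abs_div, abs_of_pos (three_pos : (0:ℝ) < 3)]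
    gcongr
    exact abs_trace_cube_le hA
  have h2 : |b| / 3 * q ^ 3 ≤ c / 8 * q ^ 4 + b ^ 2 / c / 2 * q ^ 2 := by
    have h3 : c / 8 * q ^ 4 + b ^ 2 / c / 2 * q ^ 2 - |b| / 3 * q ^ 3
        = q ^ 2 / c * ((c * q / 3 - |b| / 2) ^ 2 + c ^ 2 * q ^ 2 / 72 + |b| ^ 2 / 4) := by
      rw [← sq_abs b]; field_simp; ring
    have h4 : 0 ≤ q ^ 2 / c * ((c * q / 3 - |b| / 2) ^ 2 + c ^ 2 * q ^ 2 / 72 + |b| ^ 2 / 4) := by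
      positivity
    linarith
  have h5 : -|a| * q ^ 2 ≤ a * q ^ 2 := by gcongr; exact neg_abs_le a
  have h6 := le_abs_self (b / 3 * (A * A * A).trace)
  nlinarith

lemma abs_bulk_le (a b c : ℝ) {A : Mat d} (hA : A.IsSymm) :
    |bulk a b c A| ≤ (|a| + |b| + |c|) * (frob A ^ 2 + frob A ^ 4) := by
  rw [bulk_eq a b c hA]
  set q := frob A
  have hq : 0 ≤ q := frob_nonneg A
  have h1 : |b / 3 * (A * A * A).trace| ≤ |b| * (q ^ 2 + q ^ 4) := by
    rw [abs_mul, abs_div, abs_of_pos (three_pos : (0:ℝ) < 3)]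
    have := abs_trace_cube_le hA
    have h3 : q ^ 3 ≤ q ^ 2 + q ^ 4 := by nlinarith [sq_nonneg (q ^ 2 - q), sq_nonneg (q ^ 2), sq_nonneg q]
    calc _ ≤ |b| / 3 * (q ^ 2 + q ^ 4) := by gcongr; exact this.trans h3
      _ ≤ _ := by gcongr; linarith [abs_nonneg b]
  have h2 : |a / 2 * q ^ 2| ≤ |a| * (q ^ 2 + q ^ 4) := by
    rw [abs_mul, abs_div, abs_two, abs_of_nonneg (by positivity : 0 ≤ q ^ 2)]
    have := abs_nonneg a
    have h4 : 0 ≤ q ^ 4 := by positivity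
    have h5 : 0 ≤ q ^ 2 := by positivity
    nlinarith [mul_nonneg this h4, mul_nonneg this h5]
  have h3 : |c / 4 * q ^ 4| ≤ |c| * (q ^ 2 + q ^ 4) := by
    rw [abs_mul, abs_div, abs_of_pos (four_pos : (0:ℝ) < 4), abs_of_nonneg (by positivity : 0 ≤ q ^ 4)]
    have := abs_nonneg c
    have h4 : 0 ≤ q ^ 4 := by positivity
    have h5 : 0 ≤ q ^ 2 := by positivity
    nlinarith [mul_nonneg this h4, mul_nonneg this h5]
  calc _ ≤ |a / 2 * q ^ 2| + |b / 3 * (A * A * A).trace| + |c / 4 * q ^ 4| :=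
        (abs_add_le _ _).trans (add_le_add_left (abs_sub _ _) _)
    _ ≤ _ := by linarith

/-- The rate of the exponential growth. -/
def rate (κ μ lam Γ K c : ℝ) : ℝ :=
  (κ ^ 2 / μ + K ^ 2 * lam ^ 2 / μ + K ^ 2 * Γ) * (2 + 8 / c)

lemma production_le {a b c κ μ lam Γ K : ℝ} (hμ : 0 < μ) (hΓ : 0 < Γ) (Q : E d → Mat d)
    (u : E d → E d) (x : E d) :
    production a b c κ μ lam Γ K Q u x ≤ - (μ / 2) * frobSq (gradU u x)
      + (κ ^ 2 / μ + K ^ 2 * lam ^ 2 / μ + K ^ 2 * Γ) * (frob (Q x) ^ 2 + frob (Q x) ^ 4) := by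
  rw [production, ← frob_sq, ← frob_sq]
  set q := frob (Q x)
  set g := frob (gradU u x)
  set h := frob (molField a b c Q x)
  have hq : 0 ≤ q := frob_nonneg _
  have hg : 0 ≤ g := frob_nonneg _
  have h1 : - κ * dot (Q x) (gradU u x) ≤ |κ| * (q * g) := by
    refine (le_abs_self _).trans ?_
    rw [abs_mul, abs_neg]; gcongr; exact abs_dot_le _ _
  have h2 : K * lam * q * dot (Q x) (gradU u x) ≤ |K * lam| * q * (q * g) := by
    refine (le_abs_self _).trans ?_
    rw [abs_mul, abs_mul, abs_of_nonneg hq]; gcongr; exact abs_dot_le _ _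
  have h3 : K * Γ * dot (Q x) (molField a b c Q x) ≤ |K| * Γ * (q * h) := by
    refine (le_abs_self _).trans ?_
    rw [abs_mul, abs_mul, abs_of_pos hΓ]; gcongr; exact abs_dot_le _ _
  have y1 : |κ| * (q * g) ≤ μ / 4 * g ^ 2 + κ ^ 2 / μ * q ^ 2 := by
    have h3 : μ / 4 * g ^ 2 + κ ^ 2 / μ * q ^ 2 - |κ| * (q * g) = (μ / 2 * g - |κ| * q) ^ 2 / μ := by
      rw [← sq_abs κ]; field_simp; ring
    have : 0 ≤ (μ / 2 * g - |κ| * q) ^ 2 / μ := by positivity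
    linarith
  have y2 : |K * lam| * q * (q * g) ≤ μ / 4 * g ^ 2 + K ^ 2 * lam ^ 2 / μ * q ^ 4 := by
    have h3 : μ / 4 * g ^ 2 + K ^ 2 * lam ^ 2 / μ * q ^ 4 - |K * lam| * q * (q * g)
        = (μ / 2 * g - |K * lam| * q ^ 2) ^ 2 / μ := by
      rw [← mul_pow, ← sq_abs (K * lam)]; field_simp; ring
    have : 0 ≤ (μ / 2 * g - |K * lam| * q ^ 2) ^ 2 / μ := by positivity
    linarith
  have y3 : |K| * Γ * (q * h) ≤ Γ * h ^ 2 + K ^ 2 * Γ * q ^ 2 := by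
    have h3 : 0 ≤ Γ * ((h - |K| * q / 2) ^ 2 + 3 / 4 * |K| ^ 2 * q ^ 2) := by positivity
    rw [← sq_abs K]
    linarith
  have z1 : 0 ≤ κ ^ 2 / μ * q ^ 4 := by positivity
  have z2 : 0 ≤ K ^ 2 * lam ^ 2 / μ * q ^ 2 := by positivity
  have z3 : 0 ≤ K ^ 2 * Γ * q ^ 4 := by positivity
  linarith

/-- The energy density. -/
def energyDensity (a b c : ℝ) (Q : E d → Mat d) (u : E d → E d) (x : E d) : ℝ :=
  1 / 2 * ∑ α, u x α ^ 2 + 1 / 2 * gradQSq Q x + bulk a b c (Q x)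
    + coerc a b c / 2 * frobSq (Q x)

lemma gradQSq_nonneg (Q : E d → Mat d) (x : E d) : 0 ≤ gradQSq Q x :=
  Finset.sum_nonneg fun _ _ => Finset.sum_nonneg fun _ _ => Finset.sum_nonneg fun _ _ => sq_nonneg _

lemma le_energyDensity (a b : ℝ) {c : ℝ} (hc : 0 < c) {Q : E d → Mat d} (u : E d → E d) {x : E d}
    (hs : (Q x).IsSymm) :
    1 / 2 * ∑ α, u x α ^ 2 + 1 / 2 * (frobSq (Q x) + gradQSq Q x) + c / 8 * frob (Q x) ^ 4
      ≤ energyDensity a b c Q u x := by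
  have := le_bulk_add a b hc hs
  rw [energyDensity, ← frob_sq]
  linarith

lemma energyDensity_le (a b : ℝ) {c : ℝ} (hc : 0 < c) {Q : E d → Mat d} (u : E d → E d) {x : E d}
    (hs : (Q x).IsSymm) :
    energyDensity a b c Q u x ≤ ∑ α, u x α ^ 2
      + (1 + |a| + |b| + |c| + coerc a b c) * (frobSq (Q x) + gradQSq Q x + frob (Q x) ^ 4) := by
  have h := (le_abs_self _).trans (abs_bulk_le a b c hs)
  rw [energyDensity, ← frob_sq]
  have hK : 0 ≤ coerc a b c := by unfold coerc; positivity
  have h1 : 0 ≤ ∑ α, u x α ^ 2 := Finset.sum_nonneg fun _ _ => sq_nonneg _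
  have h2 := gradQSq_nonneg Q x
  have h3 : 0 ≤ frob (Q x) ^ 2 := sq_nonneg _
  have h4 : 0 ≤ frob (Q x) ^ 4 := by positivity
  have := abs_nonneg a
  have := abs_nonneg b
  have := abs_nonneg c
  have e1 : 0 ≤ (|a| + |b| + |c| + coerc a b c) * gradQSq Q x := by positivity
  have e2 : 0 ≤ coerc a b c * frob (Q x) ^ 2 := by positivity
  have e3 : 0 ≤ coerc a b c * frob (Q x) ^ 4 := by positivity
  linarith

/-- The viscosity absorbs every occurrence of `∇u` in the production, and the coercive energy
controls what remains. -/
lemma production_le_rate {a b c κ μ lam Γ : ℝ} (hc : 0 < c) (hμ : 0 < μ) (hΓ : 0 < Γ)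
    {Q : E d → Mat d} (u : E d → E d) {x : E d} (hs : (Q x).IsSymm) :
    production a b c κ μ lam Γ (coerc a b c) Q u x ≤ - (μ / 2) * frobSq (gradU u x)
      + rate κ μ lam Γ (coerc a b c) c * energyDensity a b c Q u x := by
  have h1 := production_le (a := a) (b := b) (c := c) (κ := κ) (lam := lam) (K := coerc a b c)
    hμ hΓ Q u x
  have h2 := le_energyDensity a b hc u hs
  have h3 : frob (Q x) ^ 2 + frob (Q x) ^ 4 ≤ (2 + 8 / c) * energyDensity a b c Q u x := by
    rw [← frob_sq] at h2
    have g1 : 0 ≤ ∑ α, u x α ^ 2 := Finset.sum_nonneg fun _ _ => sq_nonneg _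
    have g2 := gradQSq_nonneg Q x
    have g3 : 0 ≤ frob (Q x) ^ 2 := sq_nonneg _
    have g4 : 0 ≤ c / 8 * frob (Q x) ^ 4 := by positivity
    have g5 : 8 / c * (c / 8 * frob (Q x) ^ 4) ≤ 8 / c * energyDensity a b c Q u x := by
      gcongr; linarith
    have g6 : 8 / c * (c / 8 * frob (Q x) ^ 4) = frob (Q x) ^ 4 := by field_simp
    linarith
  have h4 : 0 ≤ κ ^ 2 / μ + coerc a b c ^ 2 * lam ^ 2 / μ + coerc a b c ^ 2 * Γ := by positivity
  have h5 := mul_le_mul_of_nonneg_left h3 h4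
  rw [rate]
  linarith

lemma frob_molField_le (a b c : ℝ) {Q : E d → Mat d} {x : E d} (hs : (Q x).IsSymm) :
    frob (molField a b c Q x) ≤ (1 + |a| + |b| * (2 + 2 * (frob (1 : Mat d) / d)) + |c|)
      * (frob (matLap Q x) + frob (Q x) + frob (Q x) ^ 3) := by
  set q := frob (Q x) with hq'
  have hq : 0 ≤ q := frob_nonneg _
  have hL : 0 ≤ frob (matLap Q x) := frob_nonneg _
  have ht : (Q x * Q x).trace = q ^ 2 := by rw [trace_sq_of_isSymm hs, frob_sq]
  have h1 : frob (Q x * Q x - ((Q x * Q x).trace / (d : ℝ)) • (1 : Mat d))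
      ≤ (2 + 2 * (frob (1 : Mat d) / d)) * (q + q ^ 3) := by
    refine (frob_sub_le _ _).trans ?_
    have e1 := frob_mul_le (Q x) (Q x)
    have e2 : q ^ 2 ≤ 2 * (q + q ^ 3) := by nlinarith [mul_nonneg hq (sq_nonneg (q - 1)), pow_nonneg hq 3]
    have e3 : 0 ≤ frob (1 : Mat d) / d := div_nonneg (frob_nonneg _) (Nat.cast_nonneg _)
    rw [frob_smul, ht, abs_of_nonneg (by positivity)]
    have e4 : q ^ 2 / d * frob (1 : Mat d) = frob (1 : Mat d) / d * q ^ 2 := by ring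
    rw [e4]
    have e5 := mul_le_mul_of_nonneg_left e2 e3
    have e6 : frob (Q x * Q x) ≤ q ^ 2 := by rw [pow_two]; exact e1
    linarith
  have h2 : frob (molField a b c Q x) ≤ frob (matLap Q x) + |a| * q
      + |b| * ((2 + 2 * (frob (1 : Mat d) / d)) * (q + q ^ 3)) + |c| * q ^ 3 := by
    unfold molField
    refine (frob_sub_le _ _).trans (add_le_add ((frob_add_le _ _).trans (add_le_add
      ((frob_sub_le _ _).trans (add_le_add le_rfl (frob_smul _ _).le)) ?_)) ?_)
    · rw [frob_smul]; gcongr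
    · rw [frob_smul, frob_smul, ht, abs_of_nonneg (sq_nonneg q)]
      exact le_of_eq (by ring)
  have e3 : 0 ≤ frob (1 : Mat d) / d := div_nonneg (frob_nonneg _) (Nat.cast_nonneg _)
  have := abs_nonneg a
  have := abs_nonneg b
  have := abs_nonneg c
  have g1 : 0 ≤ (|a| + |b| * (2 + 2 * (frob (1 : Mat d) / d)) + |c|) * frob (matLap Q x) := by
    positivity
  have g2 : 0 ≤ (1 + |c|) * q := by positivity
  have g3 : 0 ≤ (1 + |a|) * q ^ 3 := by positivity
  nlinarith

/-! ### Bounds on the fluxes -/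

/-- `|u|²`. -/
def velSq (u : E d → E d) (x : E d) : ℝ := ∑ α, u x α ^ 2

lemma velSq_nonneg (u : E d → E d) (x : E d) : 0 ≤ velSq u x :=
  Finset.sum_nonneg fun _ _ => sq_nonneg _

/-- A common pointwise bound of the momentum flux and of `∂ₜQ`, up to a constant. -/
def dominant (Q : E d → Mat d) (u : E d → E d) (x : E d) : ℝ :=
  velSq u x + frob (gradU u x) + gradQSq Q x + (1 + frob (Q x)) * frob (matLap Q x)
    + frob (Q x) * frob (gradU u x) + frob (Q x) + frob (Q x) ^ 4

lemma dominant_nonneg (Q : E d → Mat d) (u : E d → E d) (x : E d) : 0 ≤ dominant Q u x := by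
  have h1 := velSq_nonneg u x
  have h2 := frob_nonneg (gradU u x)
  have h3 := gradQSq_nonneg Q x
  have h4 := frob_nonneg (Q x)
  have h5 := frob_nonneg (matLap Q x)
  unfold dominant
  positivity

lemma frob_le_of_sq_le {A : Mat d} {r : ℝ} (hr : 0 ≤ r) (h : frobSq A ≤ r ^ 2) : frob A ≤ r :=
  Real.sqrt_le_iff.2 ⟨hr, h⟩

lemma sum_frob_mpd_sq (Q : E d → Mat d) (x : E d) : ∑ k, frob (mpd k Q x) ^ 2 = gradQSq Q x := by
  rw [gradQSq_eq]
  exact Finset.sum_congr rfl fun k _ => by rw [frob_sq, frobSq_eq_dot]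

lemma frob_mpd_le (Q : E d → Mat d) (x : E d) (k : Fin d) : frob (mpd k Q x) ≤ √(gradQSq Q x) := by
  refine Real.le_sqrt_of_sq_le ?_
  rw [← sum_frob_mpd_sq]
  exact Finset.single_le_sum (f := fun k => frob (mpd k Q x) ^ 2) (fun _ _ => sq_nonneg _)
    (Finset.mem_univ k)

lemma abs_vel_le (u : E d → E d) (x : E d) (α : Fin d) : |u x α| ≤ √(velSq u x) :=
  Real.abs_le_sqrt (Finset.single_le_sum (f := fun α => u x α ^ 2) (fun _ _ => sq_nonneg _)
    (Finset.mem_univ α))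

lemma frob_gradOdot_le (Q : E d → Mat d) (x : E d) : frob (gradOdot Q x) ≤ gradQSq Q x := by
  refine frob_le_of_sq_le (gradQSq_nonneg Q x) ?_
  calc frobSq (gradOdot Q x) ≤ ∑ α, ∑ β, frob (mpd α Q x) ^ 2 * frob (mpd β Q x) ^ 2 := by
        refine Finset.sum_le_sum fun α _ => Finset.sum_le_sum fun β _ => ?_
        rw [gradOdot_apply, ← mul_pow, ← sq_abs (dot _ _)]
        gcongr
        exact abs_dot_le _ _
    _ = gradQSq Q x ^ 2 := by
        rw [← sum_frob_mpd_sq, pow_two, Finset.sum_mul_sum]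

lemma frob_tensor (u : E d → E d) (x : E d) :
    frob (Matrix.of fun α β => u x α * u x β) ≤ velSq u x := by
  refine frob_le_of_sq_le (velSq_nonneg u x) ?_
  simp only [frobSq, Matrix.of_apply, velSq, pow_two (∑ α, _), Finset.sum_mul_sum, mul_pow]
  exact le_rfl

lemma frob_advectQ_le (u : E d → E d) (Q : E d → Mat d) (x : E d) :
    frob (advectQ u Q x) ≤ velSq u x + gradQSq Q x := by
  rw [advectQ_eq, ← sum_frob_mpd_sq, velSq, ← Finset.sum_add_distrib]
  refine (frob_sum_le _ _).trans (Finset.sum_le_sum fun k _ => ?_)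
  rw [frob_smul]
  nlinarith [sq_abs (u x k), sq_nonneg (|u x k| - frob (mpd k Q x)), sq_nonneg (|u x k|),
    sq_nonneg (frob (mpd k Q x))]

lemma frob_symPart_le (u : E d → E d) (x : E d) : frob (symPart u x) ≤ frob (gradU u x) := by
  rw [symPart, frob_smul, abs_of_pos (by norm_num)]
  have := frob_add_le (gradU u x) (gradU u x).transpose
  rw [frob_transpose] at this
  linarith

lemma frob_skewPart_le (u : E d → E d) (x : E d) : frob (skewPart u x) ≤ frob (gradU u x) := by
  rw [skewPart, frob_smul, abs_of_pos (by norm_num)]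
  have := frob_sub_le (gradU u x) (gradU u x).transpose
  rw [frob_transpose] at this
  linarith

lemma pow_two_le_add_pow_four {q : ℝ} (hq : 0 ≤ q) : q ^ 2 ≤ q + q ^ 4 := by
  rcases le_total q 1 with h | h
  · nlinarith [pow_nonneg hq 4]
  · nlinarith [pow_nonneg hq 2, one_le_pow₀ (n := 2) h]

lemma pow_three_le_add_pow_four {q : ℝ} (hq : 0 ≤ q) : q ^ 3 ≤ q + q ^ 4 := by
  rcases le_total q 1 with h | h
  · have : q ^ 3 ≤ q := by
      calc q ^ 3 = q * q ^ 2 := by ring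
        _ ≤ q * 1 := by gcongr; exact pow_le_one₀ hq h
        _ = q := mul_one q
    linarith [pow_nonneg hq 4]
  · have : q ^ 3 ≤ q ^ 4 := pow_le_pow_right₀ h (by norm_num)
    linarith

lemma exists_frob_molField_le (d : ℕ) (a b c : ℝ) : ∃ C : ℝ, 0 ≤ C ∧
    ∀ (Q : E d → Mat d) (u : E d → E d) (x : E d), (Q x).IsSymm →
      frob (molField a b c Q x) ≤ C * dominant Q u x
        ∧ frob (Q x) * frob (molField a b c Q x) ≤ C * dominant Q u x := by
  have hf : 0 ≤ frob (1 : Mat d) / d := div_nonneg (frob_nonneg _) (Nat.cast_nonneg _)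
  refine ⟨2 * (1 + |a| + |b| * (2 + 2 * (frob (1 : Mat d) / d)) + |c|), by positivity,
    fun Q u x hs => ?_⟩
  have hH := frob_molField_le a b c hs
  set C := 1 + |a| + |b| * (2 + 2 * (frob (1 : Mat d) / d)) + |c|
  have hC : 0 ≤ C := by positivity
  have h1 := velSq_nonneg u x
  have h2 := frob_nonneg (gradU u x)
  have h3 := gradQSq_nonneg Q x
  have h4 := frob_nonneg (Q x)
  have h5 := frob_nonneg (matLap Q x)
  set q := frob (Q x)
  have h6 := mul_nonneg h4 h2
  have h7 := mul_nonneg h4 h5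
  have q2 := pow_two_le_add_pow_four h4
  have q3 := pow_three_le_add_pow_four h4
  have h8 := pow_nonneg h4 4
  constructor
  · refine hH.trans ?_
    rw [mul_comm 2, mul_assoc]
    gcongr
    unfold dominant
    linarith
  · refine (mul_le_mul_of_nonneg_left hH h4).trans ?_
    have e : q * (C * (frob (matLap Q x) + q + q ^ 3))
        = C * (q * frob (matLap Q x) + q ^ 2 + q ^ 4) := by ring
    rw [e, mul_comm 2, mul_assoc]
    gcongr
    unfold dominant
    linarith

lemma exists_frob_stress_le (d : ℕ) (a b c κ μ lam : ℝ) : ∃ C : ℝ, 0 ≤ C ∧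
    ∀ (Q : E d → Mat d) (u : E d → E d) (x : E d), (Q x).IsSymm →
      frob (stress a b c κ μ lam Q u x) ≤ C * dominant Q u x := by
  obtain ⟨C, hC, hH⟩ := exists_frob_molField_le d a b c
  refine ⟨4 + |μ| + |lam| * C + |κ|, by positivity, fun Q u x hs => ?_⟩
  have h1 := velSq_nonneg u x
  have h2 := frob_nonneg (gradU u x)
  have h3 := gradQSq_nonneg Q x
  have h4 := frob_nonneg (Q x)
  have h5 := frob_nonneg (matLap Q x)
  have h6 := mul_nonneg h4 h2
  have h7 := mul_nonneg h4 h5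
  have h8 := pow_nonneg h4 4
  have hH' := (hH Q u x hs).2
  have d1 : velSq u x ≤ dominant Q u x := by unfold dominant; linarith
  have d2 : frob (gradU u x) ≤ dominant Q u x := by unfold dominant; linarith
  have d3 : gradQSq Q x ≤ dominant Q u x := by unfold dominant; linarith
  have d4 : frob (Q x) * frob (matLap Q x) ≤ dominant Q u x := by unfold dominant; linarith
  have d5 : frob (Q x) ≤ dominant Q u x := by unfold dominant; linarith
  have t1 := frob_mul_le (Q x) (matLap Q x)
  have t2 := frob_mul_le (matLap Q x) (Q x)
  have e1 : frob ((lam * frob (Q x)) • molField a b c Q x) ≤ |lam| * (C * dominant Q u x) := by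
    rw [frob_smul, abs_mul, abs_of_nonneg h4, mul_assoc]; gcongr
  have e2 : frob (Q x * matLap Q x - matLap Q x * Q x) ≤ 2 * dominant Q u x := by
    refine (frob_sub_le _ _).trans ?_
    linarith [mul_comm (frob (matLap Q x)) (frob (Q x))]
  have e3 : |μ| * frob (gradU u x) ≤ |μ| * dominant Q u x := by gcongr
  have e4 : |κ| * frob (Q x) ≤ |κ| * dominant Q u x := by gcongr
  have e5 := frob_tensor u x
  have e6 := frob_gradOdot_le Q x
  calc frob (stress a b c κ μ lam Q u x)
      ≤ frob (Matrix.of fun α β => u x α * u x β) + |μ| * frob (gradU u x) + frob (gradOdot Q x)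
        + frob ((lam * frob (Q x)) • molField a b c Q x)
        + frob (Q x * matLap Q x - matLap Q x * Q x) + |κ| * frob (Q x) := by
        rw [← frob_smul, ← frob_smul, stress]
        refine (frob_sub_le _ _).trans (add_le_add_left ?_ _)
        refine (frob_sub_le _ _).trans (add_le_add_left ?_ _)
        refine (frob_add_le _ _).trans (add_le_add_left ?_ _)
        refine (frob_add_le _ _).trans (add_le_add_left ?_ _)
        exact frob_sub_le _ _
    _ ≤ _ := by linarith

lemma exists_frob_timeDeriv_le (d : ℕ) (a b c lam Γ : ℝ) : ∃ C : ℝ, 0 ≤ C ∧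
    ∀ (Q : E d → Mat d) (u : E d → E d) (R : Mat d) (x : E d), (Q x).IsSymm →
      R + advectQ u Q x + Q x * skewPart u x - skewPart u x * Q x
        - (lam * frob (Q x)) • symPart u x = Γ • molField a b c Q x →
      frob R ≤ C * dominant Q u x := by
  obtain ⟨C, hC, hH⟩ := exists_frob_molField_le d a b c
  refine ⟨4 + |lam| + |Γ| * C, by positivity, fun Q u R x hs heq => ?_⟩
  have h1 := velSq_nonneg u x
  have h2 := frob_nonneg (gradU u x)
  have h3 := gradQSq_nonneg Q x
  have h4 := frob_nonneg (Q x)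
  have h5 := frob_nonneg (matLap Q x)
  have h6 := mul_nonneg h4 h2
  have h7 := mul_nonneg h4 h5
  have h8 := pow_nonneg h4 4
  have hH' := (hH Q u x hs).1
  have d1 : velSq u x + gradQSq Q x ≤ dominant Q u x := by unfold dominant; linarith
  have d2 : frob (Q x) * frob (gradU u x) ≤ dominant Q u x := by unfold dominant; linarith
  have hW : frob (Q x) * frob (skewPart u x) ≤ dominant Q u x :=
    (mul_le_mul_of_nonneg_left (frob_skewPart_le u x) h4).trans d2
  have e1 : frob (Q x * skewPart u x) ≤ dominant Q u x := (frob_mul_le _ _).trans hW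
  have e2 : frob (skewPart u x * Q x) ≤ dominant Q u x :=
    (frob_mul_le _ _).trans ((mul_comm _ _).le.trans hW)
  have e3 : frob ((lam * frob (Q x)) • symPart u x) ≤ |lam| * dominant Q u x := by
    rw [frob_smul, abs_mul, abs_of_nonneg h4, mul_assoc]
    gcongr
    exact (mul_le_mul_of_nonneg_left (frob_symPart_le u x) h4).trans d2
  have e4 : frob (Γ • molField a b c Q x) ≤ |Γ| * (C * dominant Q u x) := by
    rw [frob_smul]; gcongr
  have e5 := frob_advectQ_le u Q x
  have hD := dominant_nonneg Q u x
  have hR : R = Γ • molField a b c Q x + (lam * frob (Q x)) • symPart u x + skewPart u x * Q x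
      - Q x * skewPart u x - advectQ u Q x := by
    rw [← heq]; abel
  calc frob R ≤ frob (Γ • molField a b c Q x) + frob ((lam * frob (Q x)) • symPart u x)
        + frob (skewPart u x * Q x) + frob (Q x * skewPart u x) + frob (advectQ u Q x) := by
        conv_lhs => rw [hR]
        refine (frob_sub_le _ _).trans (add_le_add_left ?_ _)
        refine (frob_sub_le _ _).trans (add_le_add_left ?_ _)
        refine (frob_add_le _ _).trans (add_le_add_left ?_ _)
        exact frob_add_le _ _
    _ ≤ _ := by linarith

lemma abs_lagrangian_le (a b c K : ℝ) {Q : E d → Mat d} (u : E d → E d) {x : E d}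
    (hs : (Q x).IsSymm) :
    |lagrangian a b c K Q u x| ≤ (1 + 2 * (|a| + |b| + |c|) + |K|) * dominant Q u x := by
  have h1 := velSq_nonneg u x
  have h2 := frob_nonneg (gradU u x)
  have h3 := gradQSq_nonneg Q x
  have h4 := frob_nonneg (Q x)
  have h5 := frob_nonneg (matLap Q x)
  have h6 := mul_nonneg h4 h2
  have h7 := mul_nonneg h4 h5
  have h8 := pow_nonneg h4 4
  have q2 := pow_two_le_add_pow_four h4
  have d1 : velSq u x + gradQSq Q x ≤ dominant Q u x := by unfold dominant; linarith
  have d2 : frob (Q x) + frob (Q x) ^ 4 ≤ dominant Q u x := by unfold dominant; linarith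
  have hb := abs_bulk_le a b c hs
  have hb' : (|a| + |b| + |c|) * (frob (Q x) ^ 2 + frob (Q x) ^ 4)
      ≤ (|a| + |b| + |c|) * (2 * dominant Q u x) := by
    gcongr; linarith
  have hK : |K / 2 * frobSq (Q x)| ≤ |K| * dominant Q u x := by
    rw [← frob_sq, abs_mul, abs_div, abs_two, abs_of_nonneg (sq_nonneg (frob (Q x)))]
    have h9 : |K| * frob (Q x) ^ 2 ≤ |K| * dominant Q u x := by gcongr; linarith
    have h10 : 0 ≤ |K| * frob (Q x) ^ 2 := by positivity
    linarith
  have hv : |1 / 2 * velSq u x - 1 / 2 * gradQSq Q x| ≤ dominant Q u x :=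
    abs_le.2 ⟨by linarith, by linarith⟩
  calc |lagrangian a b c K Q u x|
      ≤ |1 / 2 * velSq u x - 1 / 2 * gradQSq Q x| + |bulk a b c (Q x)| + |K / 2 * frobSq (Q x)| :=
        (abs_sub _ _).trans (add_le_add_left (abs_sub _ _) _)
    _ ≤ _ := by linarith

lemma exists_flux_le (d : ℕ) (a b c κ μ lam Γ K : ℝ) : ∃ C : ℝ, 0 ≤ C ∧
    ∀ (Q R : E d → Mat d) (u : E d → E d) (x : E d), (Q x).IsSymm →
      R x + advectQ u Q x + Q x * skewPart u x - skewPart u x * Q x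
        - (lam * frob (Q x)) • symPart u x = Γ • molField a b c Q x →
      ∀ k, |∑ α, stress a b c κ μ lam Q u x α k * u x α - energyFlux a b c K Q R u k x|
        ≤ C * ((√(velSq u x) + √(gradQSq Q x)) * dominant Q u x) := by
  obtain ⟨C1, hC1, hF⟩ := exists_frob_stress_le d a b c κ μ lam
  obtain ⟨C2, hC2, hR⟩ := exists_frob_timeDeriv_le d a b c lam Γ
  refine ⟨d * C1 + C2 + d + (1 + 2 * (|a| + |b| + |c|) + |K|), by positivity,
    fun Q R u x hs heq k => ?_⟩
  have hF := hF Q u x hs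
  have hR := hR Q u (R x) x hs heq
  have hL := abs_lagrangian_le a b c K u hs
  set C3 := 1 + 2 * (|a| + |b| + |c|) + |K|
  have hC3 : 0 ≤ C3 := by positivity
  have hP := dominant_nonneg Q u x
  have hU := Real.sqrt_nonneg (velSq u x)
  have hD := Real.sqrt_nonneg (gradQSq Q x)
  set U := √(velSq u x)
  set D := √(gradQSq Q x) with hDdef
  set P := dominant Q u x with hPdef
  have hDP : D * D ≤ P := by
    rw [hDdef, Real.mul_self_sqrt (gradQSq_nonneg Q x)]
    have h1 := velSq_nonneg u x
    have h2 := frob_nonneg (gradU u x)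
    have h4 := frob_nonneg (Q x)
    have h5 := frob_nonneg (matLap Q x)
    have h6 := mul_nonneg h4 h2
    have h7 := mul_nonneg h4 h5
    have h8 := pow_nonneg h4 4
    rw [hPdef]; unfold dominant; linarith
  have e1 : |∑ α, stress a b c κ μ lam Q u x α k * u x α| ≤ d * (C1 * P * U) := by
    refine (Finset.abs_sum_le_sum_abs _ _).trans ?_
    calc _ ≤ ∑ _α : Fin d, C1 * P * U := Finset.sum_le_sum fun α _ => by
          rw [abs_mul]
          exact mul_le_mul ((abs_apply_le_frob _ _ _).trans hF) (abs_vel_le u x α) (abs_nonneg _)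
            (by positivity)
      _ = _ := by simp
  have e2 : |dot (mpd k Q x) (R x)| ≤ D * (C2 * P) :=
    (abs_dot_le _ _).trans (mul_le_mul (frob_mpd_le Q x k) hR (frob_nonneg _) hD)
  have e3 : |∑ α, u x α * dot (mpd α Q x) (mpd k Q x)| ≤ d * (U * P) := by
    refine (Finset.abs_sum_le_sum_abs _ _).trans ?_
    calc _ ≤ ∑ _α : Fin d, U * P := Finset.sum_le_sum fun α _ => by
          rw [abs_mul]
          refine mul_le_mul (abs_vel_le u x α) ((abs_dot_le _ _).trans ?_) (abs_nonneg _) hU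
          exact (mul_le_mul (frob_mpd_le Q x α) (frob_mpd_le Q x k) (frob_nonneg _) hD).trans hDP
      _ = _ := by simp
  have e4 : |u x k * lagrangian a b c K Q u x| ≤ U * (C3 * P) := by
    rw [abs_mul]
    exact mul_le_mul (abs_vel_le u x k) hL (abs_nonneg _) hU
  have f1 : 0 ≤ U * P := by positivity
  have f2 : 0 ≤ D * P := by positivity
  calc _ ≤ |∑ α, stress a b c κ μ lam Q u x α k * u x α| + |dot (mpd k Q x) (R x)|
        + |∑ α, u x α * dot (mpd α Q x) (mpd k Q x)| + |u x k * lagrangian a b c K Q u x| := by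
        unfold energyFlux
        exact (abs_sub _ _).trans (by
          linarith [abs_add_le (dot (mpd k Q x) (R x) + ∑ α, u x α * dot (mpd α Q x) (mpd k Q x))
            (u x k * lagrangian a b c K Q u x),
            abs_add_le (dot (mpd k Q x) (R x)) (∑ α, u x α * dot (mpd α Q x) (mpd k Q x))])
    _ ≤ d * (C1 * P * U) + D * (C2 * P) + d * (U * P) + U * (C3 * P) := by linarith
    _ ≤ _ := by
        have g1 : 0 ≤ d * C1 * (D * P) := by positivity
        have g2 : 0 ≤ C2 * (U * P) := by positivity
        have g3 : 0 ≤ d * (D * P) := by positivity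
        have g4 : 0 ≤ C3 * (D * P) := by positivity
        linarith

/-! ### Integral bounds on the fluxes -/

lemma norm_sq_eq_velSq (u : E d → E d) (x : E d) : ‖u x‖ ^ 2 = velSq u x := by
  rw [EuclideanSpace.real_norm_sq_eq]; rfl

lemma exists_lintegral_sum_sq_sq_le (hd : d = 2 ∨ d = 3) : ∃ C : NNReal, ∀ {ι : Type} [Fintype ι]
    (f : ι → E d → ℝ) (Z : ℝ≥0∞), (∀ i, ContDiff ℝ ∞ (f i)) →
      (∀ i, ∫⁻ x, ENNReal.ofReal (jetOne (f i) x) ≤ Z) →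
      ∫⁻ x, ENNReal.ofReal ((∑ i, f i x ^ 2) ^ 2) ≤ (Fintype.card ι) ^ 2 * C * Z ^ 2 := by
  obtain ⟨C, hC⟩ := exists_lintegral_pow_four_le hd
  refine ⟨C, fun {ι} _ f Z hf hZ => ?_⟩
  calc ∫⁻ x, ENNReal.ofReal ((∑ i, f i x ^ 2) ^ 2)
      ≤ ∫⁻ x, (Fintype.card ι) * ∑ i, ENNReal.ofReal (f i x ^ 4) := by
        refine lintegral_mono fun x => ?_
        rw [← ENNReal.ofReal_sum_of_nonneg fun i _ => by positivity, ← ENNReal.ofReal_natCast,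
          ← ENNReal.ofReal_mul (by positivity)]
        refine ENNReal.ofReal_le_ofReal ((sq_sum_le_card_mul_sum_sq ..).trans (le_of_eq ?_))
        simp [← pow_mul]
    _ = (Fintype.card ι) * ∑ i, ∫⁻ x, ENNReal.ofReal (f i x ^ 4) := by
        rw [lintegral_const_mul' _ _ (by simp), lintegral_finsetSum _ fun i _ =>
          (show Continuous fun x => f i x ^ 4 from (hf i).continuous.pow 4).measurable.ennreal_ofReal]
    _ ≤ (Fintype.card ι) * ∑ _i : ι, C * Z ^ 2 := by
        gcongr with i
        exact (hC _ (hf i)).trans (by gcongr; exact hZ i)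
    _ = _ := by simp; ring

lemma jetOne_vel_le (u : E d → E d) (α : Fin d) (x : E d) :
    jetOne (fun y => u y α) x ≤ velSq u x + frobSq (gradU u x) :=
  add_le_add (Finset.single_le_sum (f := fun α => u x α ^ 2) (fun _ _ => sq_nonneg _)
      (Finset.mem_univ α))
    (Finset.single_le_sum (f := fun α => ∑ k, pd k (fun y => u y α) x ^ 2)
      (fun _ _ => Finset.sum_nonneg fun _ _ => sq_nonneg _) (Finset.mem_univ α))

lemma sum_jetOne_entry (Q : E d → Mat d) (x : E d) :
    ∑ i, ∑ j, jetOne (fun y => Q y i j) x = frobSq (Q x) + gradQSq Q x := by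
  simp only [jetOne, frobSq, gradQSq, Finset.sum_add_distrib]

lemma sum_jetTwo_entry (Q : E d → Mat d) (x : E d) :
    ∑ i, ∑ j, jetTwo (fun y => Q y i j) x = frobSq (Q x) + gradQSq Q x + hessQSq Q x := by
  simp only [jetTwo, frobSq, gradQSq, hessQSq, Finset.sum_add_distrib]

lemma le_sum_sum {f : Fin d → Fin d → ℝ} (hf : ∀ i j, 0 ≤ f i j) (i j : Fin d) :
    f i j ≤ ∑ i, ∑ j, f i j :=
  (Finset.single_le_sum (f := f i) (fun j _ => hf i j) (Finset.mem_univ j)).trans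
    (Finset.single_le_sum (f := fun i => ∑ j, f i j) (fun i _ => Finset.sum_nonneg fun j _ => hf i j)
      (Finset.mem_univ i))

lemma jetOne_nonneg (f : E d → ℝ) (x : E d) : 0 ≤ jetOne f x :=
  add_nonneg (sq_nonneg _) (Finset.sum_nonneg fun _ _ => sq_nonneg _)

lemma jetTwo_nonneg (f : E d → ℝ) (x : E d) : 0 ≤ jetTwo f x :=
  add_nonneg (jetOne_nonneg f x) (Finset.sum_nonneg fun _ _ => Finset.sum_nonneg fun _ _ =>
    sq_nonneg _)

lemma hessQSq_nonneg (Q : E d → Mat d) (x : E d) : 0 ≤ hessQSq Q x :=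
  Finset.sum_nonneg fun _ _ => Finset.sum_nonneg fun _ _ => Finset.sum_nonneg fun _ _ =>
    Finset.sum_nonneg fun _ _ => sq_nonneg _

lemma jetOne_pd_le_jetTwo (f : E d → ℝ) (k : Fin d) (x : E d) :
    jetOne (pd k f) x ≤ jetTwo f x := by
  have h1 : pd k f x ^ 2 ≤ ∑ k, pd k f x ^ 2 :=
    Finset.single_le_sum (f := fun k => pd k f x ^ 2) (fun _ _ => sq_nonneg _) (Finset.mem_univ k)
  have h2 : ∑ l, pd l (pd k f) x ^ 2 ≤ ∑ k, ∑ l, pd k (pd l f) x ^ 2 := by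
    rw [Finset.sum_comm]
    exact Finset.single_le_sum (f := fun k => ∑ l, pd l (pd k f) x ^ 2)
      (fun _ _ => Finset.sum_nonneg fun _ _ => sq_nonneg _) (Finset.mem_univ k)
  unfold jetOne jetTwo
  nlinarith [sq_nonneg (f x)]

lemma frobSq_matLap_le (Q : E d → Mat d) (x : E d) : frobSq (matLap Q x) ≤ d * hessQSq Q x := by
  unfold frobSq hessQSq
  rw [Finset.mul_sum]
  refine Finset.sum_le_sum fun i _ => ?_
  rw [Finset.mul_sum]
  refine Finset.sum_le_sum fun j _ => ?_
  have h := sq_sum_le_card_mul_sum_sq (s := (Finset.univ : Finset (Fin d)))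
    (f := fun k => pd k (pd k fun y => Q y i j) x)
  simp only [Finset.card_univ, Fintype.card_fin] at h
  refine h.trans ?_
  gcongr with k
  exact Finset.single_le_sum (f := fun l => pd k (pd l fun y => Q y i j) x ^ 2)
    (fun _ _ => sq_nonneg _) (Finset.mem_univ k)

lemma exists_lintegral_frobSq_sq_le (hd : d = 2 ∨ d = 3) : ∃ C : NNReal, ∀ Q : E d → Mat d, SmoothMat Q →
    ∫⁻ x, ENNReal.ofReal (frobSq (Q x) ^ 2) ≤ C * h1Sq Q ^ 2 := by
  obtain ⟨C, hC⟩ := exists_lintegral_sum_sq_sq_le hd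
  refine ⟨(Fintype.card (Fin d × Fin d)) ^ 2 * C, fun Q hQ => ?_⟩
  have h := hC (ι := Fin d × Fin d) (fun p x => Q x p.1 p.2) (h1Sq Q) (fun p => hQ p.1 p.2)
    fun p => lintegral_mono fun x => ENNReal.ofReal_le_ofReal (by
      rw [← sum_jetOne_entry]
      exact le_sum_sum (f := fun i j => jetOne (fun y => Q y i j) x)
        (fun i j => jetOne_nonneg _ _) p.1 p.2)
  simp only [← Finset.univ_product_univ, Finset.sum_product] at h
  refine h.trans (le_of_eq ?_)
  push_cast
  ring

lemma exists_frobSq_le_h2Sq (hd : d = 2 ∨ d = 3) : ∃ C : NNReal, ∀ Q : E d → Mat d, SmoothMat Q →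
    ∀ x, ENNReal.ofReal (frobSq (Q x)) ≤ C * h2Sq Q := by
  obtain ⟨C, hC⟩ := exists_sq_le_lintegral_jetTwo (d := d) (by omega) (by omega)
  refine ⟨d * (d * C), fun Q hQ x => ?_⟩
  rw [frobSq, ENNReal.ofReal_sum_of_nonneg (f := fun i => ∑ j, Q x i j ^ 2)
    fun _ _ => Finset.sum_nonneg fun _ _ => sq_nonneg _]
  calc _ ≤ ∑ _i : Fin d, ∑ _j : Fin d, (C * h2Sq Q : ℝ≥0∞) := by
        refine Finset.sum_le_sum fun i _ => ?_
        rw [ENNReal.ofReal_sum_of_nonneg fun _ _ => sq_nonneg _]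
        refine Finset.sum_le_sum fun j _ => (hC _ (hQ i j) x).trans ?_
        gcongr
        refine lintegral_mono fun y => ENNReal.ofReal_le_ofReal ?_
        rw [← sum_jetTwo_entry]
        exact le_sum_sum (f := fun i j => jetTwo (fun y => Q y i j) y)
          (fun i j => jetTwo_nonneg _ _) i j
    _ = _ := by simp; ring

lemma continuous_frob {Q : E d → Mat d} (hQ : SmoothMat Q) : Continuous fun x => frob (Q x) :=
  Real.continuous_sqrt.comp (contDiff_frobSq hQ).continuous

lemma smoothMat_gradU {u : E d → E d} (hu : ∀ α, ContDiff ℝ ∞ fun x => u x α) :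
    SmoothMat (gradU u) := fun α β => contDiff_pd (hu α) β

lemma continuous_velSq {u : E d → E d} (hu : ∀ α, ContDiff ℝ ∞ fun x => u x α) :
    Continuous (velSq u) := (ContDiff.sum fun α _ => (hu α).pow 2).continuous

/-- Sum of the squared norms controlling the fluxes. -/
def totalSq (Q : E d → Mat d) (u : E d → E d) : ℝ≥0∞ := 1 + h2Sq Q + l2Sq u + gradL2Sq u

/-- The embeddings `H¹ ⊂ L⁴` and `H² ⊂ L^∞` bound the fluxes in `L²`. -/
lemma exists_lintegral_dominant_sq_le (hd : d = 2 ∨ d = 3) : ∃ C : NNReal,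
    ∀ (Q : E d → Mat d) (u : E d → E d), SmoothMat Q → (∀ α, ContDiff ℝ ∞ fun x => u x α) →
      ∫⁻ x, ENNReal.ofReal (dominant Q u x ^ 2) ≤ C * (1 + h1Sq Q) ^ 2 * totalSq Q u ^ 2 := by
  obtain ⟨C4, hC4⟩ := exists_lintegral_sum_sq_sq_le hd
  obtain ⟨C1, hC1⟩ := exists_lintegral_frobSq_sq_le hd
  obtain ⟨C2, hC2⟩ := exists_frobSq_le_h2Sq hd
  set N1 : NNReal := (Fintype.card (Fin d)) ^ 2 * C4 with hN1
  set N3 : NNReal := (Fintype.card (Fin d × Fin d × Fin d)) ^ 2 * C4 with hN3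
  refine ⟨8 * (N1 + 1 + N3 + d + C2 * d + C2 + 1 + C2 ^ 2 * C1), fun Q u hQ hu => ?_⟩
  set Z := totalSq Q u with hZ
  have hZ1 : 1 ≤ Z := by rw [hZ, totalSq, add_assoc, add_assoc]; exact le_self_add
  have hZ2 : h2Sq Q ≤ Z := by
    rw [hZ, totalSq, add_assoc, add_assoc, ← add_assoc _ (h2Sq Q), add_comm 1, add_assoc]
    rw [← add_assoc, add_assoc]
    exact le_self_add
  have hZ3 : l2Sq u + gradL2Sq u ≤ Z := by
    rw [hZ, totalSq, add_assoc]; exact le_add_self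
  have hZ4 : gradL2Sq u ≤ Z := le_add_self
  have hZZ : Z ≤ Z ^ 2 := by
    rw [pow_two]; exact le_mul_of_one_le_left' hZ1
  have cq := contDiff_frobSq hQ |>.continuous
  have cg := contDiff_frobSq (smoothMat_gradU hu) |>.continuous
  have cL := contDiff_frobSq hQ.matLap |>.continuous
  have cD := (contDiff_gradQSq hQ).continuous
  have cv := continuous_velSq hu
  have t1 : ∫⁻ x, ENNReal.ofReal (velSq u x ^ 2) ≤ N1 * Z ^ 2 := by
    have h := hC4 (ι := Fin d) (fun α x => u x α) Z hu fun α => by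
      refine le_trans ?_ hZ3
      rw [l2Sq, gradL2Sq, ← lintegral_add_left (by simpa only [norm_sq_eq_velSq] using cv.measurable.ennreal_ofReal)]
      refine lintegral_mono fun x => ?_
      rw [← ENNReal.ofReal_add (sq_nonneg _) (frobSq_nonneg _), norm_sq_eq_velSq]
      exact ENNReal.ofReal_le_ofReal (jetOne_vel_le u α x)
    rw [hN1]; push_cast; exact h
  have t2 : ∫⁻ x, ENNReal.ofReal (frobSq (gradU u x)) ≤ 1 * Z ^ 2 := by
    rw [one_mul]; exact hZ4.trans hZZ
  have t3 : ∫⁻ x, ENNReal.ofReal (gradQSq Q x ^ 2) ≤ N3 * Z ^ 2 := by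
    have h := hC4 (ι := Fin d × Fin d × Fin d) (fun p x => pd p.2.2 (fun y => Q y p.1 p.2.1) x) Z
      (fun p => contDiff_pd (hQ _ _) _) fun p => by
        refine le_trans (lintegral_mono fun x => ENNReal.ofReal_le_ofReal ?_) hZ2
        rw [← sum_jetTwo_entry]
        exact (jetOne_pd_le_jetTwo _ _ x).trans (le_sum_sum
          (f := fun i j => jetTwo (fun y => Q y i j) x) (fun i j => jetTwo_nonneg _ _) p.1 p.2.1)
    simp only [← Finset.univ_product_univ, Finset.sum_product] at h
    rw [hN3]; push_cast; exact h
  have hL : ∫⁻ x, ENNReal.ofReal (frobSq (matLap Q x)) ≤ d * Z := by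
    calc _ ≤ ∫⁻ x, d * ENNReal.ofReal (frobSq (Q x) + gradQSq Q x + hessQSq Q x) := by
          refine lintegral_mono fun x => ?_
          rw [← ENNReal.ofReal_natCast, ← ENNReal.ofReal_mul (by positivity)]
          refine ENNReal.ofReal_le_ofReal ((frobSq_matLap_le Q x).trans ?_)
          gcongr
          linarith [frobSq_nonneg (Q x), gradQSq_nonneg Q x]
      _ = d * h2Sq Q := by rw [lintegral_const_mul' _ _ (by simp), h2Sq]
      _ ≤ _ := by gcongr
  have t4 : ∫⁻ x, ENNReal.ofReal (frobSq (matLap Q x)) ≤ d * Z ^ 2 := hL.trans (by gcongr)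
  have hsup : ∀ (f : E d → ℝ) (n : ℕ), Continuous f → ∫⁻ x, ENNReal.ofReal (frobSq (Q x) ^ n * f x)
      ≤ (C2 * Z) ^ n * ∫⁻ x, ENNReal.ofReal (f x) := by
    intro f n hf
    rw [← lintegral_const_mul _ hf.measurable.ennreal_ofReal]
    refine lintegral_mono fun x => ?_
    rw [ENNReal.ofReal_mul (pow_nonneg (frobSq_nonneg _) n), ENNReal.ofReal_pow (frobSq_nonneg _)]
    gcongr
    exact (hC2 Q hQ x).trans (by gcongr)
  have t5 : ∫⁻ x, ENNReal.ofReal (frobSq (Q x) * frobSq (matLap Q x)) ≤ C2 * d * Z ^ 2 := by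
    have := hsup (fun x => frobSq (matLap Q x)) 1 cL
    simp only [pow_one] at this
    refine this.trans ((mul_le_mul_right hL _).trans (le_of_eq (by ring)))
  have t6 : ∫⁻ x, ENNReal.ofReal (frobSq (Q x) * frobSq (gradU u x)) ≤ C2 * Z ^ 2 := by
    have := hsup (fun x => frobSq (gradU u x)) 1 cg
    simp only [pow_one] at this
    exact this.trans ((mul_le_mul_right hZ4 _).trans (le_of_eq (by ring)))
  have t7 : ∫⁻ x, ENNReal.ofReal (frobSq (Q x)) ≤ 1 * Z ^ 2 := by
    rw [one_mul]
    refine le_trans (le_trans (lintegral_mono fun x => ENNReal.ofReal_le_ofReal ?_) hZ2) hZZ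
    linarith [hessQSq_nonneg Q x, gradQSq_nonneg Q x]
  -- one factor `|Q|⁴` is bounded through `H² ⊂ L^∞` and the other through `H¹ ⊂ L⁴`, so that only
  -- the second power of `Z`, whose first power is integrable in time, appears
  have t8 : ∫⁻ x, ENNReal.ofReal (frobSq (Q x) ^ 2 * frobSq (Q x) ^ 2)
      ≤ C2 ^ 2 * C1 * (1 + h1Sq Q) ^ 2 * Z ^ 2 := by
    refine (hsup _ 2 (cq.pow 2)).trans ((mul_le_mul_right (hC1 Q hQ) _).trans ?_)
    calc _ = C2 ^ 2 * C1 * h1Sq Q ^ 2 * Z ^ 2 := by ring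
      _ ≤ _ := by gcongr; exact le_add_self
  have hpt : ∀ x, ENNReal.ofReal (dominant Q u x ^ 2) ≤ 8 * (ENNReal.ofReal (velSq u x ^ 2)
      + ENNReal.ofReal (frobSq (gradU u x)) + ENNReal.ofReal (gradQSq Q x ^ 2)
      + ENNReal.ofReal (frobSq (matLap Q x)) + ENNReal.ofReal (frobSq (Q x) * frobSq (matLap Q x))
      + ENNReal.ofReal (frobSq (Q x) * frobSq (gradU u x)) + ENNReal.ofReal (frobSq (Q x))
      + ENNReal.ofReal (frobSq (Q x) ^ 2 * frobSq (Q x) ^ 2)) := by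
    intro x
    have n1 := frobSq_nonneg (Q x)
    have n2 := frobSq_nonneg (gradU u x)
    have n3 := frobSq_nonneg (matLap Q x)
    rw [← ENNReal.ofReal_add (by positivity) (by positivity),
      ← ENNReal.ofReal_add (by positivity) (by positivity),
      ← ENNReal.ofReal_add (by positivity) (by positivity),
      ← ENNReal.ofReal_add (by positivity) (by positivity),
      ← ENNReal.ofReal_add (by positivity) (by positivity),
      ← ENNReal.ofReal_add (by positivity) (by positivity),
      ← ENNReal.ofReal_add (by positivity) (by positivity),
      show (8 : ℝ≥0∞) = ENNReal.ofReal 8 by simp, ← ENNReal.ofReal_mul (by norm_num)]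
    refine ENNReal.ofReal_le_ofReal ?_
    simp only [← frob_sq]
    have := sq_sum_le_card_mul_sum_sq (s := (Finset.univ : Finset (Fin 8)))
      (f := ![velSq u x, frob (gradU u x), gradQSq Q x, frob (matLap Q x),
        frob (Q x) * frob (matLap Q x), frob (Q x) * frob (gradU u x), frob (Q x), frob (Q x) ^ 4])
    simp [Fin.sum_univ_succ] at this
    refine le_trans (le_of_eq ?_) (this.trans (le_of_eq ?_))
    · unfold dominant; ring
    · ring
  refine (lintegral_mono hpt).trans ?_
  rw [lintegral_const_mul' _ _ (by simp),
    lintegral_add_right _ (show Continuous fun x => frobSq (Q x) ^ 2 * frobSq (Q x) ^ 2 by fun_prop).measurable.ennreal_ofReal,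
    lintegral_add_right _ cq.measurable.ennreal_ofReal,
    lintegral_add_right _ (show Continuous fun x => frobSq (Q x) * frobSq (gradU u x) by fun_prop).measurable.ennreal_ofReal,
    lintegral_add_right _ (show Continuous fun x => frobSq (Q x) * frobSq (matLap Q x) by fun_prop).measurable.ennreal_ofReal,
    lintegral_add_right _ cL.measurable.ennreal_ofReal,
    lintegral_add_right _ (show Continuous fun x => gradQSq Q x ^ 2 by fun_prop).measurable.ennreal_ofReal,
    lintegral_add_right _ cg.measurable.ennreal_ofReal]
  have h1le : (1 : ℝ≥0∞) ≤ (1 + h1Sq Q) ^ 2 := one_le_pow₀ le_self_add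
  have up : ∀ {I c : ℝ≥0∞}, I ≤ c * Z ^ 2 → I ≤ c * (1 + h1Sq Q) ^ 2 * Z ^ 2 := fun h =>
    h.trans (by gcongr; exact le_mul_of_one_le_right' h1le)
  calc _ ≤ 8 * (N1 * (1 + h1Sq Q) ^ 2 * Z ^ 2 + 1 * (1 + h1Sq Q) ^ 2 * Z ^ 2
        + N3 * (1 + h1Sq Q) ^ 2 * Z ^ 2 + d * (1 + h1Sq Q) ^ 2 * Z ^ 2
        + C2 * d * (1 + h1Sq Q) ^ 2 * Z ^ 2 + C2 * (1 + h1Sq Q) ^ 2 * Z ^ 2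
        + 1 * (1 + h1Sq Q) ^ 2 * Z ^ 2 + C2 ^ 2 * C1 * (1 + h1Sq Q) ^ 2 * Z ^ 2) := by
        gcongr
        exacts [up t1, up t2, up t3, up t4, up t5, up t6, up t7]
    _ = _ := by push_cast; ring

/-! ### The weak form of the momentum equation -/

lemma locallyLipschitz_mul {f g : E d → ℝ} (hf : LocallyLipschitz f) (hg : LocallyLipschitz g) :
    LocallyLipschitz fun x => f x * g x :=
  (show ContDiff ℝ 1 (fun p : ℝ × ℝ => p.1 * p.2) by fun_prop).locallyLipschitz.comp
    (hf.prodMk hg)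

lemma locallyLipschitz_of_contDiff {f : E d → ℝ} (hf : ContDiff ℝ ∞ f) : LocallyLipschitz f :=
  (hf.of_le (by simp)).locallyLipschitz

lemma locallyLipschitz_frob {Q : E d → Mat d} (hQ : SmoothMat Q) :
    LocallyLipschitz fun x => frob (Q x) := by
  have h1 : ContDiff ℝ 1 fun x =>
      (WithLp.toLp 2 (fun p : Fin d × Fin d => Q x p.1 p.2) : EuclideanSpace ℝ (Fin d × Fin d)) := by
    rw [contDiff_euclidean]
    exact fun p => (hQ p.1 p.2).of_le (by simp)
  have h2 : (fun x => frob (Q x)) = fun x =>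
      ‖(WithLp.toLp 2 (fun p : Fin d × Fin d => Q x p.1 p.2) : EuclideanSpace ℝ (Fin d × Fin d))‖ := by
    funext x
    rw [EuclideanSpace.norm_eq, frob, frobSq, ← Finset.univ_product_univ, Finset.sum_product]
    simp
  rw [h2]
  exact lipschitzWith_one_norm.locallyLipschitz.comp h1.locallyLipschitz

lemma SmoothMat.add {A B : E d → Mat d} (hA : SmoothMat A) (hB : SmoothMat B) :
    SmoothMat fun x => A x + B x := fun i j => (hA i j).add (hB i j)

lemma SmoothMat.sub {A B : E d → Mat d} (hA : SmoothMat A) (hB : SmoothMat B) :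
    SmoothMat fun x => A x - B x := fun i j => (hA i j).sub (hB i j)

lemma SmoothMat.smul {A : E d → Mat d} (hA : SmoothMat A) {f : E d → ℝ} (hf : ContDiff ℝ ∞ f) :
    SmoothMat fun x => f x • A x := fun i j => hf.mul (hA i j)

lemma SmoothMat.const (A : Mat d) : SmoothMat fun _ => A := fun _ _ => contDiff_const

lemma smoothMat_molField (a b c : ℝ) {Q : E d → Mat d} (hQ : SmoothMat Q) :
    SmoothMat (molField a b c Q) :=
  ((hQ.matLap.sub (hQ.smul contDiff_const)).add
    (((hQ.mul hQ).sub ((SmoothMat.const 1).smul ((hQ.mul hQ).trace.div_const _))).smul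
      contDiff_const)).sub ((hQ.smul (hQ.mul hQ).trace).smul contDiff_const)

lemma smoothMat_gradOdot {Q : E d → Mat d} (hQ : SmoothMat Q) : SmoothMat (gradOdot Q) :=
  fun α β => (hQ.mpd α).dot (hQ.mpd β)

/-- The part of the momentum flux that is smooth. -/
def smoothStress (κ μ : ℝ) (Q : E d → Mat d) (u : E d → E d) (x : E d) : Mat d :=
  Matrix.of (fun α β => u x α * u x β) - μ • gradU u x + gradOdot Q x
    - (Q x * matLap Q x - matLap Q x * Q x) - κ • Q x

lemma smoothMat_smoothStress (κ μ : ℝ) {Q : E d → Mat d} (hQ : SmoothMat Q) {u : E d → E d}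
    (hu : ∀ α, ContDiff ℝ ∞ fun x => u x α) : SmoothMat (smoothStress κ μ Q u) := by
  have h1 : SmoothMat fun x => Matrix.of (fun α β => u x α * u x β) := fun α β => (hu α).mul (hu β)
  exact (((h1.sub ((smoothMat_gradU hu).smul contDiff_const)).add (smoothMat_gradOdot hQ)).sub
    ((hQ.mul hQ.matLap).sub (hQ.matLap.mul hQ))).sub (hQ.smul contDiff_const)

lemma stress_apply_eq (a b c κ μ lam : ℝ) (Q : E d → Mat d) (u : E d → E d) (x : E d)
    (α β : Fin d) : stress a b c κ μ lam Q u x α β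
      = smoothStress κ μ Q u x α β + lam * (frob (Q x) • molField a b c Q x) α β := by
  simp only [stress, smoothStress, Matrix.add_apply, Matrix.sub_apply, Matrix.smul_apply, smul_eq_mul]
  ring

lemma locallyLipschitz_stress (a b c κ μ lam : ℝ) {Q : E d → Mat d} (hQ : SmoothMat Q)
    {u : E d → E d} (hu : ∀ α, ContDiff ℝ ∞ fun x => u x α) (α β : Fin d) :
    LocallyLipschitz fun x => stress a b c κ μ lam Q u x α β := by
  simp only [stress_apply_eq]
  exact (locallyLipschitz_of_contDiff (smoothMat_smoothStress κ μ hQ hu α β)).add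
    (locallyLipschitz_mul (LocallyLipschitz.const lam) (locallyLipschitz_mul
      (locallyLipschitz_frob hQ) (locallyLipschitz_of_contDiff (smoothMat_molField a b c hQ α β))))

lemma deriv_eq_of_uEquation {a b c κ μ lam : ℝ} {Q : ℝ → E d → Mat d} {u : ℝ → E d → E d}
    {P : ℝ → E d → ℝ} {t : ℝ} {x : E d} (hQ : SmoothMat (Q t))
    (hu : ∀ α, ContDiff ℝ ∞ fun x => u t x α) (hdiv : divU (u t) x = 0)
    (hd : ∀ α β, DifferentiableAt ℝ (fun y => (frob (Q t y) • molField a b c (Q t) y) α β) x)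
    (h : uEquation a b c κ μ lam Q u P t x) (α : Fin d) :
    deriv (fun s => u s x α) t
      = - (∑ β, pd β (fun y => stress a b c κ μ lam (Q t) (u t) y α β) x) - pd α (P t) x := by
  have D : ∀ {f : E d → ℝ}, ContDiff ℝ ∞ f → DifferentiableAt ℝ f x := fun h =>
    h.differentiable (by simp) x
  have hh := h α
  have hcomm : SmoothMat fun y => Q t y * matLap (Q t) y - matLap (Q t) y * Q t y :=
    (hQ.mul hQ.matLap).sub (hQ.matLap.mul hQ)
  have hs : ∀ β, pd β (fun y => stress a b c κ μ lam (Q t) (u t) y α β) x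
      = (u t x α * pd β (fun y => u t y β) x + u t x β * pd β (fun y => u t y α) x)
        - μ * pd β (pd β (fun y => u t y α)) x
        + pd β (fun y => gradOdot (Q t) y α β) x
        - pd β (fun y => (Q t y * matLap (Q t) y - matLap (Q t) y * Q t y) α β) x
        - κ * pd β (fun y => Q t y α β) x
        + lam * pd β (fun y => (frob (Q t y) • molField a b c (Q t) y) α β) x := by
    intro β
    have s1 : ContDiff ℝ ∞ fun y => u t y α * u t y β := (hu α).mul (hu β)
    have s2 : ContDiff ℝ ∞ fun y => μ * gradU (u t) y α β :=
      contDiff_const.mul (smoothMat_gradU hu α β)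
    have s3 := smoothMat_gradOdot hQ α β
    have s4 := hcomm α β
    have s5 : ContDiff ℝ ∞ fun y => κ * Q t y α β := contDiff_const.mul (hQ α β)
    simp only [stress_apply_eq]
    rw [pd_add (D (smoothMat_smoothStress κ μ hQ hu α β)) ((hd α β).const_mul lam),
      pd_const_mul (hd α β)]
    simp only [smoothStress]
    have e : (fun y => (Matrix.of (fun α β => u t y α * u t y β) - μ • gradU (u t) y
        + gradOdot (Q t) y - (Q t y * matLap (Q t) y - matLap (Q t) y * Q t y) - κ • Q t y) α β)
        = fun y => u t y α * u t y β - μ * gradU (u t) y α β + gradOdot (Q t) y α β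
          - (Q t y * matLap (Q t) y - matLap (Q t) y * Q t y) α β - κ * Q t y α β := rfl
    rw [e, pd_sub (D (((s1.sub s2).add s3).sub s4)) (D s5), pd_sub (D ((s1.sub s2).add s3)) (D s4),
      pd_add (D (s1.sub s2)) (D s3), pd_sub (D s1) (D s2), pd_mul (D (hu α)) (D (hu β)),
      pd_const_mul (D (smoothMat_gradU hu α β)), pd_const_mul (D (hQ α β))]
    simp only [gradU, Matrix.of_apply]
    ring
  have hdiv' : ∑ β, pd β (fun y => u t y β) x = 0 := hdiv
  simp only [hs, Finset.sum_add_distrib, Finset.sum_sub_distrib, ← Finset.mul_sum, hdiv']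
  simp only [matDiv, lap] at hh
  linarith

/-- The momentum equation tested with a divergence-free field: the pressure drops out. -/
lemma weak_momentum {a b c κ μ lam : ℝ} {Q : ℝ → E d → Mat d} {u : ℝ → E d → E d}
    {P : ℝ → E d → ℝ} {t : ℝ} (hQ : SmoothMat (Q t))
    (hu : ∀ α, ContDiff ℝ ∞ fun x => u t x α) (hdiv : ∀ x, divU (u t) x = 0)
    (hP : LocallyLipschitz (P t)) (h : ∀ᵐ x, uEquation a b c κ μ lam Q u P t x)
    {w : Fin d → E d → ℝ} (hw : IsSolenoidalTest w) :
    ∑ α, ∫ x, deriv (fun s => u s x α) t * w α x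
      = ∑ α, ∑ β, ∫ x, stress a b c κ μ lam (Q t) (u t) x α β * pd β (w α) x := by
  have hLip := locallyLipschitz_stress a b c κ μ lam hQ hu
  have hnd : ∀ᵐ x, ∀ α β, DifferentiableAt ℝ
      (fun y => (frob (Q t y) • molField a b c (Q t) y) α β) x := by
    rw [ae_all_iff]; intro α
    rw [ae_all_iff]; intro β
    exact ae_differentiableAt_of_locallyLipschitz (locallyLipschitz_mul
      (locallyLipschitz_frob hQ) (locallyLipschitz_of_contDiff (smoothMat_molField a b c hQ α β)))
  have h1 : ∀ α, ∫ x, deriv (fun s => u s x α) t * w α x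
      = ∑ β, (∫ x, stress a b c κ μ lam (Q t) (u t) x α β * pd β (w α) x)
        + ∫ x, P t x * pd α (w α) x := by
    intro α
    have i1 := fun β => (hw.test α).integral_pd_mul (hLip α β) β
    have i2 := (hw.test α).integral_pd_mul hP α
    have i3 : Integrable fun x =>
        - ∑ β, pd β (fun y => stress a b c κ μ lam (Q t) (u t) y α β) x * w α x :=
      (integrable_finsetSum _ fun β _ => (i1 β).1).neg
    calc ∫ x, deriv (fun s => u s x α) t * w α x
        = ∫ x, (- (∑ β, pd β (fun y => stress a b c κ μ lam (Q t) (u t) y α β) x * w α x)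
            - pd α (P t) x * w α x) := by
          refine integral_congr_ae ?_
          filter_upwards [h, hnd] with x hx hdx
          rw [deriv_eq_of_uEquation hQ hu (hdiv x) hdx hx α, ← Finset.sum_mul]
          ring
      _ = _ := by
          rw [integral_sub i3 i2.1, integral_neg,
            integral_finsetSum _ fun β _ => (i1 β).1, i2.2]
          simp only [(i1 _).2, Finset.sum_neg_distrib]
          ring
  simp only [h1, Finset.sum_add_distrib]
  have h2 : ∑ α, ∫ x, P t x * pd α (w α) x = 0 := by
    rw [← integral_finsetSum _ fun α _ => by
      simpa only [mul_comm] using ((hw.test α).pderiv α).integrable_mul hP.continuous]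
    simp only [← Finset.mul_sum, hw.div, mul_zero, integral_zero]
  rw [h2, add_zero]

/-! ### Bounds at every time -/

/-- Fatou's lemma turns a bound for almost every time into a bound for every time. -/
lemma lintegral_le_of_ae_le {I : Set ℝ} (hI : IsOpen I) {f : ℝ → E d → ℝ} (hf : ContField I f)
    {K : ℝ≥0∞} (h : ∀ᵐ t ∂(volume.restrict I), ∫⁻ x, ENNReal.ofReal (f t x) ≤ K) {t : ℝ}
    (ht : t ∈ I) : ∫⁻ x, ENNReal.ofReal (f t x) ≤ K := by
  rw [ae_restrict_iff' hI.measurableSet] at h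
  have h1 := (Measure.dense_of_ae h).open_subset_closure_inter hI ht
  obtain ⟨s, hs, hst⟩ := mem_closure_iff_seq_limit.1 h1
  have hlim : ∀ x, Filter.Tendsto (fun n => ENNReal.ofReal (f (s n) x)) Filter.atTop
      (nhds (ENNReal.ofReal (f t x))) := fun x =>
    ENNReal.tendsto_ofReal (((hf.time x).continuousAt (hI.mem_nhds ht)).tendsto.comp hst)
  calc ∫⁻ x, ENNReal.ofReal (f t x)
      = ∫⁻ x, Filter.liminf (fun n => ENNReal.ofReal (f (s n) x)) Filter.atTop :=
        lintegral_congr fun x => (hlim x).liminf_eq.symm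
    _ ≤ Filter.liminf (fun n => ∫⁻ x, ENNReal.ofReal (f (s n) x)) Filter.atTop :=
        lintegral_liminf_le fun n => (hf.slice (hs n).1).measurable.ennreal_ofReal
    _ ≤ K := Filter.liminf_le_of_frequently_le' (Filter.Frequently.of_forall fun n =>
        (hs n).2 (hs n).1)

lemma aemeasurable_lintegral {I : Set ℝ} (hI : MeasurableSet I) {f : ℝ → E d → ℝ}
    (hf : ContField I f) :
    AEMeasurable (fun t => ∫⁻ x, ENNReal.ofReal (f t x)) (volume.restrict I) :=
  (hf.aestronglyMeasurable hI).aemeasurable.ennreal_ofReal.lintegral_prod_right'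

/-! ### The localized energy inequality on a time slice -/

lemma integrable_of_lintegral_le {f : E d → ℝ} (hf : Continuous f) (h0 : ∀ x, 0 ≤ f x) {r : ℝ}
    (hr : 0 ≤ r) (h : ∫⁻ x, ENNReal.ofReal (f x) ≤ ENNReal.ofReal r) :
    Integrable f ∧ ∫ x, f x ≤ r := by
  constructor
  · refine ⟨hf.aestronglyMeasurable, ?_⟩
    rw [hasFiniteIntegral_iff_ofReal (Filter.Eventually.of_forall h0)]
    exact h.trans_lt ENNReal.ofReal_lt_top
  · rw [integral_eq_lintegral_of_nonneg_ae (Filter.Eventually.of_forall h0)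
      hf.aestronglyMeasurable]
    exact ENNReal.toReal_le_of_le_ofReal hr h

lemma memLp_two_of_lintegral_le {f : E d → ℝ} (hf : Continuous f) {r : ℝ}
    (h : ∫⁻ x, ENNReal.ofReal (f x ^ 2) ≤ ENNReal.ofReal r) : MemLp f 2 := by
  refine memLp_two_of_lintegral hf.aestronglyMeasurable ?_
  simp only [← ofReal_pow_two]
  exact h.trans_lt ENNReal.ofReal_lt_top

lemma integral_mul_le_of_lintegral_le {f g : E d → ℝ} (hf : Continuous f) (hg : Continuous g)
    {r s : ℝ} (hr : 0 ≤ r) (hs : 0 ≤ s)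
    (hfr : ∫⁻ x, ENNReal.ofReal (f x ^ 2) ≤ ENNReal.ofReal (r ^ 2))
    (hgs : ∫⁻ x, ENNReal.ofReal (g x ^ 2) ≤ ENNReal.ofReal (s ^ 2)) :
    Integrable (fun x => f x * g x) ∧ ∫ x, f x * g x ≤ r * s := by
  have mf := memLp_two_of_lintegral_le hf hfr
  have mg := memLp_two_of_lintegral_le hg hgs
  refine ⟨mf.integrable_mul mg, (le_abs_self _).trans ((abs_integral_mul_le mf mg).trans ?_)⟩
  have h1 := (integrable_of_lintegral_le (hf.pow 2) (fun x => sq_nonneg _) (sq_nonneg r) hfr).2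
  have h2 := (integrable_of_lintegral_le (hg.pow 2) (fun x => sq_nonneg _) (sq_nonneg s) hgs).2
  exact mul_le_mul (Real.sqrt_le_iff.2 ⟨hr, h1⟩) (Real.sqrt_le_iff.2 ⟨hs, h2⟩)
    (Real.sqrt_nonneg _) hr

lemma continuous_stress (a b c κ μ lam : ℝ) {Q : E d → Mat d} (hQ : SmoothMat Q)
    {u : E d → E d} (hu : ∀ α, ContDiff ℝ ∞ fun x => u x α) (α β : Fin d) :
    Continuous fun x => stress a b c κ μ lam Q u x α β :=
  (locallyLipschitz_stress a b c κ μ lam hQ hu α β).continuous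

lemma continuous_dominant {Q : E d → Mat d} (hQ : SmoothMat Q) {u : E d → E d}
    (hu : ∀ α, ContDiff ℝ ∞ fun x => u x α) : Continuous (dominant Q u) := by
  have h1 := continuous_velSq hu
  have h2 := continuous_frob (smoothMat_gradU hu)
  have h3 := (contDiff_gradQSq hQ).continuous
  have h4 := continuous_frob hQ
  have h5 := continuous_frob hQ.matLap
  unfold dominant
  fun_prop

lemma continuous_production (a b c κ μ lam Γ K : ℝ) {Q : E d → Mat d} (hQ : SmoothMat Q)
    {u : E d → E d} (hu : ∀ α, ContDiff ℝ ∞ fun x => u x α) :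
    Continuous (production a b c κ μ lam Γ K Q u) := by
  have h1 := (contDiff_frobSq (smoothMat_gradU hu)).continuous
  have h2 := (contDiff_frobSq (smoothMat_molField a b c hQ)).continuous
  have h3 := (hQ.dot (smoothMat_gradU hu)).continuous
  have h4 := continuous_frob hQ
  have h5 := (hQ.dot (smoothMat_molField a b c hQ)).continuous
  unfold production
  fun_prop

lemma contDiff_energyDensity (a b c : ℝ) {Q : E d → Mat d} (hQ : SmoothMat Q)
    {u : E d → E d} (hu : ∀ α, ContDiff ℝ ∞ fun x => u x α) :
    ContDiff ℝ ∞ (energyDensity a b c Q u) :=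
  (((contDiff_const.mul (ContDiff.sum fun α _ => (hu α).pow 2)).add
    (contDiff_const.mul (contDiff_gradQSq hQ))).add (hQ.bulk a b c)).add
    (contDiff_const.mul (contDiff_frobSq hQ))

lemma continuous_bulkD (a b c : ℝ) {Q R : E d → Mat d} (hQ : SmoothMat Q) (hR : SmoothMat R) :
    Continuous fun x => bulkD a b c (Q x) (R x) := by
  have h1 := (hQ.dot hR).continuous
  have h2 := ((hQ.mul hQ).dot hR).continuous
  have h3 := (hQ.mul hQ).trace.continuous
  unfold bulkD
  fun_prop

/-- The time derivative of the part of the energy density that depends on `Q`, where `R = ∂ₜQ`. -/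
def elasticRate (a b c : ℝ) (Q R : E d → Mat d) (x : E d) : ℝ :=
  ∑ k, dot (mpd k Q x) (mpd k R x) + bulkD a b c (Q x) (R x) + coerc a b c * dot (Q x) (R x)

lemma continuous_elasticRate (a b c : ℝ) {Q R : E d → Mat d} (hQ : SmoothMat Q)
    (hR : SmoothMat R) : Continuous (elasticRate a b c Q R) :=
  ((continuous_finsetSum _ fun k _ => ((hQ.mpd k).dot (hR.mpd k)).continuous).add
    (continuous_bulkD a b c hQ hR)).add (continuous_const.mul (hQ.dot hR).continuous)

lemma l2Sq_eq (u : E d → E d) : l2Sq u = ∫⁻ x, ENNReal.ofReal (velSq u x) := by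
  simp only [l2Sq, norm_sq_eq_velSq]

lemma sqrt_integral_div_sq_le {u : E d → E d} (hu : ∀ α, ContDiff ℝ ∞ fun x => u x α)
    (hdiv : ∀ x, divU u x = 0) {N δ : ℝ} (hN : 0 ≤ N)
    (huN : l2Sq u ≤ ENNReal.ofReal (N ^ 2)) {φ : E d → ℝ} (hφ : IsTest φ) (hδ : 0 ≤ δ)
    (hφδ : ∀ k x, |pd k φ x| ≤ δ) :
    √(∫ x, (∑ α, pd α (fun y => φ y * u y α) x) ^ 2) ≤ d * δ * N := by
  have h1 : ∀ x, ∑ α, pd α (fun y => φ y * u y α) x = ∑ α, u x α * pd α φ x := by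
    intro x
    have h2 : ∀ α, pd α (fun y => φ y * u y α) x
        = φ x * pd α (fun y => u y α) x + u x α * pd α φ x := fun α => by
      rw [pd_mul (hφ.differentiable x) ((hu α).differentiable (by simp) x)]; ring
    have h3 : ∑ α, pd α (fun y => u y α) x = 0 := hdiv x
    simp only [h2, Finset.sum_add_distrib, ← Finset.mul_sum, h3]
    ring
  have hv := integrable_of_lintegral_le (continuous_velSq hu) (velSq_nonneg u) (sq_nonneg N)
    (l2Sq_eq u ▸ huN)
  refine Real.sqrt_le_iff.2 ⟨by positivity, ?_⟩
  simp only [h1]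
  have hb : ∀ x, (∑ α, u x α * pd α φ x) ^ 2 ≤ d * δ ^ 2 * velSq u x := by
    intro x
    refine (Finset.sum_mul_sq_le_sq_mul_sq _ _ _).trans ?_
    rw [mul_comm (d * δ ^ 2)]
    refine mul_le_mul_of_nonneg_left ?_ (velSq_nonneg u x)
    calc _ ≤ ∑ _k : Fin d, δ ^ 2 := Finset.sum_le_sum fun k _ => by
          rw [← sq_abs]; gcongr; exact hφδ k x
      _ = _ := by simp
  calc ∫ x, (∑ α, u x α * pd α φ x) ^ 2 ≤ ∫ x, d * δ ^ 2 * velSq u x :=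
        integral_mono_of_nonneg (Filter.Eventually.of_forall fun x => sq_nonneg _)
          (hv.1.const_mul _) (Filter.Eventually.of_forall hb)
    _ = d * δ ^ 2 * ∫ x, velSq u x := integral_const_mul _ _
    _ ≤ d * δ ^ 2 * N ^ 2 := by gcongr; exact hv.2
    _ ≤ (d * δ * N) ^ 2 := by
        rw [mul_pow, mul_pow]
        gcongr
        have : (d : ℝ) ≤ (d : ℝ) ^ 2 := by exact_mod_cast Nat.le_self_pow (by norm_num) d
        exact this

/-- The integrated form of the localized energy balance at one time, `R` standing for `∂ₜQ`. The
error is the size of `∇φ` times the energy norm times the norm of the fluxes. -/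
lemma exists_slice_inequality (d : ℕ) {a b c κ μ lam Γ : ℝ} (hc : 0 < c) (hμ : 0 < μ)
    (hΓ : 0 < Γ) : ∃ C : ℝ, 0 ≤ C ∧ ∀ {Q R : E d → Mat d} (_ : SmoothMat Q) (_ : SmoothMat R)
      (_ : ∀ x, (Q x).IsSymm) (_ : ∀ x, (Q x).trace = 0) (_ : ∀ x, (R x).trace = 0)
      {u : E d → E d} (_ : ∀ α, ContDiff ℝ ∞ fun x => u x α) (_ : ∀ x, divU u x = 0)
      (_ : ∀ x, R x + advectQ u Q x + Q x * skewPart u x - skewPart u x * Q x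
        - (lam * frob (Q x)) • symPart u x = Γ • molField a b c Q x)
      {N A δ : ℝ} (_ : 0 ≤ N) (_ : 0 ≤ A) (_ : 0 ≤ δ)
      (_ : l2Sq u ≤ ENNReal.ofReal (N ^ 2)) (_ : h1Sq Q ≤ ENNReal.ofReal (N ^ 2))
      (_ : ∫⁻ x, ENNReal.ofReal (dominant Q u x ^ 2) ≤ ENNReal.ofReal (A ^ 2))
      {φ : E d → ℝ} (_ : IsTest φ) (_ : ∀ x, 0 ≤ φ x) (_ : ∀ k x, |pd k φ x| ≤ δ),
      (∫ x, φ x * elasticRate a b c Q R x)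
          + ∑ α, ∑ β, ∫ x, stress a b c κ μ lam Q u x α β * pd β (fun y => φ y * u y α) x
        ≤ rate κ μ lam Γ (coerc a b c) c * (∫ x, φ x * energyDensity a b c Q u x)
          - μ / 2 * (∫ x, φ x * frobSq (gradU u x)) + C * (δ * N * A) := by
  obtain ⟨C, hC, hflux⟩ := exists_flux_le d a b c κ μ lam Γ (coerc a b c)
  refine ⟨d * (C * 2), by positivity, fun {Q R} hQ hR hs h0 hR0 {u} hu hdiv heq {N A δ} hN hA hδ
    huN hQN hPA {φ} hφ hφ0 hφδ => ?_⟩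
  have iF : ∀ α β, Integrable fun x =>
      stress a b c κ μ lam Q u x α β * pd β (fun y => φ y * u y α) x := fun α β => by
    simpa only [mul_comm] using
      ((hφ.mul_left (hu α)).pderiv β).integrable_mul (continuous_stress a b c κ μ lam hQ hu α β)
  have iE := hφ.integrable_mul (continuous_elasticRate a b c hQ hR)
  set res : Fin d → E d → ℝ := fun k x => ∑ α, stress a b c κ μ lam Q u x α k * u x α
    - energyFlux a b c (coerc a b c) Q R u k x with hres
  have cres : ∀ k, Continuous (res k) := fun k =>
    (continuous_finsetSum _ fun α _ =>
      (continuous_stress a b c κ μ lam hQ hu α k).mul (hu α).continuous).sub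
      (contDiff_energyFlux a b c _ hQ hR hu k).continuous
  have iR : ∀ k, Integrable fun x => pd k φ x * res k x := fun k =>
    (hφ.pderiv k).integrable_mul (cres k)
  have iP := hφ.integrable_mul (continuous_production a b c κ μ lam Γ (coerc a b c) hQ hu)
  have tY : ∀ k, IsTest fun y => φ y * energyFlux a b c (coerc a b c) Q R u k y := fun k =>
    hφ.mul_left (contDiff_energyFlux a b c _ hQ hR hu k)
  have hbal : (∫ x, φ x * elasticRate a b c Q R x)
        + ∑ α, ∑ β, ∫ x, stress a b c κ μ lam Q u x α β * pd β (fun y => φ y * u y α) x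
      = (∫ x, φ x * production a b c κ μ lam Γ (coerc a b c) Q u x)
        + ∑ k, ∫ x, pd k φ x * res k x := by
    have e1 : ∑ α, ∑ β, ∫ x, stress a b c κ μ lam Q u x α β * pd β (fun y => φ y * u y α) x
        = ∫ x, ∑ α, ∑ β, stress a b c κ μ lam Q u x α β * pd β (fun y => φ y * u y α) x := by
      rw [integral_finsetSum _ fun α _ => integrable_finsetSum _ fun β _ => iF α β]
      exact Finset.sum_congr rfl fun α _ => (integral_finsetSum _ fun β _ => iF α β).symm
    rw [e1, ← integral_add iE
      (integrable_finsetSum _ fun α _ => integrable_finsetSum _ fun β _ => iF α β),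
      ← integral_finsetSum _ fun k _ => iR k,
      ← integral_add iP (integrable_finsetSum _ fun k _ => iR k)]
    have e2 : ∫ x, ∑ k, pd k (fun y => φ y * energyFlux a b c (coerc a b c) Q R u k y) x = 0 := by
      rw [integral_finsetSum _ fun k _ => ((tY k).pderiv k).integrable]
      exact Finset.sum_eq_zero fun k _ => (tY k).integral_pd k
    have iY : Integrable fun x =>
        ∑ k, pd k (fun y => φ y * energyFlux a b c (coerc a b c) Q R u k y) x :=
      integrable_finsetSum _ fun k _ => ((tY k).pderiv k).integrable
    have iPR : Integrable fun x => φ x * production a b c κ μ lam Γ (coerc a b c) Q u x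
        + ∑ k, pd k φ x * res k x := iP.add (integrable_finsetSum _ fun k _ => iR k)
    calc _ = ∫ x, (∑ k, pd k (fun y => φ y * energyFlux a b c (coerc a b c) Q R u k y) x
          + (φ x * production a b c κ μ lam Γ (coerc a b c) Q u x
            + ∑ k, pd k φ x * res k x)) := by
          refine integral_congr_ae (Filter.Eventually.of_forall fun x => ?_)
          have := local_energy_balance (κ := κ) (μ := μ) (K := coerc a b c) hQ hR hs h0 hu (hR0 x)
            (hdiv x) (heq x) hφ.smooth
          simp only [elasticRate, hres]
          rw [this, add_assoc]
      _ = _ := by rw [integral_add iY iPR, e2, zero_add]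
  have hprod : ∫ x, φ x * production a b c κ μ lam Γ (coerc a b c) Q u x
      ≤ rate κ μ lam Γ (coerc a b c) c * (∫ x, φ x * energyDensity a b c Q u x)
        - μ / 2 * (∫ x, φ x * frobSq (gradU u x)) := by
    have i1 := hφ.integrable_mul (contDiff_energyDensity a b c hQ hu).continuous
    have i2 := hφ.integrable_mul (contDiff_frobSq (smoothMat_gradU hu)).continuous
    rw [← integral_const_mul, ← integral_const_mul, ← integral_sub (i1.const_mul _) (i2.const_mul _)]
    refine integral_mono iP ((i1.const_mul _).sub (i2.const_mul _)) fun x => ?_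
    have := mul_le_mul_of_nonneg_left (production_le_rate (a := a) (b := b) (κ := κ) (lam := lam)
      hc hμ hΓ u (hs x)) (hφ0 x)
    exact this.trans (le_of_eq (by ring))
  have cU : Continuous fun x => √(velSq u x) := Real.continuous_sqrt.comp (continuous_velSq hu)
  have cD : Continuous fun x => √(gradQSq Q x) :=
    Real.continuous_sqrt.comp (contDiff_gradQSq hQ).continuous
  have cP := continuous_dominant hQ hu
  have hU := integral_mul_le_of_lintegral_le cU cP hN hA (by
    simpa only [Real.sq_sqrt (velSq_nonneg u _), ← l2Sq_eq] using huN) hPA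
  have hD := integral_mul_le_of_lintegral_le cD cP hN hA (by
    simp only [Real.sq_sqrt (gradQSq_nonneg Q _)]
    refine le_trans (lintegral_mono fun x => ENNReal.ofReal_le_ofReal ?_) hQN
    linarith [frobSq_nonneg (Q x)]) hPA
  have hres' : ∀ k, ∫ x, pd k φ x * res k x ≤ δ * (C * (N * A + N * A)) := by
    intro k
    have i3 : Integrable fun x => δ * (C * (√(velSq u x) * dominant Q u x
        + √(gradQSq Q x) * dominant Q u x)) := ((hU.1.add hD.1).const_mul C).const_mul δ
    calc ∫ x, pd k φ x * res k x ≤ ∫ x, δ * (C * (√(velSq u x) * dominant Q u x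
          + √(gradQSq Q x) * dominant Q u x)) := by
          refine integral_mono (iR k) i3 fun x => ?_
          refine (le_abs_self _).trans ?_
          rw [abs_mul, ← add_mul]
          exact mul_le_mul (hφδ k x) (hflux Q R u x (hs x) (heq x) k) (abs_nonneg _) hδ
      _ = δ * (C * ((∫ x, √(velSq u x) * dominant Q u x) + ∫ x, √(gradQSq Q x) * dominant Q u x)) := by
          rw [integral_const_mul, integral_const_mul, integral_add hU.1 hD.1]
      _ ≤ _ := by gcongr; exacts [hU.2, hD.2]
  rw [hbal]
  have hsum : ∑ k, ∫ x, pd k φ x * res k x ≤ d * (δ * (C * (N * A + N * A))) := by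
    refine (Finset.sum_le_sum fun k _ => hres' k).trans (le_of_eq ?_)
    simp
  refine (add_le_add hprod hsum).trans (le_of_eq ?_)
  ring

/-! ### Evolution of matrix fields -/

/-- A time-dependent matrix field with entries smooth on `I × ℝᵈ`. -/
def SmoothMatField (I : Set ℝ) (A : ℝ → E d → Mat d) : Prop :=
  ∀ i j, SmoothField I fun t x => A t x i j

namespace SmoothMatField

variable {I : Set ℝ} {A B : ℝ → E d → Mat d}

lemma slice (hA : SmoothMatField I A) {t : ℝ} (ht : t ∈ I) : SmoothMat (A t) :=
  fun i j => (hA i j).slice ht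

lemma mono {J : Set ℝ} (hA : SmoothMatField I A) (h : J ⊆ I) : SmoothMatField J A :=
  fun i j => (hA i j).mono h

lemma mpd (hI : UniqueDiffOn ℝ I) (hA : SmoothMatField I A) (k : Fin d) :
    SmoothMatField I fun t => mpd k (A t) := fun i j => (hA i j).pderiv hI k

lemma add (hA : SmoothMatField I A) (hB : SmoothMatField I B) :
    SmoothMatField I fun t x => A t x + B t x := fun i j => (hA i j).add (hB i j)

lemma sub (hA : SmoothMatField I A) (hB : SmoothMatField I B) :
    SmoothMatField I fun t x => A t x - B t x := fun i j => (hA i j).sub (hB i j)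

lemma smul {f : ℝ → E d → ℝ} (hf : SmoothField I f) (hA : SmoothMatField I A) :
    SmoothMatField I fun t x => f t x • A t x := fun i j => hf.mul (hA i j)

lemma const_smul (r : ℝ) (hA : SmoothMatField I A) :
    SmoothMatField I fun t x => r • A t x := fun i j => (hA i j).const_mul r

lemma const (M : Mat d) : SmoothMatField I fun _ _ => M := fun _ _ => contDiffOn_const

lemma mul (hA : SmoothMatField I A) (hB : SmoothMatField I B) :
    SmoothMatField I fun t x => A t x * B t x := fun i j => by
  simp only [Matrix.mul_apply]
  exact SmoothField.sum fun k _ => (hA i k).mul (hB k j)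

lemma trace (hA : SmoothMatField I A) : SmoothField I fun t x => (A t x).trace := by
  simp only [Matrix.trace, Matrix.diag_apply]
  exact SmoothField.sum fun k _ => hA k k

lemma dot (hA : SmoothMatField I A) (hB : SmoothMatField I B) :
    SmoothField I fun t x => dot (A t x) (B t x) :=
  SmoothField.sum fun i _ => SmoothField.sum fun j _ => (hA i j).mul (hB i j)

lemma frobSq (hA : SmoothMatField I A) : SmoothField I fun t x => frobSq (A t x) := by
  simpa only [frobSq_eq_dot] using hA.dot hA

lemma frob (hA : SmoothMatField I A) : ContField I fun t x => frob (A t x) :=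
  hA.frobSq.contField.sqrt

lemma matLap (hI : UniqueDiffOn ℝ I) (hA : SmoothMatField I A) :
    SmoothMatField I fun t => matLap (A t) := fun i j => by
  simp only [ActiveLC.matLap, lap, Matrix.of_apply]
  exact SmoothField.sum fun k _ => ((hA i j).pderiv hI k).pderiv hI k

lemma gradQSq (hI : UniqueDiffOn ℝ I) (hA : SmoothMatField I A) :
    SmoothField I fun t => gradQSq (A t) :=
  SmoothField.sum fun i _ => SmoothField.sum fun j _ => SmoothField.sum fun k _ =>
    ((hA i j).pderiv hI k).pow 2

lemma hessQSq (hI : UniqueDiffOn ℝ I) (hA : SmoothMatField I A) :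
    SmoothField I fun t => hessQSq (A t) :=
  SmoothField.sum fun i _ => SmoothField.sum fun j _ => SmoothField.sum fun k _ =>
    SmoothField.sum fun l _ => (((hA i j).pderiv hI l).pderiv hI k).pow 2

lemma molField (a b c : ℝ) (hI : UniqueDiffOn ℝ I) (hA : SmoothMatField I A) :
    SmoothMatField I fun t => molField a b c (A t) := by
  have h2 := hA.mul hA
  have h3 : SmoothField I fun t x => (A t x * A t x).trace / (d : ℝ) := by
    simpa only [div_eq_inv_mul] using h2.trace.const_mul (d : ℝ)⁻¹
  exact (((hA.matLap hI).sub (hA.const_smul a)).add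
    ((h2.sub (smul h3 (const 1))).const_smul b)).sub ((smul h2.trace hA).const_smul c)

lemma bulk (a b c : ℝ) (hA : SmoothMatField I A) : SmoothField I fun t x => bulk a b c (A t x) :=
  (((hA.mul hA).trace.const_mul (a / 2)).sub (((hA.mul hA).mul hA).trace.const_mul (b / 3))).add
    (((hA.mul hA).trace.pow 2).const_mul (c / 4))

end SmoothMatField

section VelocityFields

variable {I : Set ℝ} {u : ℝ → E d → E d} {Q : ℝ → E d → Mat d}

lemma smoothField_velSq (hu : ∀ α, SmoothField I fun t x => u t x α) :
    SmoothField I fun t => velSq (u t) := SmoothField.sum fun α _ => (hu α).pow 2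

lemma smoothMatField_gradU (hI : UniqueDiffOn ℝ I) (hu : ∀ α, SmoothField I fun t x => u t x α) :
    SmoothMatField I fun t => gradU (u t) := fun α β => (hu α).pderiv hI β

lemma smoothField_energyDensity (a b c : ℝ) (hI : UniqueDiffOn ℝ I) (hQ : SmoothMatField I Q)
    (hu : ∀ α, SmoothField I fun t x => u t x α) :
    SmoothField I fun t => energyDensity a b c (Q t) (u t) :=
  ((((smoothField_velSq hu).const_mul (1 / 2)).add ((hQ.gradQSq hI).const_mul (1 / 2))).add
    (hQ.bulk a b c)).add (hQ.frobSq.const_mul (coerc a b c / 2))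

lemma contField_stress (a b c κ μ lam : ℝ) (hI : UniqueDiffOn ℝ I) (hQ : SmoothMatField I Q)
    (hu : ∀ α, SmoothField I fun t x => u t x α) (α β : Fin d) :
    ContField I fun t x => stress a b c κ μ lam (Q t) (u t) x α β := by
  simp only [stress_apply_eq]
  have hL := hQ.matLap hI
  have hG : SmoothField I fun t x => gradOdot (Q t) x α β := (hQ.mpd hI α).dot (hQ.mpd hI β)
  have hT : SmoothField I fun t x => u t x α * u t x β := (hu α).mul (hu β)
  have h1 : SmoothField I fun t x => smoothStress κ μ (Q t) (u t) x α β :=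
    (((hT.sub ((smoothMatField_gradU hI hu α β).const_mul μ)).add hG).sub
      (((hQ.mul hL).sub (hL.mul hQ)) α β)).sub ((hQ α β).const_mul κ)
  exact h1.contField.add ((hQ.frob.mul (hQ.molField a b c hI α β).contField).const_mul lam)

/-- The entrywise time derivative of a matrix field. -/
def mdt (Q : ℝ → E d → Mat d) (t : ℝ) (x : E d) : Mat d :=
  Matrix.of fun i j => deriv (fun s => Q s x i j) t

lemma smoothMatField_mdt (hI : IsOpen I) (hQ : SmoothMatField I Q) :
    SmoothMatField I (mdt Q) := fun i j => (hQ i j).timeDeriv hI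

lemma dt_energyDensity (a b c : ℝ) (hI : IsOpen I) (hQ : SmoothMatField I Q)
    (hu : ∀ α, SmoothField I fun t x => u t x α) {t : ℝ} (ht : t ∈ I) (x : E d)
    (hs : (Q t x).IsSymm) :
    dt (fun s => energyDensity a b c (Q s) (u s)) t x
      = ∑ α, dt (fun s y => u s y α) t x * u t x α + elasticRate a b c (Q t) (mdt Q t) x := by
  have hI' := hI.uniqueDiffOn (𝕜 := ℝ)
  have h1 : HasDerivAt (fun s => ∑ α, u s x α ^ 2)
      (2 * ∑ α, dt (fun s y => u s y α) t x * u t x α) t := by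
    refine (HasDerivAt.fun_sum fun α _ => ((hu α).hasDerivAt hI ht x).pow 2).congr_deriv ?_
    rw [Finset.mul_sum]
    exact Finset.sum_congr rfl fun α _ => by push_cast; ring
  have h2 : HasDerivAt (fun s => gradQSq (Q s) x)
      (2 * ∑ k, dot (mpd k (Q t) x) (mpd k (mdt Q t) x)) t := by
    have e : (2 * ∑ k, dot (mpd k (Q t) x) (mpd k (mdt Q t) x))
        = ∑ i, ∑ j, ∑ k, 2 * pd k (fun y => Q t y i j) x * pd k (fun y => mdt Q t y i j) x := by
      simp only [dot, mpd, Matrix.of_apply, Finset.mul_sum, ← mul_assoc]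
      rw [Finset.sum_comm]
      exact Finset.sum_congr rfl fun i _ => Finset.sum_comm
    rw [e]
    unfold gradQSq
    refine HasDerivAt.fun_sum fun i _ => HasDerivAt.fun_sum fun j _ =>
      HasDerivAt.fun_sum fun k _ => ?_
    refine ((((hQ i j).pderiv hI' k).hasDerivAt hI ht x).pow 2).congr_deriv ?_
    have := (hQ i j).dt_pd hI ht k x
    rw [this]
    push_cast
    rw [pow_one]
    rfl
  have hQd : ∀ i j, HasDerivAt (fun s => Q s x i j) (mdt Q t x i j) t := fun i j =>
    (hQ i j).hasDerivAt hI ht x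
  have h3 := hasDerivAt_bulk a b c (A := fun s => Q s x) hQd hs
  have h4 : HasDerivAt (fun s => frobSq (Q s x)) (2 * dot (Q t x) (mdt Q t x)) t := by
    simp only [frobSq, dot, Finset.mul_sum]
    refine HasDerivAt.fun_sum fun i _ => HasDerivAt.fun_sum fun j _ => ?_
    refine ((hQd i j).pow 2).congr_deriv ?_
    push_cast; ring
  have h5 := (((h1.const_mul (1 / 2)).add (h2.const_mul (1 / 2))).add h3).add
    (h4.const_mul (coerc a b c / 2))
  refine h5.deriv.trans ?_
  rw [elasticRate]
  ring

lemma trace_mdt (hI : IsOpen I) (hQ : SmoothMatField I Q)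
    (h0 : ∀ t ∈ I, ∀ x, (Q t x).trace = 0) {t : ℝ} (ht : t ∈ I) (x : E d) :
    (mdt Q t x).trace = 0 := by
  have h1 := hasDerivAt_trace (A := fun s => Q s x) (A' := mdt Q t x)
    fun i j => (hQ i j).hasDerivAt hI ht x
  have h2 : HasDerivAt (fun s => (Q s x).trace) 0 t := by
    refine (hasDerivAt_const t (0 : ℝ)).congr_of_eventuallyEq ?_
    filter_upwards [hI.mem_nhds ht] with s hs using h0 s hs x
  exact h1.unique h2

end VelocityFields

/-! ### The differential inequality for the localized energy -/

section Solution

variable {a b c κ μ lam Γ : ℝ} {T : EReal} {Q₀ : E d → Mat d} {u₀ : E d → E d}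
  {Q : ℝ → E d → Mat d} {u : ℝ → E d → E d} {S : ℝ}

lemma Ico_subset_timeInterval (hS : (S : EReal) < T) : Ico 0 S ⊆ timeInterval T := fun t ht =>
  ⟨ht.1, lt_trans (by exact_mod_cast ht.2) hS⟩

namespace IsSmoothSolution

lemma smoothMatField (h : IsSmoothSolution a b c κ μ lam Γ T Q₀ u₀ Q u) :
    SmoothMatField (timeInterval T) Q := h.smooth_Q

lemma smoothField_vel (h : IsSmoothSolution a b c κ μ lam Γ T Q₀ u₀ Q u) (α : Fin d) :
    SmoothField (timeInterval T) fun t x => u t x α :=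
  (contDiffOn_euclidean.1 h.smooth_u) α

lemma exists_norm_le (h : IsSmoothSolution a b c κ μ lam Γ T Q₀ u₀ Q u) (hS0 : 0 ≤ S)
    (hS : (S : EReal) < T) : ∃ N : ℝ, 0 ≤ N ∧ ∀ t ∈ Ioo 0 S,
      h1Sq (Q t) ≤ ENNReal.ofReal (N ^ 2) ∧ l2Sq (u t) ≤ ENNReal.ofReal (N ^ 2) := by
  have hE := h.energyClass S ⟨hS0, hS⟩
  obtain ⟨K1, hK1⟩ := hE.Q_LinftyH1
  obtain ⟨K2, hK2⟩ := hE.u_LinftyL2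
  have hsub : Ioo 0 S ⊆ timeInterval T := Ioo_subset_Ico_self.trans (Ico_subset_timeInterval hS)
  have hI : UniqueDiffOn ℝ (Ioo 0 S) := isOpen_Ioo.uniqueDiffOn
  have hQ := h.smoothMatField.mono hsub
  have hu := fun α => (h.smoothField_vel α).mono hsub
  have hle : ∀ K ∈ ({K1, K2} : Set ℝ), K ≤ (1 + |K1| + |K2|) ^ 2 := by
    intro K hK
    have h1 := le_abs_self K1
    have h2 := le_abs_self K2
    have h3 := abs_nonneg K1
    have h4 := abs_nonneg K2
    rcases hK with rfl | rfl <;> nlinarith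
  refine ⟨1 + |K1| + |K2|, by positivity, fun t ht => ⟨?_, ?_⟩⟩
  · refine (lintegral_le_of_ae_le isOpen_Ioo (hQ.frobSq.add (hQ.gradQSq hI)).contField hK1 ht).trans
      (ENNReal.ofReal_le_ofReal (hle K1 (by simp)))
  · simp only [l2Sq_eq] at hK2 ⊢
    exact (lintegral_le_of_ae_le isOpen_Ioo (smoothField_velSq hu).contField hK2 ht).trans
      (ENNReal.ofReal_le_ofReal (hle K2 (by simp)))

lemma aemeasurable_h2Sq (h : IsSmoothSolution a b c κ μ lam Γ T Q₀ u₀ Q u)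
    (hS : (S : EReal) < T) :
    AEMeasurable (fun t => h2Sq (Q t)) (volume.restrict (Ioo 0 S)) := by
  have hQ := h.smoothMatField.mono (Ioo_subset_Ico_self.trans (Ico_subset_timeInterval hS))
  have hI : UniqueDiffOn ℝ (Ioo 0 S) := isOpen_Ioo.uniqueDiffOn
  exact aemeasurable_lintegral measurableSet_Ioo
    ((hQ.frobSq.add (hQ.gradQSq hI)).add (hQ.hessQSq hI)).contField

lemma aemeasurable_l2Sq (h : IsSmoothSolution a b c κ μ lam Γ T Q₀ u₀ Q u)
    (hS : (S : EReal) < T) :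
    AEMeasurable (fun t => l2Sq (u t)) (volume.restrict (Ioo 0 S)) := by
  have hu := fun α => (h.smoothField_vel α).mono
    (Ioo_subset_Ico_self.trans (Ico_subset_timeInterval hS))
  simp only [l2Sq_eq]
  exact aemeasurable_lintegral measurableSet_Ioo (smoothField_velSq hu).contField

lemma aemeasurable_gradL2Sq (h : IsSmoothSolution a b c κ μ lam Γ T Q₀ u₀ Q u)
    (hS : (S : EReal) < T) :
    AEMeasurable (fun t => gradL2Sq (u t)) (volume.restrict (Ioo 0 S)) := by
  have hu := fun α => (h.smoothField_vel α).mono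
    (Ioo_subset_Ico_self.trans (Ico_subset_timeInterval hS))
  exact aemeasurable_lintegral measurableSet_Ioo
    (smoothMatField_gradU isOpen_Ioo.uniqueDiffOn hu).frobSq.contField

lemma lintegral_totalSq_lt_top (h : IsSmoothSolution a b c κ μ lam Γ T Q₀ u₀ Q u) (hS0 : 0 ≤ S)
    (hS : (S : EReal) < T) : ∫⁻ t in Ioo 0 S, totalSq (Q t) (u t) < ⊤ := by
  have hE := h.energyClass S ⟨hS0, hS⟩
  have e : ∀ t, totalSq (Q t) (u t) = 1 + (h2Sq (Q t) + (l2Sq (u t) + gradL2Sq (u t))) := fun t => by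
    rw [totalSq]; ring
  simp only [e]
  rw [lintegral_add_left measurable_const, lintegral_add_left' (h.aemeasurable_h2Sq hS)]
  refine ENNReal.add_lt_top.2 ⟨?_, ENNReal.add_lt_top.2 ⟨hE.Q_L2H2, hE.u_L2H1⟩⟩
  simp

lemma aemeasurable_totalSq (h : IsSmoothSolution a b c κ μ lam Γ T Q₀ u₀ Q u)
    (hS : (S : EReal) < T) :
    AEMeasurable (fun t => totalSq (Q t) (u t)) (volume.restrict (Ioo 0 S)) :=
  ((aemeasurable_const.add (h.aemeasurable_h2Sq hS)).add (h.aemeasurable_l2Sq hS)).add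
    (h.aemeasurable_gradL2Sq hS)

/-- There is a time-integrable bound of the fluxes in `L²`. -/
lemma exists_dominant_bound (h : IsSmoothSolution a b c κ μ lam Γ T Q₀ u₀ Q u)
    (hd : d = 2 ∨ d = 3) (hS0 : 0 ≤ S) (hS : (S : EReal) < T) :
    ∃ A : ℝ → ℝ, (∀ t, 0 ≤ A t) ∧ IntegrableOn A (Ioo 0 S) ∧
      ∀ᵐ t ∂(volume.restrict (Ioo 0 S)),
        ∫⁻ x, ENNReal.ofReal (dominant (Q t) (u t) x ^ 2) ≤ ENNReal.ofReal (A t ^ 2) := by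
  obtain ⟨C, hC⟩ := exists_lintegral_dominant_sq_le hd
  obtain ⟨N, hN, hNb⟩ := h.exists_norm_le hS0 hS
  have hfin := h.lintegral_totalSq_lt_top hS0 hS
  have hm := h.aemeasurable_totalSq hS
  refine ⟨fun t => √C * (1 + N ^ 2) * (totalSq (Q t) (u t)).toReal, fun t => by positivity,
    (integrable_toReal_of_lintegral_ne_top hm hfin.ne).const_mul _, ?_⟩
  have hsub : Ioo 0 S ⊆ timeInterval T := Ioo_subset_Ico_self.trans (Ico_subset_timeInterval hS)
  filter_upwards [ae_lt_top' hm hfin.ne, ae_restrict_mem measurableSet_Ioo] with t ht htI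
  refine (hC (Q t) (u t) (h.smoothMatField.slice (hsub htI))
    (fun α => (h.smoothField_vel α).slice (hsub htI))).trans ?_
  rw [mul_pow, mul_pow, Real.sq_sqrt C.coe_nonneg, ENNReal.ofReal_mul (by positivity),
    ENNReal.ofReal_mul (by positivity), ENNReal.ofReal_pow (by positivity),
    ENNReal.ofReal_pow ENNReal.toReal_nonneg, ENNReal.ofReal_toReal ht.ne, ENNReal.ofReal_coe_nnreal,
    ENNReal.ofReal_add zero_le_one (by positivity), ENNReal.ofReal_one]
  gcongr
  exact (hNb t htI).1

end IsSmoothSolution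

namespace IsSmoothSolution

/-- The localized energy `∫ e φ` satisfies a linear differential inequality with dissipation, up to
an error proportional to the size `δ` of `∇φ`. -/
lemma exists_energy_inequality (h : IsSmoothSolution a b c κ μ lam Γ T Q₀ u₀ Q u)
    (hd : d = 2 ∨ d = 3) (hc : 0 < c) (hμ : 0 < μ) (hΓ : 0 < Γ) (hS0 : 0 ≤ S)
    (hS : (S : EReal) < T) :
    ∃ A : ℝ → ℝ, IntegrableOn A (Ioo 0 S) ∧ (∀ t, 0 ≤ A t) ∧
      ∀ᵐ t ∂(volume.restrict (Ioo 0 S)), ∀ (φ : E d → ℝ) (δ : ℝ), IsTest φ → (∀ x, 0 ≤ φ x) →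
        0 ≤ δ → (∀ k x, |pd k φ x| ≤ δ) →
        ∫ x, dt (fun s => energyDensity a b c (Q s) (u s)) t x * φ x
          ≤ rate κ μ lam Γ (coerc a b c) c * (∫ x, energyDensity a b c (Q t) (u t) x * φ x)
            - μ / 2 * (∫ x, frobSq (gradU (u t) x) * φ x) + δ * A t := by
  obtain ⟨A, hA0, hAi, hA⟩ := h.exists_dominant_bound hd hS0 hS
  obtain ⟨N, hN, hNb⟩ := h.exists_norm_le hS0 hS
  obtain ⟨CF, hCF, hF⟩ := exists_frob_stress_le d a b c κ μ lam
  obtain ⟨C, hC, hslice⟩ := exists_slice_inequality d (a := a) (b := b) (κ := κ) (lam := lam) hc hμ hΓ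
  have hsub : Ioo 0 S ⊆ timeInterval T := Ioo_subset_Ico_self.trans (Ico_subset_timeInterval hS)
  have hI : UniqueDiffOn ℝ (Ioo 0 S) := isOpen_Ioo.uniqueDiffOn
  have hQ := h.smoothMatField.mono hsub
  have hu := fun α => (h.smoothField_vel α).mono hsub
  obtain ⟨P, hP⟩ := h.eq_u
  have hmom := momentum_estimate (d := d) (by omega) (S := S) (u := fun α t x => u t x α)
    (F := fun α β t x => stress a b c κ μ lam (Q t) (u t) x α β) (a := fun t => CF * A t) hu
    (contField_stress a b c κ μ lam hI hQ hu) (fun t => mul_nonneg hCF (hA0 t)) (hAi.const_mul CF)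
    (fun α β => by
      filter_upwards [hA, ae_restrict_mem measurableSet_Ioo] with t ht htI
      calc ∫⁻ x, ‖stress a b c κ μ lam (Q t) (u t) x α β‖ₑ ^ 2
          ≤ ∫⁻ x, ENNReal.ofReal (CF ^ 2) * ENNReal.ofReal (dominant (Q t) (u t) x ^ 2) := by
            refine lintegral_mono fun x => ?_
            rw [← ofReal_pow_two, ← ENNReal.ofReal_mul (sq_nonneg _), ← mul_pow]
            refine ENNReal.ofReal_le_ofReal ?_
            rw [← sq_abs]
            gcongr
            exact (abs_apply_le_frob _ _ _).trans (hF _ _ _ (h.symm_Q t (hsub htI) x))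
        _ = ENNReal.ofReal (CF ^ 2) * ∫⁻ x, ENNReal.ofReal (dominant (Q t) (u t) x ^ 2) :=
            lintegral_const_mul' _ _ ENNReal.ofReal_ne_top
        _ ≤ ENNReal.ofReal (CF ^ 2) * ENNReal.ofReal (A t ^ 2) := by gcongr
        _ = _ := by
            rw [← ENNReal.ofReal_mul (sq_nonneg _), ← mul_pow,
              ENNReal.ofReal_pow (mul_nonneg hCF (hA0 t))])
    (fun α t ht => memLp_two_of_lintegral_le ((hu α).slice ht).continuous (r := N ^ 2) (by
      refine le_trans (lintegral_mono fun x => ENNReal.ofReal_le_ofReal ?_)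
        (l2Sq_eq (u t) ▸ (hNb t ht).2)
      rw [← sq_abs]
      exact (pow_le_pow_left₀ (abs_nonneg _) (abs_vel_le (u t) x α) 2).trans_eq
        (Real.sq_sqrt (velSq_nonneg _ _))))
    (fun t ht x => h.div_u t (hsub ht) ht.1 x)
    (fun t ht w hw => weak_momentum (hQ.slice ht) (fun α => (hu α).slice ht)
      (h.div_u t (hsub ht) ht.1) (hP t (hsub ht) ht.1).1 (hP t (hsub ht) ht.1).2 hw)
  refine ⟨fun t => (d ^ 2 * CF * (d * N) + C * N) * A t, hAi.const_mul _,
    fun t => mul_nonneg (by positivity) (hA0 t), ?_⟩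
  filter_upwards [hA, ae_restrict_mem measurableSet_Ioo, hmom] with t ht htI hm φ δ hφ hφ0 hδ hφδ
  have sQ := hQ.slice htI
  have su := fun α => (hu α).slice htI
  have sR := (smoothMatField_mdt isOpen_Ioo hQ).slice htI
  have hsym := h.symm_Q t (hsub htI)
  have hdiv := h.div_u t (hsub htI) htI.1
  have hs := hslice sQ sR hsym (h.trace_Q t (hsub htI))
    (trace_mdt isOpen_Ioo hQ (fun t ht => h.trace_Q t (hsub ht)) htI) su hdiv
    (h.eq_Q t (hsub htI) htI.1) hN (hA0 t) hδ (hNb t htI).2 (hNb t htI).1 ht hφ hφ0 hφδ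
  have hm' := (abs_le.1 (hm (fun α x => φ x * u t x α) fun α => hφ.mul_left (su α))).2
  have hsq := sqrt_integral_div_sq_le su hdiv hN (hNb t htI).2 hφ hδ hφδ
  have hm'' := hm'.trans (mul_le_mul_of_nonneg_left hsq
    (mul_nonneg (by positivity) (mul_nonneg hCF (hA0 t))))
  have cdt : ∀ α, Continuous (dt (fun s y => u s y α) t) := fun α =>
    (((hu α).timeDeriv isOpen_Ioo).slice htI).continuous
  have iU : ∀ α, Integrable fun x => dt (fun s y => u s y α) t x * (φ x * u t x α) := fun α => by
    have := hφ.integrable_mul ((cdt α).mul (su α).continuous)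
    refine this.congr (Filter.Eventually.of_forall fun x => ?_)
    simp only [Pi.mul_apply]
    ring
  have iE := hφ.integrable_mul (continuous_elasticRate a b c sQ sR)
  have hsplit : ∫ x, dt (fun s => energyDensity a b c (Q s) (u s)) t x * φ x
      = (∑ α, ∫ x, dt (fun s y => u s y α) t x * (φ x * u t x α))
        + ∫ x, φ x * elasticRate a b c (Q t) (mdt Q t) x := by
    rw [← integral_finsetSum _ fun α _ => iU α,
      ← integral_add (integrable_finsetSum _ fun α _ => iU α) iE]
    refine integral_congr_ae (Filter.Eventually.of_forall fun x => ?_)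
    simp only
    rw [dt_energyDensity a b c isOpen_Ioo hQ hu htI x (hsym x), add_mul, Finset.sum_mul]
    congr 1
    · exact Finset.sum_congr rfl fun α _ => by ring
    · ring
  rw [hsplit]
  simp only [mul_comm _ (φ _)] at hs ⊢
  linarith

/-- Grönwall's inequality for the localized energy. -/
lemma exists_gronwall (h : IsSmoothSolution a b c κ μ lam Γ T Q₀ u₀ Q u)
    (hd : d = 2 ∨ d = 3) (hc : 0 < c) (hμ : 0 < μ) (hΓ : 0 < Γ) {t : ℝ} (ht0 : 0 < t)
    (htS : t < S) (hS : (S : EReal) < T) :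
    ∃ M : ℝ, ∀ (φ : E d → ℝ) (δ : ℝ), IsTest φ → (∀ x, 0 ≤ φ x) →
        0 ≤ δ → (∀ k x, |pd k φ x| ≤ δ) →
        (∫ x, energyDensity a b c (Q t) (u t) x * φ x)
          + μ / 2 * (∫ s in 0..t, ∫ x, frobSq (gradU (u s) x) * φ x)
        ≤ Real.exp (rate κ μ lam Γ (coerc a b c) c * t)
          * ((∫ x, energyDensity a b c (Q 0) (u 0) x * φ x) + δ * M) := by
  obtain ⟨A, hAi, hA0, hA⟩ := h.exists_energy_inequality hd hc hμ hΓ (ht0.trans htS).le hS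
  refine ⟨∫ s in 0..t, A s, fun φ δ hφ hφ0 hδ hφδ => ?_⟩
  set r := rate κ μ lam Γ (coerc a b c) c with hr
  have hr0 : 0 ≤ r := by unfold r rate; positivity
  have hsub := Ico_subset_timeInterval hS
  have hI : UniqueDiffOn ℝ (Ico 0 S) := uniqueDiffOn_Ico 0 S
  have hQ := h.smoothMatField.mono hsub
  have hu := fun α => (h.smoothField_vel α).mono hsub
  have he := smoothField_energyDensity a b c hI hQ hu
  have hg := (smoothMatField_gradU hI hu).frobSq
  set y : ℝ → ℝ := fun s => ∫ x, energyDensity a b c (Q s) (u s) x * φ x with hy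
  set g : ℝ → ℝ := fun s => ∫ x, frobSq (gradU (u s) x) * φ x with hgdef
  have hIcc : Icc 0 t ⊆ Ico 0 S := fun s hs => ⟨hs.1, hs.2.trans_lt htS⟩
  have cy : ContinuousOn y (Icc 0 t) := (he.contField.continuousOn_integral hφ).mono hIcc
  have cg : ContinuousOn g (Icc 0 t) := (hg.contField.continuousOn_integral hφ).mono hIcc
  have hg0 : ∀ s, 0 ≤ g s := fun s =>
    integral_nonneg fun x => mul_nonneg (frobSq_nonneg _) (hφ0 x)
  have hy' : ∀ s ∈ Ioo 0 t, HasDerivAt y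
      (∫ x, dt (fun s => energyDensity a b c (Q s) (u s)) s x * φ x) s := fun s hs =>
    SmoothField.hasDerivAt_integral isOpen_Ioo (he.mono Ioo_subset_Ico_self) hφ
      ⟨hs.1, hs.2.trans htS⟩
  set y' : ℝ → ℝ := fun s => ∫ x, dt (fun s => energyDensity a b c (Q s) (u s)) s x * φ x with hy'def
  set z : ℝ → ℝ := fun s => Real.exp (-(r * s)) * y s with hz
  set z' : ℝ → ℝ := fun s => Real.exp (-(r * s)) * (y' s - r * y s) with hz'
  have hzd : ∀ s ∈ Ioo 0 t, HasDerivAt z (z' s) s := by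
    intro s hs
    have h1 : HasDerivAt (fun s => Real.exp (-(r * s))) (Real.exp (-(r * s)) * -r) s := by
      simpa using (((hasDerivAt_id s).const_mul r).neg).exp
    refine (h1.mul (hy' s hs)).congr_deriv ?_
    simp only [hz']
    ring
  set ψ : ℝ → ℝ := fun s => -(μ / 2 * Real.exp (-(r * t)) * g s) + δ * A s with hψ
  have hAint : IntegrableOn A (Icc 0 t) := by
    rw [integrableOn_Icc_iff_integrableOn_Ioc]
    exact hAi.mono_set fun s hs => ⟨hs.1, hs.2.trans_lt htS⟩
  have hgint : IntegrableOn g (Icc 0 t) := cg.integrableOn_Icc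
  have hψint : IntegrableOn ψ (Icc 0 t) := (hgint.const_mul _).neg.add (hAint.const_mul δ)
  -- the inequality holds for almost every time only, so the bound is modified on a null set
  classical
  set ψ' : ℝ → ℝ := fun s => if z' s ≤ ψ s then ψ s else z' s with hψ'
  have hae : ∀ᵐ s ∂(volume.restrict (Icc 0 t)), ψ' s = ψ s := by
    rw [← Measure.restrict_congr_set (Ioo_ae_eq_Icc (μ := volume) (a := (0 : ℝ)) (b := t))]
    filter_upwards [ae_restrict_of_ae_restrict_of_subset (Ioo_subset_Ioo_right htS.le) hA,
      ae_restrict_mem measurableSet_Ioo] with s hs hsI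
    have h1 := hs φ δ hφ hφ0 hδ hφδ
    refine if_pos ?_
    have h2 : Real.exp (-(r * t)) ≤ Real.exp (-(r * s)) :=
      Real.exp_le_exp.2 (neg_le_neg (mul_le_mul_of_nonneg_left hsI.2.le hr0))
    have h3 : Real.exp (-(r * s)) ≤ 1 :=
      Real.exp_le_one_iff.2 (neg_nonpos.2 (mul_nonneg hr0 hsI.1.le))
    calc z' s ≤ Real.exp (-(r * s)) * (-(μ / 2 * g s) + δ * A s) :=
          mul_le_mul_of_nonneg_left (by linarith) (Real.exp_pos _).le
      _ = -(Real.exp (-(r * s)) * (μ / 2 * g s)) + Real.exp (-(r * s)) * (δ * A s) := by ring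
      _ ≤ -(Real.exp (-(r * t)) * (μ / 2 * g s)) + 1 * (δ * A s) :=
          add_le_add (neg_le_neg (mul_le_mul_of_nonneg_right h2
            (mul_nonneg (by positivity) (hg0 s))))
            (mul_le_mul_of_nonneg_right h3 (mul_nonneg hδ (hA0 s)))
      _ = ψ s := by simp only [hψ]; ring
  have hFTC : z t - z 0 ≤ ∫ s in 0..t, ψ' s := by
    refine intervalIntegral.sub_le_integral_of_hasDeriv_right_of_le ht0.le
      (ContinuousOn.mul (by fun_prop) cy) (fun s hs => (hzd s hs).hasDerivWithinAt)
      (hψint.congr (hae.mono fun s hs => hs.symm)) fun s _ => ?_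
    simp only [hψ']
    split_ifs with hif
    · exact hif
    · exact le_rfl
  have hint : ∫ s in 0..t, ψ' s
      = -(μ / 2 * Real.exp (-(r * t)) * ∫ s in 0..t, g s) + δ * ∫ s in 0..t, A s := by
    have e1 : ∫ s in 0..t, ψ' s = ∫ s in 0..t, ψ s := by
      rw [intervalIntegral.integral_of_le ht0.le, intervalIntegral.integral_of_le ht0.le,
        ← integral_Icc_eq_integral_Ioc, ← integral_Icc_eq_integral_Ioc]
      exact integral_congr_ae hae
    have i1 : IntervalIntegrable g volume 0 t :=
      (intervalIntegrable_iff_integrableOn_Icc_of_le ht0.le).2 hgint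
    have i2 : IntervalIntegrable A volume 0 t :=
      (intervalIntegrable_iff_integrableOn_Icc_of_le ht0.le).2 hAint
    have i3 : IntervalIntegrable (fun s => -(μ / 2 * Real.exp (-(r * t)) * g s)) volume 0 t :=
      (i1.const_mul _).neg
    rw [e1]
    simp only [hψ]
    rw [intervalIntegral.integral_add i3 (i2.const_mul _), intervalIntegral.integral_neg, intervalIntegral.integral_const_mul,
      intervalIntegral.integral_const_mul]
  rw [hint] at hFTC
  have hz0 : z 0 = y 0 := by simp [hz]
  have hexp : Real.exp (r * t) * Real.exp (-(r * t)) = 1 := by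
    rw [← Real.exp_add, add_neg_cancel, Real.exp_zero]
  have hmul := mul_le_mul_of_nonneg_left hFTC (Real.exp_pos (r * t)).le
  have e2 : Real.exp (r * t) * (z t - z 0) = y t - Real.exp (r * t) * y 0 := by
    rw [hz0]; simp only [hz]
    linear_combination y t * hexp
  have e3 : Real.exp (r * t) * (-(μ / 2 * Real.exp (-(r * t)) * ∫ s in 0..t, g s)
      + δ * ∫ s in 0..t, A s) = -(μ / 2 * ∫ s in 0..t, g s)
        + Real.exp (r * t) * (δ * ∫ s in 0..t, A s) := by
    linear_combination (-(μ / 2 * ∫ s in 0..t, g s)) * hexp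
  rw [e2, e3] at hmul
  change y t + μ / 2 * (∫ s in 0..t, g s) ≤ Real.exp (r * t) * (y 0 + δ * ∫ s in 0..t, A s)
  linarith

end IsSmoothSolution

/-! ### Removal of the cutoff -/

lemma liminf_add_liminf_le {A B C : ℕ → ℝ≥0∞} {L : ℝ≥0∞} (h : ∀ n, A n + B n ≤ C n)
    (hC : Filter.Tendsto C Filter.atTop (nhds L)) :
    Filter.liminf A Filter.atTop + Filter.liminf B Filter.atTop ≤ L := by
  have mono : ∀ f : ℕ → ℝ≥0∞, Monotone fun n => ⨅ k ≥ n, f k := fun f m n hmn =>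
    le_iInf₂ fun k hk => iInf₂_le k (le_trans hmn hk)
  rw [Filter.liminf_eq_iSup_iInf_of_nat, Filter.liminf_eq_iSup_iInf_of_nat,
    ENNReal.iSup_add_iSup_of_monotone (mono A) (mono B)]
  refine iSup_le fun n => ge_of_tendsto hC ?_
  filter_upwards [Filter.eventually_ge_atTop n] with k hk
  exact (add_le_add (iInf₂_le k hk) (iInf₂_le k hk)).trans (h k)

lemma lintegral_le_liminf_cutoff {f : E d → ℝ} (hf : Continuous f) :
    ∫⁻ x, ENNReal.ofReal (f x)
      ≤ Filter.liminf (fun n : ℕ => ∫⁻ x, ENNReal.ofReal (f x * cutoff ((n : ℝ) + 1) x))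
        Filter.atTop := by
  refine le_trans (le_of_eq (lintegral_congr fun x => Eq.symm ?_)) (lintegral_liminf_le fun n =>
    (hf.mul (cutoff_isTest (by positivity)).continuous).measurable.ennreal_ofReal)
  have h1 := (tendsto_cutoff x).const_mul (f x)
  rw [mul_one] at h1
  exact (ENNReal.tendsto_ofReal h1).liminf_eq

lemma ofReal_integral_mul_test {f φ : E d → ℝ} (hf : Continuous f) (hφ : IsTest φ)
    (h0 : ∀ x, 0 ≤ f x) (hφ0 : ∀ x, 0 ≤ φ x) :
    ENNReal.ofReal (∫ x, f x * φ x) = ∫⁻ x, ENNReal.ofReal (f x * φ x) :=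
  ofReal_integral_eq_lintegral_ofReal (by simpa only [mul_comm] using hφ.integrable_mul hf)
    (Filter.Eventually.of_forall fun x => mul_nonneg (h0 x) (hφ0 x))

lemma contField_const_time {I : Set ℝ} {φ : E d → ℝ} (hφ : Continuous φ) :
    ContField I fun _ => φ := (hφ.comp continuous_snd).continuousOn

namespace IsSmoothSolution

/-- The global energy inequality. -/
lemma energy_le (h : IsSmoothSolution a b c κ μ lam Γ T Q₀ u₀ Q u)
    (hd : d = 2 ∨ d = 3) (hc : 0 < c) (hμ : 0 < μ) (hΓ : 0 < Γ) {t : ℝ} (ht0 : 0 < t)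
    (htT : (t : EReal) < T) :
    ENNReal.ofReal (1 / 2) * l2Sq (u t) + ENNReal.ofReal (1 / 2) * h1Sq (Q t)
        + ENNReal.ofReal (μ / 2) * ∫⁻ s in Ioo 0 t, gradL2Sq (u s)
      ≤ ENNReal.ofReal (Real.exp (rate κ μ lam Γ (coerc a b c) c * t))
        * ∫⁻ x, ENNReal.ofReal (energyDensity a b c Q₀ u₀ x) := by
  obtain ⟨S, htS, hS⟩ := EReal.lt_iff_exists_real_btwn.1 htT
  replace htS : t < S := by exact_mod_cast htS
  obtain ⟨M, hM⟩ := h.exists_gronwall hd hc hμ hΓ ht0 htS hS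
  obtain ⟨Cφ, hCφ, hφ'⟩ := exists_pd_cutoff_le d
  have hsub := Ico_subset_timeInterval hS
  have hI : UniqueDiffOn ℝ (Ico 0 S) := uniqueDiffOn_Ico 0 S
  have hQ := h.smoothMatField.mono hsub
  have hu := fun α => (h.smoothField_vel α).mono hsub
  have htI : t ∈ Ico 0 S := ⟨ht0.le, htS⟩
  have h0I : (0 : ℝ) ∈ Ico 0 S := ⟨le_rfl, ht0.trans htS⟩
  have hG : SmoothField (Ico 0 S) fun s x => μ / 2 * frobSq (gradU (u s) x) :=
    (smoothMatField_gradU hI hu).frobSq.const_mul (μ / 2)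
  have hG0 : ∀ s x, 0 ≤ μ / 2 * frobSq (gradU (u s) x) := fun s x =>
    mul_nonneg (by positivity) (frobSq_nonneg _)
  set e1 : E d → ℝ := fun x => 1 / 2 * velSq (u t) x + 1 / 2 * (frobSq (Q t x) + gradQSq (Q t) x)
    with he1
  have ce1 : Continuous e1 := by
    have h1 := continuous_velSq fun α => (hu α).slice htI
    have h2 := (contDiff_frobSq (hQ.slice htI)).continuous
    have h3 := (contDiff_gradQSq (hQ.slice htI)).continuous
    fun_prop
  have he10 : ∀ x, 0 ≤ e1 x := fun x => by
    have h1 := velSq_nonneg (u t) x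
    have h2 := frobSq_nonneg (Q t x)
    have h3 := gradQSq_nonneg (Q t) x
    positivity
  have hle : ∀ {s : ℝ}, s ∈ Ico 0 S → ∀ x, 1 / 2 * velSq (u s) x
      + 1 / 2 * (frobSq (Q s x) + gradQSq (Q s) x) ≤ energyDensity a b c (Q s) (u s) x := by
    intro s hs x
    have h1 := le_energyDensity a b hc (u s) (h.symm_Q s (hsub hs) x)
    have h2 : 0 ≤ c / 8 * frob (Q s x) ^ 4 := by positivity
    have h3 : velSq (u s) x = ∑ α, u s x α ^ 2 := rfl
    linarith
  have hpos0 : ∀ x, 0 ≤ energyDensity a b c (Q 0) (u 0) x := fun x => by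
    refine le_trans ?_ (hle h0I x)
    have h1 := velSq_nonneg (u 0) x
    have h2 := frobSq_nonneg (Q 0 x)
    have h3 := gradQSq_nonneg (Q 0) x
    positivity
  have hQ0 : Q 0 = Q₀ := funext h.init_Q
  have hu0 : u 0 = u₀ := funext h.init_u
  set r := rate κ μ lam Γ (coerc a b c) c
  set D := ∫⁻ x, ENNReal.ofReal (energyDensity a b c Q₀ u₀ x) with hD
  -- the inequality with the cutoff of radius `n + 1`
  have key : ∀ n : ℕ, (∫⁻ x, ENNReal.ofReal (e1 x * cutoff ((n : ℝ) + 1) x))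
      + ∫⁻ s in Ioo 0 t, ∫⁻ x, ENNReal.ofReal
          (μ / 2 * frobSq (gradU (u s) x) * cutoff ((n : ℝ) + 1) x)
      ≤ ENNReal.ofReal (Real.exp (r * t)) * (D + ENNReal.ofReal (Cφ / ((n : ℝ) + 1) * M)) := by
    intro n
    have hn : (0 : ℝ) < (n : ℝ) + 1 := by positivity
    set φ : E d → ℝ := cutoff ((n : ℝ) + 1) with hφdef
    have hφ : IsTest φ := cutoff_isTest hn
    have hφ0 : ∀ x, 0 ≤ φ x := cutoff_nonneg _
    have hg := hM φ (Cφ / ((n : ℝ) + 1)) hφ hφ0 (by positivity) (hφ' _ hn)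
    have ce : ∀ {s : ℝ}, s ∈ Ico 0 S → Continuous (energyDensity a b c (Q s) (u s)) := fun hs =>
      (contDiff_energyDensity a b c (hQ.slice hs) fun α => (hu α).slice hs).continuous
    have p1 : ∫⁻ x, ENNReal.ofReal (e1 x * φ x)
        ≤ ENNReal.ofReal (∫ x, energyDensity a b c (Q t) (u t) x * φ x) := by
      rw [ofReal_integral_mul_test (ce htI) hφ (fun x => (he10 x).trans (hle htI x)) hφ0]
      exact lintegral_mono fun x => ENNReal.ofReal_le_ofReal
        (mul_le_mul_of_nonneg_right (hle htI x) (hφ0 x))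
    have hgc : ContinuousOn (fun s => ∫ x, μ / 2 * frobSq (gradU (u s) x) * φ x) (Icc 0 t) :=
      (hG.contField.continuousOn_integral hφ).mono fun s hs => ⟨hs.1, hs.2.trans_lt htS⟩
    have hgn : ∀ s, 0 ≤ ∫ x, μ / 2 * frobSq (gradU (u s) x) * φ x := fun s =>
      integral_nonneg fun x => mul_nonneg (hG0 s x) (hφ0 x)
    have p2 : ∫⁻ s in Ioo 0 t, ∫⁻ x, ENNReal.ofReal (μ / 2 * frobSq (gradU (u s) x) * φ x)
        = ENNReal.ofReal (μ / 2 * ∫ s in 0..t, ∫ x, frobSq (gradU (u s) x) * φ x) := by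
      have q1 : μ / 2 * (∫ s in 0..t, ∫ x, frobSq (gradU (u s) x) * φ x)
          = ∫ s in Ioo 0 t, ∫ x, μ / 2 * frobSq (gradU (u s) x) * φ x := by
        rw [← integral_Ioc_eq_integral_Ioo, ← intervalIntegral.integral_of_le ht0.le,
          ← intervalIntegral.integral_const_mul]
        simp only [mul_assoc, integral_const_mul]
      rw [q1, ofReal_integral_eq_lintegral_ofReal (hgc.integrableOn_Icc.mono_set Ioo_subset_Icc_self)
        (Filter.Eventually.of_forall hgn)]
      refine setLIntegral_congr_fun measurableSet_Ioo fun s hs => ?_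
      exact (ofReal_integral_mul_test (hG.slice ⟨hs.1.le, hs.2.trans htS⟩).continuous hφ (hG0 s)
        hφ0).symm
    have p3 : ENNReal.ofReal (∫ x, energyDensity a b c (Q 0) (u 0) x * φ x) ≤ D := by
      rw [ofReal_integral_mul_test (ce h0I) hφ hpos0 hφ0, hD, ← hQ0, ← hu0]
      exact lintegral_mono fun x => ENNReal.ofReal_le_ofReal
        (mul_le_of_le_one_right (hpos0 x) (cutoff_le_one _ x))
    have p4 : 0 ≤ ∫ x, energyDensity a b c (Q t) (u t) x * φ x :=
      integral_nonneg fun x => mul_nonneg ((he10 x).trans (hle htI x)) (hφ0 x)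
    have p5 : 0 ≤ μ / 2 * ∫ s in 0..t, ∫ x, frobSq (gradU (u s) x) * φ x :=
      mul_nonneg (by positivity) (intervalIntegral.integral_nonneg ht0.le fun s _ =>
        integral_nonneg fun x => mul_nonneg (frobSq_nonneg _) (hφ0 x))
    calc _ ≤ ENNReal.ofReal (∫ x, energyDensity a b c (Q t) (u t) x * φ x)
          + ENNReal.ofReal (μ / 2 * ∫ s in 0..t, ∫ x, frobSq (gradU (u s) x) * φ x) :=
          add_le_add p1 p2.le
      _ ≤ ENNReal.ofReal (Real.exp (r * t) * ((∫ x, energyDensity a b c (Q 0) (u 0) x * φ x)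
            + Cφ / ((n : ℝ) + 1) * M)) := by
          rw [← ENNReal.ofReal_add p4 p5]
          exact ENNReal.ofReal_le_ofReal hg
      _ ≤ _ := by
          rw [ENNReal.ofReal_mul (Real.exp_pos _).le]
          exact mul_le_mul_right (ENNReal.ofReal_add_le.trans (add_le_add_left p3 _)) _
  have hlim : Filter.Tendsto (fun n : ℕ => ENNReal.ofReal (Real.exp (r * t))
      * (D + ENNReal.ofReal (Cφ / ((n : ℝ) + 1) * M))) Filter.atTop
      (nhds (ENNReal.ofReal (Real.exp (r * t)) * (D + ENNReal.ofReal 0))) := by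
    refine ENNReal.Tendsto.const_mul ?_ (Or.inr ENNReal.ofReal_ne_top)
    refine tendsto_const_nhds.add (ENNReal.tendsto_ofReal ?_)
    have := (tendsto_one_div_add_atTop_nhds_zero_nat (𝕜 := ℝ)).const_mul (Cφ * M)
    rw [mul_zero] at this
    refine this.congr fun n => ?_
    ring
  have hfin := liminf_add_liminf_le key hlim
  rw [ENNReal.ofReal_zero, add_zero] at hfin
  refine le_trans (add_le_add ?_ ?_) hfin
  · refine le_trans (le_of_eq ?_) (lintegral_le_liminf_cutoff ce1)
    have m1 : Measurable fun x => ENNReal.ofReal (velSq (u t) x) :=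
      (continuous_velSq fun α => (hu α).slice htI).measurable.ennreal_ofReal
    rw [l2Sq_eq, h1Sq, ← lintegral_const_mul' _ _ ENNReal.ofReal_ne_top,
      ← lintegral_const_mul' _ _ ENNReal.ofReal_ne_top, ← lintegral_add_left (m1.const_mul _)]
    refine lintegral_congr fun x => ?_
    have h1 := velSq_nonneg (u t) x
    have h2 := frobSq_nonneg (Q t x)
    have h3 := gradQSq_nonneg (Q t) x
    rw [← ENNReal.ofReal_mul (by norm_num), ← ENNReal.ofReal_mul (by norm_num),
      ← ENNReal.ofReal_add (by positivity) (by positivity)]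
  · rw [← lintegral_const_mul' _ _ ENNReal.ofReal_ne_top]
    calc ∫⁻ s in Ioo 0 t, ENNReal.ofReal (μ / 2) * gradL2Sq (u s)
        ≤ ∫⁻ s in Ioo 0 t, Filter.liminf (fun n : ℕ => ∫⁻ x, ENNReal.ofReal
          (μ / 2 * frobSq (gradU (u s) x) * cutoff ((n : ℝ) + 1) x)) Filter.atTop := by
          refine setLIntegral_mono' measurableSet_Ioo fun s hs => ?_
          refine le_trans (le_of_eq ?_) (lintegral_le_liminf_cutoff
            (hG.slice ⟨hs.1.le, hs.2.trans htS⟩).continuous)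
          rw [gradL2Sq, ← lintegral_const_mul' _ _ ENNReal.ofReal_ne_top]
          exact lintegral_congr fun x => (ENNReal.ofReal_mul (by positivity)).symm
      _ ≤ _ := by
          refine lintegral_liminf_le' fun n => aemeasurable_lintegral measurableSet_Ioo ?_
          refine (hG.contField.mono fun s hs => ⟨hs.1.le, hs.2.trans htS⟩).mul
            (contField_const_time (cutoff_isTest (by positivity)).continuous)

end IsSmoothSolution

/-- The initial energy is controlled by the norms of the data. -/
lemma exists_initial_energy_le (hd : d = 2 ∨ d = 3) (a b : ℝ) (hc : 0 < c) (hQ₀ : SmoothMat Q₀)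
    (hu₀ : ∀ α, ContDiff ℝ ∞ fun x => u₀ x α) (hfin : h1Sq Q₀ < ⊤) :
    ∃ C : ℝ, 0 < C ∧ ((∀ x, (Q₀ x).IsSymm) →
      ∫⁻ x, ENNReal.ofReal (energyDensity a b c Q₀ u₀ x)
        ≤ ENNReal.ofReal C * (h1Sq Q₀ + l2Sq u₀)) := by
  obtain ⟨C1, hC1⟩ := exists_lintegral_frobSq_sq_le hd
  set Ce := 1 + |a| + |b| + |c| + coerc a b c with hCe
  have hcoerc : 0 ≤ coerc a b c := by unfold coerc; positivity
  have hCe1 : 0 ≤ Ce := by positivity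
  refine ⟨1 + Ce * (1 + C1 * (h1Sq Q₀).toReal), by positivity, fun hs => ?_⟩
  have cv := continuous_velSq hu₀
  have cq := (contDiff_frobSq hQ₀).continuous
  have cD := (contDiff_gradQSq hQ₀).continuous
  calc ∫⁻ x, ENNReal.ofReal (energyDensity a b c Q₀ u₀ x)
      ≤ ∫⁻ x, (ENNReal.ofReal (velSq u₀ x) + ENNReal.ofReal Ce *
          (ENNReal.ofReal (frobSq (Q₀ x) + gradQSq Q₀ x) + ENNReal.ofReal (frobSq (Q₀ x) ^ 2))) := by
        refine lintegral_mono fun x => ?_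
        have h1 := velSq_nonneg u₀ x
        have h2 := frobSq_nonneg (Q₀ x)
        have h3 := gradQSq_nonneg Q₀ x
        rw [← ENNReal.ofReal_add (by positivity) (by positivity), ← ENNReal.ofReal_mul hCe1,
          ← ENNReal.ofReal_add (by positivity) (by positivity)]
        refine ENNReal.ofReal_le_ofReal ((energyDensity_le a b hc u₀ (hs x)).trans (le_of_eq ?_))
        rw [← frob_sq, velSq]; ring
    _ = l2Sq u₀ + ENNReal.ofReal Ce * (h1Sq Q₀ + ∫⁻ x, ENNReal.ofReal (frobSq (Q₀ x) ^ 2)) := by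
        rw [lintegral_add_left cv.measurable.ennreal_ofReal,
          lintegral_const_mul' _ _ ENNReal.ofReal_ne_top,
          lintegral_add_left (show Continuous fun x => frobSq (Q₀ x) + gradQSq Q₀ x from
            cq.add cD).measurable.ennreal_ofReal, l2Sq_eq, h1Sq]
    _ ≤ l2Sq u₀ + ENNReal.ofReal Ce * (h1Sq Q₀ + C1 * h1Sq Q₀ ^ 2) := by
        gcongr; exact hC1 Q₀ hQ₀
    _ = l2Sq u₀ + ENNReal.ofReal Ce * (1 + C1 * h1Sq Q₀) * h1Sq Q₀ := by ring
    _ ≤ (1 + ENNReal.ofReal Ce * (1 + C1 * h1Sq Q₀)) * l2Sq u₀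
        + (1 + ENNReal.ofReal Ce * (1 + C1 * h1Sq Q₀)) * h1Sq Q₀ := by
        gcongr
        · exact le_mul_of_one_le_left' le_self_add
        · exact le_add_self
    _ = _ := by
        rw [ENNReal.ofReal_add zero_le_one (by positivity), ENNReal.ofReal_mul hCe1,
          ENNReal.ofReal_add zero_le_one (by positivity), ENNReal.ofReal_mul (by positivity),
          ENNReal.ofReal_toReal hfin.ne, ENNReal.ofReal_coe_nnreal, ENNReal.ofReal_one]
        ring

lemma h1Norm_sq (A : E d → Mat d) : h1Norm A ^ 2 = h1Sq A := by
  rw [h1Norm, ← ENNReal.rpow_natCast, ← ENNReal.rpow_mul]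
  norm_num

end Solution

end ActiveLC

end

theorem proposition2p2 (d : ℕ) (hd : d = 2 ∨ d = 3)
    (a b c κ μ lam Γ : ℝ) (hc : 0 < c) (hμ : 0 < μ) (hΓ : 0 < Γ)
    (Q₀ : ActiveLC.E d → ActiveLC.Mat d) (u₀ : ActiveLC.E d → ActiveLC.E d)
    (hQ₀ : ∀ i j, ContDiff ℝ ∞ (fun x => Q₀ x i j)) (hu₀ : ContDiff ℝ ∞ u₀)
    (hQ₀H1 : ActiveLC.h1Norm Q₀ < ⊤) (hu₀L2 : ActiveLC.l2Sq u₀ < ⊤) :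
    ∃ C₁ C₂ C₃ C₄ : ℝ, 0 < C₁ ∧ 0 < C₂ ∧ 0 < C₃ ∧ 0 < C₄ ∧
      ∀ (T : EReal) (Q : ℝ → ActiveLC.E d → ActiveLC.Mat d)
        (u : ℝ → ActiveLC.E d → ActiveLC.E d),
        ActiveLC.IsSmoothSolution a b c κ μ lam Γ T Q₀ u₀ Q u →
        ∀ t : ℝ, 0 < t → (t : EReal) < T →
          ActiveLC.h1Norm (Q t)
              ≤ ENNReal.ofReal (C₁ * Real.exp (C₂ * t))
                * (ActiveLC.h1Norm Q₀ ^ 2 + ActiveLC.l2Sq u₀) ∧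
          ENNReal.ofReal (1 / 2) * ActiveLC.l2Sq (u t)
              + ENNReal.ofReal (μ / 4) * ∫⁻ s in Ioo 0 t, ActiveLC.gradL2Sq (u s)
            ≤ ENNReal.ofReal C₃ * (ActiveLC.h1Norm Q₀ ^ 2 + ActiveLC.l2Sq u₀)
                * ENNReal.ofReal (Real.exp (C₂ * t))
              + ENNReal.ofReal C₄ := by
  have hfin : ActiveLC.h1Sq Q₀ < ⊤ := by
    rw [← ActiveLC.h1Norm_sq]; exact ENNReal.pow_lt_top hQ₀H1
  obtain ⟨K, hK, hdata⟩ := ActiveLC.exists_initial_energy_le hd a b hc hQ₀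
    (contDiff_euclidean.1 hu₀) hfin
  rw [ActiveLC.h1Norm_sq]
  set N := ActiveLC.h1Sq Q₀ + ActiveLC.l2Sq u₀ with hN
  have hNfin : N ≠ ⊤ := (ENNReal.add_lt_top.2 ⟨hfin, hu₀L2⟩).ne
  set n := N.toReal with hn
  have hn0 : 0 ≤ n := ENNReal.toReal_nonneg
  have hNn : N = ENNReal.ofReal n := (ENNReal.ofReal_toReal hNfin).symm
  set r := ActiveLC.rate κ μ lam Γ (ActiveLC.coerc a b c) c with hr
  have hr0 : 0 ≤ r := by unfold r ActiveLC.rate; positivity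
  refine ⟨√(2 * K / n) + 1, r + 1, K, 1, by positivity, by positivity, hK, one_pos,
    fun T Q u h t ht0 htT => ?_⟩
  have hsym : ∀ x, (Q₀ x).IsSymm := fun x => by
    rw [← h.init_Q x]
    exact h.symm_Q 0 ⟨le_rfl, lt_trans (by exact_mod_cast ht0) htT⟩ x
  have hE := h.energy_le hd hc hμ hΓ ht0 htT
  have hexp : Real.exp (r * t) ≤ Real.exp ((r + 1) * t) := Real.exp_le_exp.2 (by nlinarith)
  have hbound : ENNReal.ofReal (Real.exp (r * t))
      * ∫⁻ x, ENNReal.ofReal (ActiveLC.energyDensity a b c Q₀ u₀ x)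
      ≤ ENNReal.ofReal (Real.exp ((r + 1) * t)) * (ENNReal.ofReal K * N) :=
    mul_le_mul' (ENNReal.ofReal_le_ofReal hexp) (hdata hsym)
  have hE' := hE.trans hbound
  set e := Real.exp ((r + 1) * t) with he
  have he1 : 1 ≤ e := Real.one_le_exp (by positivity)
  constructor
  · -- for `N = 0` the field `Q` vanishes; otherwise `√N` is absorbed by the constant
    have h1 : ENNReal.ofReal (1 / 2) * ActiveLC.h1Sq (Q t) ≤ ENNReal.ofReal (e * (K * n)) := by
      rw [ENNReal.ofReal_mul (by positivity), ENNReal.ofReal_mul hK.le, ← hNn]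
      exact le_trans (le_add_self.trans le_self_add) hE'
    have h2 : ActiveLC.h1Sq (Q t) ≤ ENNReal.ofReal (2 * (e * (K * n))) := by
      calc ActiveLC.h1Sq (Q t)
          = ENNReal.ofReal 2 * (ENNReal.ofReal (1 / 2) * ActiveLC.h1Sq (Q t)) := by
            rw [← mul_assoc, ← ENNReal.ofReal_mul (by norm_num)]; norm_num
        _ ≤ ENNReal.ofReal 2 * ENNReal.ofReal (e * (K * n)) := by gcongr
        _ = _ := by rw [← ENNReal.ofReal_mul (by norm_num)]
    have h3 : √(2 * (e * (K * n))) ≤ (√(2 * K / n) + 1) * e * n := by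
      rcases hn0.eq_or_lt with h0 | h0
      · rw [← h0]; simp
      · have h4 : √(2 * (e * (K * n))) ≤ √(2 * K / n) * (e * n) := by
          refine Real.sqrt_le_iff.2 ⟨by positivity, ?_⟩
          rw [mul_pow, Real.sq_sqrt (by positivity)]
          have h5 : 2 * K / n * (e * n) ^ 2 = 2 * (e * (K * n)) * e := by field_simp
          rw [h5]
          exact le_mul_of_one_le_right (by positivity) he1
        nlinarith [mul_pos (lt_of_lt_of_le one_pos he1) h0]
    rw [hNn, ← ENNReal.ofReal_mul (by positivity)]
    calc ActiveLC.h1Norm (Q t) ≤ ENNReal.ofReal (2 * (e * (K * n))) ^ (1 / 2 : ℝ) :=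
          ENNReal.rpow_le_rpow h2 (by norm_num)
      _ = ENNReal.ofReal (√(2 * (e * (K * n)))) := by
          rw [ENNReal.ofReal_rpow_of_nonneg (by positivity) (by norm_num), Real.sqrt_eq_rpow]
      _ ≤ _ := ENNReal.ofReal_le_ofReal h3
  · calc ENNReal.ofReal (1 / 2) * ActiveLC.l2Sq (u t)
          + ENNReal.ofReal (μ / 4) * ∫⁻ s in Ioo 0 t, ActiveLC.gradL2Sq (u s)
        ≤ ENNReal.ofReal (1 / 2) * ActiveLC.l2Sq (u t)
          + ENNReal.ofReal (1 / 2) * ActiveLC.h1Sq (Q t)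
          + ENNReal.ofReal (μ / 2) * ∫⁻ s in Ioo 0 t, ActiveLC.gradL2Sq (u s) := by
          gcongr
          · exact le_self_add
          · norm_num
      _ ≤ ENNReal.ofReal e * (ENNReal.ofReal K * N) := hE'
      _ = ENNReal.ofReal K * N * ENNReal.ofReal e := mul_comm _ _
      _ ≤ _ := le_self_add
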